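/- Fix $m\ge 2$. Consider deterministic one-tape machines with finitely many states, some of them accepting, whose tape is infinite to the right only and whose tape alphabet consists of a blank and $m$ non-blank symbols. At the start the input, a word of $n$ non-blank symbols, fills the first $n$ cells, all other cells are blank, and the head is at the first cell. In each step the machine reads the scanned cell and, according to its partial transition function, prescribes the new content of the cell, a head move (left, right or none; a left move from the first cell leaves the head there) and a new state. The only change of a cell that it can make is to write a non-blank symbol into the first blank cell of the tape (so the written portion grows only at its end and never contains a blank); rewriting the present content of a cell is allowed, and a step that would change a cell in any other way is not available and stops the machine. An input is accepted if the run enters an accepting state. Call such a machine an end-writing machine. Let $\langle M,x\rangle\in\{0,1\}^*$ be the standard code of an end-writing machine $M$ and an input $x$: the number of states and the initial state in unary, the list of accepting states, and the transition table with its entries in unary, followed by the symbols of $x$ in unary. Then: 1. (Simulation) There are a deterministic (multi-stack) Turing machine $U$, a function $g:\mathbb N\to\mathbb N$ and a constant $C$, all depending only on $m$, such that $U$ halts on every binary word and decides the acceptance problem $A_m=\{\langle M,x\rangle : M \text{ is an end-writing machine that accepts } x\}$, and such that for every $k$, every end-writing machine $M$ with $k$ states and every input $x$ the run of $U$ on $\langle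 M,x\rangle$ uses at most $g(k)+C\,|x|$ cells. 2. The acceptance problem $A_m$ is in $\mathrm{PSPACE}$. 3. (Non-universality) There is a recursively enumerable language $L$ over the $m$ non-blank symbols such that for no end-writing machine $M$ and no computable map $e$ from words to words does one have, for all words $x$: $x\in L$ if and only if $M$ accepts $e(x)$. In particular (take $e$ to be the identity) no end-writing machine accepts $L$. -/

import Mathlib

open Turing

namespace WriteOnce

/-! ## Write-once machines that write only at the end of the tape

The non-blank symbols are the elements of `Fin m`; a cell content is an element of
`Option (Fin m)`, with `none` for the blank. The tape is infinite to the right only. -/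

/-- Head moves. -/
inductive Move
  | left
  | stay
  | right
  deriving DecidableEq

/-- The new head position; a move to the left from the leftmost cell leaves the head there. -/
def Move.apply : Move → ℕ → ℕ
  | .left, i => i - 1
  | .stay, i => i
  | .right, i => i + 1

/-- A deterministic one-tape machine with `k` states and `m` non-blank tape symbols. The transition
function sends a state and the scanned cell content to the new content of the cell, the head move
and the new state; the value `none` means that the machine halts. -/
structure Machine (m k : ℕ) where
  start : Fin k
  accept : Fin k → Bool
  trans : Fin k → Option (Fin m) → Option (Option (Fin m) × Move × Fin k)

/-- A configuration. The tape has no blank between non-blank cells, so it is given by the word `w`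
of its non-blank cells: the content of cell `i` is `w[i]?`, which is blank from `i = w.length` on.
The head may be at any cell, also at any of the blank ones. -/
structure Cfg (m k : ℕ) where
  state : Fin k
  head : ℕ
  tape : List (Fin m)

/-- The result of trying to put the content `s` into cell `i`. Leaving the cell as it is is always
allowed. The only allowed change is to write a non-blank symbol into the first blank cell. Other
changes (erasing or overwriting a non-blank cell, writing behind the first blank cell) are not
available to the machine. -/
def write {m : ℕ} (w : List (Fin m)) (i : ℕ) (s : Option (Fin m)) : Option (List (Fin m)) :=
  if s = w[i]? then some w
  else match s with
    | none => none
    | some a => if i = w.length then some (w ++ [a]) else none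

namespace Machine

variable {m k : ℕ}

/-- One step; `none` if the machine halts or if the write it asks for is not available. -/
def step (M : Machine m k) (c : Cfg m k) : Option (Cfg m k) :=
  match M.trans c.state c.tape[c.head]? with
  | none => none
  | some (s, d, q) => (write c.tape c.head s).map fun w => ⟨q, d.apply c.head, w⟩

/-- At the start the input fills the first cells of the tape and the head is at the first cell. -/
def init (M : Machine m k) (x : List (Fin m)) : Cfg m k := ⟨M.start, 0, x⟩

/-- The machine accepts an input if its run enters an accepting state. -/
def Accepts (M : Machine m k) (x : List (Fin m)) : Prop :=
  ∃ c, StateTransition.Reaches M.step (M.init x) c ∧ M.accept c.state = true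

end Machine

/-! ## Encoding of machines and inputs by binary words -/

/-- The self-delimiting unary code of a natural number. -/
def unary (n : ℕ) : List Bool := List.replicate n true ++ [false]

def encodeCell {m : ℕ} : Option (Fin m) → List Bool
  | none => unary 0
  | some a => unary (a.val + 1)

def encodeMove : Move → List Bool
  | .left => unary 0
  | .stay => unary 1
  | .right => unary 2

def encodeEntry {m k : ℕ} : Option (Option (Fin m) × Move × Fin k) → List Bool
  | none => [false]
  | some (s, d, q) => true :: (encodeCell s ++ encodeMove d ++ unary q.val)

/-- The entries of the transition table for the state `q`: first for the blank, then for the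
non-blank symbols in their order. -/
def encodeRow {m k : ℕ} (M : Machine m k) (q : Fin k) : List Bool :=
  encodeEntry (M.trans q none) ++
    (List.finRange m).flatMap fun a => encodeEntry (M.trans q (some a))

/-- Number of states, initial state, accepting states, transition table. -/
def encodeMachine {m k : ℕ} (M : Machine m k) : List Bool :=
  unary k ++ unary M.start.val ++ (List.finRange k).map M.accept ++
    (List.finRange k).flatMap (encodeRow M)

def encodeInput {m : ℕ} (x : List (Fin m)) : List Bool :=
  x.flatMap fun a => unary a.val

/-- The code of a machine together with an input. -/
def encode {m k : ℕ} (M : Machine m k) (x : List (Fin m)) : List Bool :=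
  encodeMachine M ++ encodeInput x

/-! The encoding is injective. -/

theorem unary_append_inj : ∀ {a b : ℕ} {u v : List Bool},
    unary a ++ u = unary b ++ v → a = b ∧ u = v
  | 0, 0, u, v, h => by simpa [unary] using h
  | 0, b + 1, u, v, h => by simp [unary, List.replicate_succ] at h
  | a + 1, 0, u, v, h => by simp [unary, List.replicate_succ] at h
  | a + 1, b + 1, u, v, h => by
    have h' : unary a ++ u = unary b ++ v := by
      simpa [unary, List.replicate_succ] using h
    have := unary_append_inj h'
    exact ⟨by rw [this.1], this.2⟩

theorem encodeCell_append_inj {m : ℕ} {a b : Option (Fin m)} {u v : List Bool}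
    (h : encodeCell a ++ u = encodeCell b ++ v) : a = b ∧ u = v := by
  rcases a with _ | a <;> rcases b with _ | b <;>
    simp only [encodeCell] at h <;> have := unary_append_inj h <;> simp at this ⊢
  · exact this
  · exact ⟨Fin.ext this.1, this.2⟩

theorem encodeMove_append_inj {a b : Move} {u v : List Bool}
    (h : encodeMove a ++ u = encodeMove b ++ v) : a = b ∧ u = v := by
  cases a <;> cases b <;> simp only [encodeMove] at h <;>
    have := unary_append_inj h <;> simp at this ⊢ <;> exact this

theorem encodeEntry_append_inj {m k : ℕ} {a b : Option (Option (Fin m) × Move × Fin k)}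
    {u v : List Bool} (h : encodeEntry a ++ u = encodeEntry b ++ v) : a = b ∧ u = v := by
  rcases a with _ | ⟨s, d, q⟩ <;> rcases b with _ | ⟨s', d', q'⟩ <;>
    simp [encodeEntry] at h ⊢
  · exact h
  · obtain ⟨hs, h1⟩ := encodeCell_append_inj h
    obtain ⟨hd, h2⟩ := encodeMove_append_inj h1
    obtain ⟨hq, h3⟩ := unary_append_inj h2
    exact ⟨⟨hs, hd, Fin.ext hq⟩, h3⟩

theorem flatMap_append_inj {α β : Type} (f g : α → List β) (l : List α)
    (hfg : ∀ a ∈ l, ∀ u v, f a ++ u = g a ++ v → f a = g a ∧ u = v) :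
    ∀ u v, l.flatMap f ++ u = l.flatMap g ++ v → (∀ a ∈ l, f a = g a) ∧ u = v := by
  induction l with
  | nil => simp
  | cons a l ih =>
    intro u v h
    simp only [List.flatMap_cons, List.append_assoc] at h
    obtain ⟨h1, h2⟩ := hfg a (by simp) _ _ h
    obtain ⟨h3, h4⟩ := ih (fun b hb => hfg b (by simp [hb])) _ _ h2
    exact ⟨by simpa [h1] using h3, h4⟩

theorem encodeRow_append_inj {m k : ℕ} {M N : Machine m k} {q : Fin k} {u v : List Bool}
    (h : encodeRow M q ++ u = encodeRow N q ++ v) : M.trans q = N.trans q ∧ u = v := by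
  simp only [encodeRow, List.append_assoc] at h
  obtain ⟨h1, h2⟩ := encodeEntry_append_inj h
  obtain ⟨h3, h4⟩ := flatMap_append_inj _ _ _ (fun a _ u v h => by
    obtain ⟨h, h'⟩ := encodeEntry_append_inj h
    exact ⟨by rw [h], h'⟩) _ _ h2
  refine ⟨funext fun s => ?_, h4⟩
  rcases s with _ | a
  · exact h1
  · have := h3 a (List.mem_finRange a)
    exact (encodeEntry_append_inj (u := []) (v := []) (by simpa using this)).1

theorem encodeInput_inj {m : ℕ} : ∀ {x y : List (Fin m)}, encodeInput x = encodeInput y → x = y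
  | [], [], _ => rfl
  | [], b :: y, h => by simp [encodeInput, unary] at h
  | a :: x, [], h => by simp [encodeInput, unary] at h
  | a :: x, b :: y, h => by
    obtain ⟨h1, h2⟩ := unary_append_inj (show unary a.val ++ encodeInput x =
      unary b.val ++ encodeInput y by simpa [encodeInput] using h)
    rw [Fin.ext h1, encodeInput_inj h2]

/-- A binary word encodes at most one pair of a machine and an input. -/
theorem encode_inj {m k k' : ℕ} {M : Machine m k} {M' : Machine m k'} {x x' : List (Fin m)}
    (h : encode M x = encode M' x') : k = k' ∧ HEq M M' ∧ x = x' := by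
  simp only [encode, encodeMachine, List.append_assoc] at h
  obtain ⟨rfl, h⟩ := unary_append_inj h
  obtain ⟨hs, h⟩ := unary_append_inj h
  obtain ⟨ha, h⟩ := List.append_inj h (by simp)
  obtain ⟨ht, h⟩ := flatMap_append_inj _ _ _ (fun a _ u v h => by
    obtain ⟨h, h'⟩ := encodeRow_append_inj h
    exact ⟨by simp [encodeRow, h], h'⟩) _ _ h
  refine ⟨rfl, heq_of_eq ?_, encodeInput_inj h⟩
  obtain ⟨s, a, t⟩ := M
  obtain ⟨s', a', t'⟩ := M'
  have e1 : s = s' := Fin.ext hs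
  have e2 : a = a' := funext fun q => by
    simpa using (List.map_inj_left.1 ha) q (List.mem_finRange q)
  have e3 : t = t' := funext fun q =>
    (encodeRow_append_inj (u := []) (v := []) (by simpa using ht q (List.mem_finRange q))).1
  subst e1 e2 e3
  rfl

/-- The acceptance problem for machines with `m` non-blank symbols: the set of codes of pairs of a
machine (with any number of states) and an input that the machine accepts. -/
def acceptanceProblem (m : ℕ) : Language Bool :=
  {w | ∃ (k : ℕ) (M : Machine m k) (x : List (Fin m)), w = encode M x ∧ M.Accepts x}

/-! ## Space complexity

The model of computation is Mathlib's deterministic multi-stack Turing machine `FinTM2`; here with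
binary input and binary output. -/

/-- The number of cells that a configuration uses: the total length of all stacks, the input
stack included. -/
def spaceUsed (tm : FinTM2) (c : tm.Cfg) : ℕ :=
  letI := tm.kFin
  ∑ i : tm.K, (c.stk i).length

/-- `c` occurs in the run of `U` on the input `w`. -/
def Occurs (U : TM2ComputableAux Bool Bool) (w : List Bool) (c : U.tm.Cfg) : Prop :=
  StateTransition.Reaches U.tm.step (initList U.tm (w.map U.inputAlphabet.symm)) c

/-- `U` halts on every input `w`, and then its output stack holds one bit, which tells whether
`w ∈ L`. -/
def Decides (U : TM2ComputableAux Bool Bool) (L : Language Bool) : Prop :=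
  ∀ w : List Bool, ∃ (c : U.tm.Cfg) (b : Bool), Occurs U w c ∧ c.l = none ∧
    c.stk U.tm.k₁ = [U.outputAlphabet.symm b] ∧ (b = true ↔ w ∈ L)

/-- The run of `U` on the input `w` never uses more than `s` cells. -/
def RunsInSpace (U : TM2ComputableAux Bool Bool) (w : List Bool) (s : ℕ) : Prop :=
  ∀ c : U.tm.Cfg, Occurs U w c → spaceUsed U.tm c ≤ s

/-- The class of binary languages that are decidable in polynomial space. -/
def PSPACE : Set (Language Bool) :=
  {L | ∃ (U : TM2ComputableAux Bool Bool) (p : Polynomial ℕ),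
    Decides U L ∧ ∀ w : List Bool, RunsInSpace U w (p.eval w.length)}

end WriteOnce

/-! The written part of the tape grows only at its end. Hence, between two visits of the first blank
cell, the machine moves either on a fixed word or on blank cells that it cannot fill. All that
matters about the written word is its behaviour: the function that sends the state in which the head
enters the word at its last cell to the state in which it leaves to the right, with the rejecting
state `0` as the value when it never leaves. The behaviour of a word followed by `a` depends only on
`a` and the behaviour of the word, as the least fixed point of `Table.wordFun`. The blank half-line
behind the first blank cell has a behaviour too, `Table.blank`, which is the same at every position.
Both fixed points are reached by as many iterations as there are states (`flat_iterate_fixed`), with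
the state `0` as the undefined value.

The run as seen from the first blank cell is therefore the orbit of a pair (state, behaviour) under
`Table.top`. If the normal form has `n + 2` states, there are `(n + 2) ^ (n + 3)` such pairs, and
acceptance is visible after that many rounds or any larger number (`Table.Normal.accepts_iff`). The
tape may grow without bound, but the procedure never stores it.

Space: a pair, the transition table and a binary counter with `(n + 2) * (n + 2)` digits take room
quadratic in the number of states, and the input is consumed symbol by symbol. Only three stacks
depend on the input length, and they do so linearly. To obtain a Turing machine, the procedure is
written in a small structured language `Prog` whose big-step semantics `Runs` carries a capacity for
each stack; `Runs.arrives` and `machine_spec` turn such a run into a run of the compiled machine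
with the same bounds. `runs_mainProg` is the correctness of the whole program. Parsing rejects every
word that is not a code.

Non-universality: for a fixed machine the procedure is a finite automaton reading the input, so
acceptance is computable, whereas the halting problem, coded in the lengths of words, is recursively
enumerable and not many-one reducible to a computable predicate. -/

namespace WriteOnce

/-! ## A structured programming language on stacks -/

/-- Programs that work on stacks indexed by `K` with symbols from `G`. -/
inductive Prog (K G : Type) : Type
  | skip : Prog K G
  | push (i : K) (a : G) : Prog K G
  /-- Stop the whole computation with the answer `b`. -/
  | halt (b : Bool) : Prog K G
  | seq (p q : Prog K G) : Prog K G
  /-- Pop the stack `i` and branch on the popped symbol. -/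
  | case (i : K) (f : Option G → Prog K G) : Prog K G
  /-- As long as the top symbol of the stack `i` satisfies `c`, pop it and run `f` on it. -/
  | loop (i : K) (c : G → Bool) (f : G → Prog K G) : Prog K G

namespace Prog

variable {K G : Type}

/-- The program points of a program. -/
def Lab : Prog K G → Type
  | skip => Unit
  | push _ _ => Unit
  | halt _ => Unit
  | seq p q => p.Lab ⊕ q.Lab
  | case _ f => Option (Σ a, (f a).Lab)
  | loop _ _ f => Option (Σ a, (f a).Lab)

theorem finite_lab [Finite G] (p : Prog K G) : Finite p.Lab := by
  induction p with
  | skip => exact inferInstanceAs (Finite Unit)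
  | push => exact inferInstanceAs (Finite Unit)
  | halt => exact inferInstanceAs (Finite Unit)
  | seq p q _ _ => exact inferInstanceAs (Finite (p.Lab ⊕ q.Lab))
  | case _ f _ => exact inferInstanceAs (Finite (Option (Σ a, (f a).Lab)))
  | loop _ _ f _ => exact inferInstanceAs (Finite (Option (Σ a, (f a).Lab)))

/-- The first program point. -/
def entry : (p : Prog K G) → p.Lab
  | skip => ()
  | push _ _ => ()
  | halt _ => ()
  | seq p _ => Sum.inl p.entry
  | case _ _ => none
  | loop _ _ _ => none

/-- The stack alphabets: a stack of bits for input and output, and the stacks of the program. -/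
abbrev Alph (K G : Type) : Option K → Type
  | none => Bool
  | some _ => G

/-- The statement at a program point. -/
def code {Λ : Type} : (p : Prog K G) → (p.Lab → Λ) → Λ → p.Lab → TM2.Stmt (Alph K G) Λ (Option G)
  | skip, _, next, _ => .goto fun _ => next
  | push i a, _, next, _ => .push (some i) (fun _ => a) (.goto fun _ => next)
  | halt b, _, _, _ => .push none (fun _ => b) .halt
  | seq p q, e, _, .inl l => p.code (fun l => e (.inl l)) (e (.inr q.entry)) l
  | seq _ q, e, next, .inr l => q.code (fun l => e (.inr l)) next l
  | case i f, e, _, none =>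
      .pop (some i) (fun _ x => x) (.goto fun x => e (some ⟨x, (f x).entry⟩))
  | case _ f, e, next, some ⟨a, l⟩ => (f a).code (fun l => e (some ⟨a, l⟩)) next l
  | loop i c f, e, next, none =>
      .peek (some i) (fun _ x => x) (.branch (fun x => x.any c)
        (.pop (some i) (fun _ x => x) (.goto fun x => match x with
          | some a => e (some ⟨a, (f a).entry⟩)
          | none => next))
        (.goto fun _ => next))
  | loop _ _ f, e, _, some ⟨a, l⟩ => (f a).code (fun l => e (some ⟨a, l⟩)) (e none) l

/-- A run all of whose configurations satisfy `P`. -/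
def Path {C : Type} (step : C → Option C) (P : C → Prop) (c c' : C) : Prop :=
  Relation.ReflTransGen (fun a b => b ∈ step a ∧ P a ∧ P b) c c'

theorem Path.reaches {C : Type} {step : C → Option C} {P : C → Prop} {c c' : C}
    (h : Path step P c c') : StateTransition.Reaches step c c' :=
  Relation.ReflTransGen.mono (r := fun a b => b ∈ step a ∧ P a ∧ P b) (fun _ _ h => h.1) _ _ h

theorem Path.mono {C : Type} {step : C → Option C} {P Q : C → Prop} {c c' : C}
    (h : Path step P c c') (hPQ : ∀ c, P c → Q c) : Path step Q c c' :=
  Relation.ReflTransGen.mono (r := fun a b => b ∈ step a ∧ P a ∧ P b)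
    (fun _ _ h => ⟨h.1, hPQ _ h.2.1, hPQ _ h.2.2⟩) _ _ h

/-- On the way to a halting configuration a deterministic machine visits only the path. -/
theorem Path.forall_reaches {C : Type} {step : C → Option C} {P : C → Prop} {c c' d : C}
    (h : Path step P c c') (hP : P c) (hc' : step c' = none)
    (hd : StateTransition.Reaches step c d) : P d := by
  induction h using Relation.ReflTransGen.head_induction_on with
  | refl =>
    rcases Relation.ReflTransGen.cases_head hd with rfl | ⟨e, he, _⟩
    · exact hP
    · simp [hc'] at he
  | head hab _ ih =>
    rcases Relation.ReflTransGen.cases_head hd with rfl | ⟨e, he, hed⟩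
    · exact hP
    · have : e = _ := Option.some_injective _ ((Option.mem_def.1 he).symm.trans hab.1)
      subst this
      exact ih hab.2.2 hed

/-- The stacks of the machine: the input and output stack and the stacks of the program. -/
def stks (o : List Bool) (S : K → List G) : ∀ i : Option K, List (Alph K G i)
  | none => o
  | some i => S i

@[simp] theorem stks_none (o : List Bool) (S : K → List G) : stks o S none = o := rfl

@[simp] theorem stks_some (o : List Bool) (S : K → List G) (i : K) : stks o S (some i) = S i := rfl

/-- The capacity condition on the configurations. -/
def Fits {Λ : Type} (n : ℕ) (cap : K → ℕ) (c : TM2.Cfg (Alph K G) Λ (Option G)) : Prop :=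
  (c.stk none).length ≤ n ∧ ∀ i, (c.stk (some i)).length ≤ cap i

/-! ### Big-step semantics and correctness of the compilation -/

variable [DecidableEq K]

/-- Big-step semantics: the program started on the stacks `S` ends with new stacks or with an answer,
and no stack `i` is ever pushed beyond the length `cap i`. -/
inductive Runs (cap : K → ℕ) : Prog K G → (K → List G) → (K → List G) ⊕ Bool → Prop
  | skip (S) : Runs cap .skip S (.inl S)
  | push {i a S} (h : (S i).length < cap i) :
      Runs cap (.push i a) S (.inl (Function.update S i (a :: S i)))
  | halt (b S) : Runs cap (.halt b) S (.inr b)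
  | seq {p q S S' r} (hp : Runs cap p S (.inl S')) (hq : Runs cap q S' r) : Runs cap (.seq p q) S r
  | seq_halt {p q S b} (hp : Runs cap p S (.inr b)) : Runs cap (.seq p q) S (.inr b)
  | case {i f S r} (h : Runs cap (f (S i).head?) (Function.update S i (S i).tail) r) :
      Runs cap (.case i f) S r
  | loop_done {i c f S} (h : (S i).head?.any c = false) : Runs cap (.loop i c f) S (.inl S)
  | loop_step {i c f S S' r a l} (h : S i = a :: l) (hc : c a = true)
      (hf : Runs cap (f a) (Function.update S i l) (.inl S'))
      (hl : Runs cap (.loop i c f) S' r) : Runs cap (.loop i c f) S r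
  | loop_halt {i c f S b a l} (h : S i = a :: l) (hc : c a = true)
      (hf : Runs cap (f a) (Function.update S i l) (.inr b)) : Runs cap (.loop i c f) S (.inr b)

@[simp] theorem update_stks_none (o o' : List Bool) (S : K → List G) :
    Function.update (stks o S) none o' = stks o' S := by
  funext i; cases i <;> simp

@[simp] theorem update_stks_some (o : List Bool) (S : K → List G) (i : K) (l : List G) :
    Function.update (stks o S) (some i) l = stks o (Function.update S i l) := by
  funext j
  cases j with
  | none => simp
  | some j => by_cases h : j = i
              · subst h; simp
              · rw [Function.update_of_ne (by simpa using h)]; simp [h]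

/-- Only `push` lengthens a stack, and its rule asks for a free cell, so the capacity bound is an
invariant. The induction in `Runs.arrives` needs it for the second part of a sequence and for the
rest of a loop. -/
theorem Runs.fits {cap : K → ℕ} {p : Prog K G} {S r} (h : Runs cap p S r) :
    (∀ i, (S i).length ≤ cap i) → ∀ S', r = .inl S' → ∀ i, (S' i).length ≤ cap i := by
  have key : ∀ (S : K → List G) (i : K) (l : List G), (∀ j, (S j).length ≤ cap j) →
      l.length ≤ cap i → ∀ j, ((Function.update S i l) j).length ≤ cap j := by
    intro S i l hS hl j
    by_cases hj : j = i
    · subst hj; simpa using hl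
    · simpa [hj] using hS j
  induction h with
  | skip => rintro hS _ ⟨⟩; exact hS
  | push h => rintro hS _ ⟨⟩; exact key _ _ _ hS (by simpa using h)
  | halt => rintro _ _ ⟨⟩
  | seq _ _ ih1 ih2 => intro hS S' e; exact ih2 (ih1 hS _ rfl) _ e
  | seq_halt => rintro _ _ ⟨⟩
  | case _ ih =>
    intro hS S' e
    refine ih (key _ _ _ hS ?_) _ e
    rw [List.length_tail]
    exact (Nat.sub_le _ _).trans (hS _)
  | loop_done => rintro hS _ ⟨⟩; exact hS
  | @loop_step i c f S S' r a l h _ _ _ ih1 ih2 =>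
    intro hS S' e
    refine ih2 (ih1 (key _ _ _ hS ?_) _ rfl) _ e
    have := hS i
    rw [h] at this
    simp at this
    omega
  | loop_halt => rintro _ _ ⟨⟩

/-- From the label `l` and the stacks `S` the machine gets to the outcome `r`. -/
def Arrives {Λ : Type} (n : ℕ) (cap : K → ℕ) (m : Λ → TM2.Stmt (Alph K G) Λ (Option G))
    (l next : Λ) (v : Option G) (S : K → List G) : (K → List G) ⊕ Bool → Prop
  | .inl S' => ∃ v', Path (TM2.step m) (Fits n cap) ⟨some l, v, stks [] S⟩
      ⟨some next, v', stks [] S'⟩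
  | .inr b => ∃ v' S', Path (TM2.step m) (Fits n cap) ⟨some l, v, stks [] S⟩
      ⟨none, v', stks [b] S'⟩

theorem Arrives.trans {Λ : Type} {n : ℕ} {cap : K → ℕ} {m : Λ → TM2.Stmt (Alph K G) Λ (Option G)}
    {l l' next : Λ} {v v' : Option G} {S S' : K → List G} {r}
    (h : Path (TM2.step m) (Fits n cap) ⟨some l, v, stks [] S⟩ ⟨some l', v', stks [] S'⟩)
    (h' : Arrives n cap m l' next v' S' r) : Arrives n cap m l next v S r := by
  rcases r with S2 | b
  · obtain ⟨v2, h2⟩ := h'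
    exact ⟨v2, Relation.ReflTransGen.trans h h2⟩
  · obtain ⟨v2, S2, h2⟩ := h'
    exact ⟨v2, S2, Relation.ReflTransGen.trans h h2⟩

theorem Path.single_of_step {Λ : Type} {n : ℕ} {cap : K → ℕ}
    {m : Λ → TM2.Stmt (Alph K G) Λ (Option G)} {c c' : TM2.Cfg (Alph K G) Λ (Option G)}
    (h : TM2.step m c = some c') (hc : Fits n cap c) (hc' : Fits n cap c') :
    Path (TM2.step m) (Fits n cap) c c' :=
  Relation.ReflTransGen.single ⟨h, hc, hc'⟩

theorem length_update_le {cap : K → ℕ} {S : K → List G} {i : K} {l : List G}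
    (hS : ∀ i, (S i).length ≤ cap i) (hl : l.length ≤ cap i) (j : K) :
    (Function.update S i l j).length ≤ cap j := by
  by_cases hj : j = i
  · subst hj; simpa using hl
  · simpa [hj] using hS j

/-- The compiled program performs the run. -/
theorem Runs.arrives {cap : K → ℕ} {n : ℕ} (hn : 1 ≤ n) {p : Prog K G} {S r} (h : Runs cap p S r) :
    ∀ (_ : ∀ i, (S i).length ≤ cap i)
    {Λ : Type} (m : Λ → TM2.Stmt (Alph K G) Λ (Option G)) (e : p.Lab → Λ) (next : Λ)
    (_ : ∀ l, m (e l) = p.code e next l) (v : Option G),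
    Arrives n cap m (e p.entry) next v S r := by
  -- The machine, the embedding `e` of program points and the exit `next` stay quantified in the
  -- induction, since each subprogram is compiled with its own embedding and exit.
  induction h with
  | skip S =>
    intro hS Λ m e next hm v
    refine ⟨v, Path.single_of_step ?_ ⟨by simp, hS⟩ ⟨by simp, hS⟩⟩
    rw [TM2.step, hm]
    simp [code]
  | @push i a S h =>
    intro hS Λ m e next hm v
    refine ⟨v, Path.single_of_step ?_ ⟨by simp, hS⟩
      ⟨by simp, length_update_le hS (by simpa using h)⟩⟩
    rw [TM2.step, hm]
    simp [code]
  | halt b S =>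
    intro hS Λ m e next hm v
    refine ⟨v, S, Path.single_of_step ?_ ⟨by simp, hS⟩ ⟨by simpa using hn, hS⟩⟩
    rw [TM2.step, hm]
    simp [code]
  | @seq p q S S' r hp hq ih1 ih2 =>
    intro hS Λ m e next hm v
    obtain ⟨v', h1⟩ := ih1 hS m (fun l => e (.inl l)) (e (.inr q.entry)) (fun l => hm (.inl l)) v
    exact Arrives.trans h1
      (ih2 (hp.fits hS _ rfl) m (fun l => e (.inr l)) next (fun l => hm (.inr l)) v')
  | @seq_halt p q S b hp ih =>
    intro hS Λ m e next hm v
    exact ih hS m (fun l => e (.inl l)) (e (.inr q.entry)) (fun l => hm (.inl l)) v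
  | @case i f S r h ih =>
    intro hS Λ m e next hm v
    have hS' := length_update_le (cap := cap) (i := i) (l := (S i).tail) hS
      (by rw [List.length_tail]; exact (Nat.sub_le _ _).trans (hS _))
    refine Arrives.trans (S' := Function.update S i (S i).tail) (Path.single_of_step ?_ ⟨by simp, hS⟩ ⟨by simp, hS'⟩)
      (ih hS' m (fun l => e (some ⟨_, l⟩)) next (fun l => hm (some ⟨_, l⟩)) (S i).head?)
    rw [TM2.step, hm]
    simp [code, entry]
  | @loop_done i c f S h =>
    intro hS Λ m e next hm v
    refine ⟨(S i).head?, Path.single_of_step ?_ ⟨by simp, hS⟩ ⟨by simp, hS⟩⟩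
    rw [TM2.step, hm]
    simp [code, entry, h]
  | @loop_step i c f S S' r a l h hc hf hl ih1 ih2 =>
    intro hS Λ m e next hm v
    have hS' := length_update_le (cap := cap) (i := i) (l := l) hS
      (by have := hS i; rw [h] at this; simp at this; omega)
    -- The exit of the body is the loop test `e none`, so the second induction hypothesis can take
    -- over at the same program point.
    obtain ⟨v', h1⟩ := ih1 hS' m (fun l => e (some ⟨_, l⟩)) (e none) (fun l => hm (some ⟨_, l⟩))
      (some a)
    refine Arrives.trans (S' := Function.update S i l) (Path.single_of_step ?_ ⟨by simp, hS⟩ ⟨by simp, hS'⟩)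
      (Arrives.trans h1 (ih2 (hf.fits hS' _ rfl) m e next hm v'))
    rw [TM2.step, hm]
    simp [code, entry, h, hc]
  | @loop_halt i c f S b a l h hc hf ih =>
    intro hS Λ m e next hm v
    have hS' := length_update_le (cap := cap) (i := i) (l := l) hS
      (by have := hS i; rw [h] at this; simp at this; omega)
    obtain h1 := ih hS' m (fun l => e (some ⟨_, l⟩)) (e none) (fun l => hm (some ⟨_, l⟩))
      (some a)
    refine Arrives.trans (S' := Function.update S i l) (r := .inr b) (Path.single_of_step ?_ ⟨by simp, hS⟩ ⟨by simp, hS'⟩) h1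
    rw [TM2.step, hm]
    simp [code, entry, h, hc]

/-- The statements of the machine that moves its input (in reversed order) to the stack `i₀` and then
runs the program `p`. -/
def machineCode (p : Prog K G) (i₀ : K) (emb : Bool → G) :
    Option p.Lab → TM2.Stmt (Alph K G) (Option p.Lab) (Option G)
  | none => .pop none (fun _ x => x.map emb) (.branch (fun x => x.isSome)
      (.push (some i₀) (fun x => x.getD (emb false)) (.goto fun _ => none))
      (.goto fun _ => some p.entry))
  | some l => p.code some none l

/-- The Turing machine of a program. -/
noncomputable def machine [Fintype K] [Finite G] (p : Prog K G) (i₀ : K) (emb : Bool → G) :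
    TM2ComputableAux Bool Bool where
  tm :=
    { K := Option K
      k₀ := none
      k₁ := none
      Γ := Alph K G
      Λ := Option p.Lab
      main := none
      ΛFin := by
        have := p.finite_lab
        exact Fintype.ofFinite _
      σ := Option G
      initialState := none
      σFin := Fintype.ofFinite _
      Γk₀Fin := inferInstanceAs (Fintype Bool)
      m := p.machineCode i₀ emb }
  inputAlphabet := Equiv.refl Bool
  outputAlphabet := Equiv.refl Bool

/-- Each round moves one symbol, so `w.length + u.length` is constant and bounds both stacks.
Loading reverses the input; the program itself has to undo this. -/
theorem machineCode_load (p : Prog K G) (i₀ : K) (emb : Bool → G) {n : ℕ} {cap : K → ℕ}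
    (hi : n ≤ cap i₀) (S : K → List G) (hS : ∀ i ≠ i₀, (S i).length ≤ cap i) :
    ∀ (w : List Bool) (u : List G), w.length + u.length ≤ n → ∀ v : Option G,
    ∃ v', Path (TM2.step (p.machineCode i₀ emb)) (Fits n cap)
      ⟨some none, v, stks w (Function.update S i₀ u)⟩
      ⟨some (some p.entry), v',
        stks [] (Function.update S i₀ ((w.map emb).reverse ++ u))⟩ := by
  have key : ∀ u : List G, u.length ≤ n → ∀ j, (Function.update S i₀ u j).length ≤ cap j := by
    intro u hu j
    by_cases hj : j = i₀
    · subst hj; simpa using hu.trans hi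
    · simpa [hj] using hS j hj
  intro w
  induction w with
  | nil =>
    intro u hu v
    refine ⟨none, Path.single_of_step ?_ ⟨by simp, key _ (by simpa using hu)⟩
      ⟨by simp, key _ (by simpa using hu)⟩⟩
    simp [machineCode]
  | cons b w ih =>
    intro u hu v
    simp only [List.length_cons] at hu
    obtain ⟨v', h⟩ := ih (emb b :: u) (by simp; omega) (some (emb b))
    refine ⟨v', Relation.ReflTransGen.head ⟨?_, ⟨?_, key _ (by omega)⟩,
      ⟨?_, key (emb b :: u) (by simp; omega)⟩⟩ (by simpa [Path] using h)⟩
    · simp [machineCode]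
    · simp; omega
    · simp; omega

/-- The machine of a program that always halts with an answer. -/
theorem machine_spec [Fintype K] [Finite G] (p : Prog K G) (i₀ : K) (emb : Bool → G)
    (w : List Bool) (b : Bool) (cap : K → ℕ) (hcap : w.length ≤ cap i₀)
    (h : Runs cap p (Function.update (fun _ => []) i₀ (w.map emb).reverse) (.inr b)) :
    (∃ c, Occurs (p.machine i₀ emb) w c ∧ c.l = none ∧
      c.stk (p.machine i₀ emb).tm.k₁ = [(p.machine i₀ emb).outputAlphabet.symm b]) ∧
    RunsInSpace (p.machine i₀ emb) w (w.length + 1 + ∑ i, cap i) := by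
  have hS : ∀ i, (Function.update (fun _ => []) i₀ (w.map emb).reverse i).length ≤ cap i :=
    length_update_le (by simp) (by simpa using hcap)
  have hfit {c : TM2.Cfg (Alph K G) (Option p.Lab) (Option G)} (hc : Fits (w.length + 1) cap c) :
      spaceUsed (p.machine i₀ emb).tm c ≤ w.length + 1 + ∑ i, cap i := by
    have : spaceUsed (p.machine i₀ emb).tm c = ∑ i : Option K, (c.stk i).length := rfl
    rw [this, Fintype.sum_option]
    exact Nat.add_le_add hc.1 (Finset.sum_le_sum fun i _ => hc.2 i)
  have hini : initList (p.machine i₀ emb).tm (w.map (p.machine i₀ emb).inputAlphabet.symm) =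
      (⟨some none, none, stks w (Function.update (fun _ => []) i₀ [])⟩ :
        TM2.Cfg (Alph K G) (Option p.Lab) (Option G)) := by
    refine congrArg (TM2.Cfg.mk (some none) none) (funext fun i => ?_)
    rcases i with _ | i
    · exact (dif_pos rfl).trans (List.map_id w)
    · refine (dif_neg (show ¬ (some i : Option K) = none by simp)).trans ?_
      by_cases h : i = i₀
      · subst h; simp; rfl
      · simp; rfl
  obtain ⟨v, h1⟩ := machineCode_load p i₀ emb (cap := cap) hcap (fun _ => []) (by simp) w []
    (by simp) none
  obtain ⟨v', S', h2⟩ := h.arrives (n := w.length + 1) (by omega) hS (p.machineCode i₀ emb) some none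
    (fun _ => rfl) v
  rw [List.append_nil] at h1
  -- The bound for the input stack is raised from `w.length` to `w.length + 1`, because the answer
  -- bit needs a cell even if the input is empty.
  have h3 := Relation.ReflTransGen.trans (h1.mono fun c hc => ⟨hc.1.trans (by omega), hc.2⟩) h2
  constructor
  · refine ⟨(⟨none, v', stks [b] S'⟩ : TM2.Cfg (Alph K G) (Option p.Lab) (Option G)), ?_, rfl, rfl⟩
    unfold Occurs
    rw [hini]
    exact Path.reaches h3
  · intro c hc
    unfold Occurs at hc
    rw [hini] at hc
    -- The path ends in a halted configuration and the machine is deterministic, so every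
    -- configuration of the run lies on the path.
    refine hfit (Path.forall_reaches h3 ⟨?_, ?_⟩ rfl hc)
    · simp
    · exact length_update_le (by simp) (by simp)

end Prog
/-! ## Iteration on finite types -/

/-- The flat order on functions: `g` extends `f` where `f` is nonzero. -/
def FlatLE {V : Type} [Zero V] (f g : V → V) : Prop := ∀ v, f v ≠ 0 → g v = f v

theorem FlatLE.eq {V : Type} [Zero V] {f g : V → V} (h : FlatLE f g)
    (hs : ∀ v, g v ≠ 0 → f v ≠ 0) : f = g := by
  funext v
  by_cases hv : g v = 0
  · by_contra hne
    exact hne (h v (by rwa [hv] at hne)).symm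
  · exact (h v (hs v hv)).symm

/-- Kleene iteration over a flat order stabilises after as many steps as there are arguments. -/
theorem flat_iterate_fixed {V : Type} [Zero V] [Fintype V] (φ : (V → V) → V → V)
    (h0 : ∀ f, f 0 = 0 → φ f 0 = 0)
    (hmono : ∀ f g, f 0 = 0 → FlatLE f g → FlatLE (φ f) (φ g)) :
    φ (φ^[Fintype.card V] fun _ => 0) = φ^[Fintype.card V] fun _ => 0 := by
  classical
  set x : ℕ → V → V := fun j => φ^[j] fun _ => 0 with hx
  have xs : ∀ j, x (j + 1) = φ (x j) := fun j => Function.iterate_succ_apply' φ j _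
  -- Strictness is carried along because monotonicity is assumed only for strict functions;
  -- `blankFun` applies its argument twice and needs this.
  have x0 : ∀ j, x j 0 = 0 := by
    intro j
    induction j with
    | zero => rfl
    | succ j ih => rw [xs]; exact h0 _ ih
  have le : ∀ j, FlatLE (x j) (x (j + 1)) := by
    intro j
    induction j with
    | zero => intro v hv; exact absurd rfl hv
    | succ j ih => rw [xs, xs (j + 1)]; exact hmono _ _ (x0 j) ih
  -- Along the ascending chain a value can only change from `0` to something else, so two
  -- consecutive members with the same support are equal.
  set s : ℕ → Finset V := fun j => Finset.univ.filter fun v => x j v ≠ 0 with hs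
  have smono : ∀ j, s j ⊆ s (j + 1) := by
    intro j v hv
    simp only [hs, Finset.mem_filter, Finset.mem_univ, true_and] at hv ⊢
    rwa [le j v hv]
  have stab : ∀ j, x (j + 1) = x j → ∀ i, x (j + i + 1) = x (j + i) := by
    intro j hj i
    induction i with
    | zero => exact hj
    | succ i ih => rw [← add_assoc, xs, ih, ← xs, ih]
  have ex : ∃ j ≤ Fintype.card V, x (j + 1) = x j := by
    by_contra! hne
    -- Without stabilisation the supports grow strictly `Fintype.card V + 1` times, which is once
    -- too often.
    have card : ∀ j, j ≤ Fintype.card V + 1 → j ≤ (s j).card := by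
      intro j
      induction j with
      | zero => simp
      | succ j ih =>
        intro hj
        refine (Nat.succ_le_succ (ih (by omega))).trans (Finset.card_lt_card ?_)
        refine Finset.ssubset_iff_subset_ne.2 ⟨smono j, fun h => hne j (by omega) ?_⟩
        refine ((le j).eq fun v hv => ?_).symm
        have : v ∈ s (j + 1) := by simpa [hs] using hv
        rw [← h] at this
        simpa [hs] using this
    have h1 := card _ le_rfl
    have h2 := Finset.card_le_univ (s (Fintype.card V + 1))
    omega
  obtain ⟨j, hj, h⟩ := ex
  have := stab j h (Fintype.card V - j)
  rw [Nat.add_sub_cancel' hj] at this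
  exact (xs _).symm.trans this

/-- An absorbing set of a finite dynamical system is reached within as many steps as there are
points. -/
theorem exists_iterate_iff {X : Type} [Fintype X] (f : X → X) (P : X → Prop)
    (hP : ∀ x, P x → P (f x)) (x : X) {n : ℕ} (hn : Fintype.card X ≤ n + 1) :
    (∃ j, P (f^[j] x)) ↔ P (f^[n] x) := by
  classical
  have mono : ∀ i j, i ≤ j → P (f^[i] x) → P (f^[j] x) := by
    intro i j hij h
    induction hij with
    | refl => exact h
    | step _ ih => rw [Function.iterate_succ_apply']; exact hP _ ih
  refine ⟨fun h => ?_, fun h => ⟨n, h⟩⟩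
  set j := Nat.find h with hj
  by_cases hjn : j ≤ n
  · exact mono _ _ hjn (Nat.find_spec h)
  exfalso
  -- If the first hit `j` came after `n`, the points at times `0, …, j` would outnumber `X`; cutting
  -- out the segment between two equal ones gives an earlier hit.
  obtain ⟨a, b, hab, e⟩ := Fintype.exists_ne_map_eq_of_card_lt (fun i : Fin (j + 1) => f^[i] x)
    (by simpa using by omega)
  have key : ∀ a b : ℕ, a < b → b ≤ j → f^[a] x = f^[b] x → False := by
    intro a b hab hb e
    refine Nat.find_min h (m := j - b + a) (by omega) ?_
    rw [Function.iterate_add_apply, e, ← Function.iterate_add_apply, Nat.sub_add_cancel hb]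
    exact Nat.find_spec h
  rcases lt_or_gt_of_ne (fun h => hab (Fin.ext h) : a.val ≠ b.val) with h | h
  · exact key _ _ h (by omega) e
  · exact key _ _ h (by omega) e.symm

/-! ## Machines in normal form

The state `0` rejects for ever and the state `1` accepts. -/

/-- A transition table: what to write into the first blank cell, the head move and the new state. -/
abbrev Table (m n : ℕ) : Type := Option (Fin m) → Fin (n + 2) → Option (Fin m) × Move × Fin (n + 2)

namespace Table

variable {m n : ℕ}

/-- The states `0` and `1` are absorbing, in the direction in which words are left. -/
structure Normal (τ : Table m n) : Prop where
  some_zero : ∀ a, τ (some a) 0 = (none, .right, 0)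
  some_one : ∀ a, τ (some a) 1 = (none, .right, 1)
  none_zero : τ none 0 = (none, .left, 0)
  none_one : τ none 1 = (none, .left, 1)

/-- One step on a configuration of state, head position and tape. -/
def next (τ : Table m n) (c : Fin (n + 2) × ℕ × List (Fin m)) : Fin (n + 2) × ℕ × List (Fin m) :=
  match c.2.2[c.2.1]? with
  | some a => ((τ (some a) c.1).2.2, (τ (some a) c.1).2.1.apply c.2.1, c.2.2)
  | none => match τ none c.1 with
    | (none, d, v) => (v, d.apply c.2.1, c.2.2)
    | (some a, d, v) =>
      if c.2.1 = c.2.2.length then (v, d.apply c.2.1, c.2.2 ++ [a]) else (0, c.2.1, c.2.2)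

/-- The state `1` is reached within `t` steps. -/
def AccIn (τ : Table m n) (t : ℕ) (c : Fin (n + 2) × ℕ × List (Fin m)) : Prop :=
  (τ.next^[t] c).1 = 1

theorem accIn_succ (τ : Table m n) (t c) : τ.AccIn (t + 1) c ↔ τ.AccIn t (τ.next c) := Iff.rfl

namespace Normal

variable {τ : Table m n}

theorem next_of_le_one (h : τ.Normal) {c : Fin (n + 2) × ℕ × List (Fin m)} (hc : c.1 = 0 ∨ c.1 = 1) :
    (τ.next c).1 = c.1 := by
  obtain ⟨v, i, w⟩ := c
  rw [next]
  rcases hc with hc | hc <;> simp only at hc <;> subst hc <;> split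
  · simp [h.some_zero]
  · simp [h.none_zero]
  · simp [h.some_one]
  · simp [h.none_one]

theorem iterate_of_le_one (h : τ.Normal) {c : Fin (n + 2) × ℕ × List (Fin m)}
    (hc : c.1 = 0 ∨ c.1 = 1) (t : ℕ) : (τ.next^[t] c).1 = c.1 := by
  induction t with
  | zero => rfl
  | succ t ih =>
    rw [Function.iterate_succ_apply', h.next_of_le_one (by rwa [ih]), ih]

theorem accIn_one (h : τ.Normal) (t i w) : τ.AccIn t (1, i, w) :=
  h.iterate_of_le_one (Or.inr rfl) t

theorem not_accIn_zero (h : τ.Normal) (t i w) : ¬ τ.AccIn t (0, i, w) := by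
  rw [AccIn, h.iterate_of_le_one (Or.inl rfl) t]
  simp

theorem accIn_mono (h : τ.Normal) {t t' : ℕ} (ht : t ≤ t') {c} (hc : τ.AccIn t c) :
    τ.AccIn t' c := by
  obtain ⟨s, rfl⟩ := Nat.exists_eq_add_of_le' ht
  rw [AccIn, Function.iterate_add_apply, h.iterate_of_le_one (Or.inr hc)]
  exact hc

theorem accIn_zero_iff {v i w} : τ.AccIn 0 (v, i, w) ↔ v = 1 := Iff.rfl

end Normal

/-! ## Behaviour of words and of the blank part of the tape -/

/-- The functional whose least fixed point is the behaviour of a word followed by the symbol `a`, where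
`t` is the behaviour of the word. -/
def wordFun (τ : Table m n) (a : Fin m) (t f : Fin (n + 2) → Fin (n + 2)) (v : Fin (n + 2)) :
    Fin (n + 2) :=
  match (τ (some a) v).2.1 with
  | .left => f (t (τ (some a) v).2.2)
  | .stay => f (τ (some a) v).2.2
  | .right => (τ (some a) v).2.2

/-- The functional whose least fixed point is the behaviour of a half-line of blank cells. -/
def blankFun (τ : Table m n) (f : Fin (n + 2) → Fin (n + 2)) (v : Fin (n + 2)) : Fin (n + 2) :=
  match (τ none v).1 with
  | some _ => 0
  | none => match (τ none v).2.1 with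
    | .left => (τ none v).2.2
    | .stay => f (τ none v).2.2
    | .right => f (f (τ none v).2.2)

/-- The behaviour of a word followed by the symbol `a`, given that of the word. -/
def extend (τ : Table m n) (a : Fin m) (t : Fin (n + 2) → Fin (n + 2)) : Fin (n + 2) → Fin (n + 2) :=
  (τ.wordFun a t)^[n + 2] fun _ => 0

/-- The behaviour of a half-line of blank cells. -/
def blank (τ : Table m n) : Fin (n + 2) → Fin (n + 2) := τ.blankFun^[n + 2] fun _ => 0

/-- `t` is the behaviour of the word `w`: entering `w` at its last cell in state `v` amounts to being
behind its last cell in state `t v`. -/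
structure IsBehaviour (τ : Table m n) (w : List (Fin m)) (t : Fin (n + 2) → Fin (n + 2)) : Prop where
  acc : ∀ u v s, τ.AccIn s (v, w.length - 1, w ++ u) → τ.AccIn s (t v, w.length, w ++ u)
  acc_of : ∀ u v s, τ.AccIn s (t v, w.length, w ++ u) → ∃ s', τ.AccIn s' (v, w.length - 1, w ++ u)

/-- For the empty word `w.length - 1` truncates to `0`, the same cell as `w.length`. This is where
the rule that a left move from the first cell leaves the head there enters. -/
theorem isBehaviour_nil (τ : Table m n) : τ.IsBehaviour [] id :=
  ⟨fun _ _ _ h => h, fun _ _ s h => ⟨s, h⟩⟩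

namespace Normal

variable {τ : Table m n}

/-- The rejecting state serves as the bottom element: `wordFun` preserves strictness at `0` and uses
its argument at most once, so it is monotone for the flat order, and `n + 2` iterations suffice for
`n + 2` states. -/
theorem wordFun_extend (h : τ.Normal) (a : Fin m) (t : Fin (n + 2) → Fin (n + 2)) :
    τ.wordFun a t (τ.extend a t) = τ.extend a t := by
  have := flat_iterate_fixed (τ.wordFun a t) (by intro f _; simp [wordFun, h.some_zero]) (by
    intro f g _ hfg v
    simp only [wordFun]
    split
    · exact hfg _
    · exact hfg _
    · simp)
  simpa [extend] using this

theorem blankFun_blank (h : τ.Normal) : τ.blankFun τ.blank = τ.blank := by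
  have := flat_iterate_fixed τ.blankFun (by intro f _; simp [blankFun, h.none_zero]) (by
    intro f g f0 hfg v
    simp only [blankFun]
    split
    · simp
    split
    · simp
    · exact hfg _
    · intro hv
      -- In the nested application a nonzero outer value forces a nonzero inner one, as `f 0 = 0`;
      -- only then does `g` agree with `f` at both places.
      have h1 : f (τ none v).2.2 ≠ 0 := fun h1 => hv (by rw [h1, f0])
      rw [hfg _ h1]
      exact hfg _ hv)
  simpa [blank] using this

theorem next_some {a : Fin m} {v i} {w : List (Fin m)} (hw : w[i]? = some a) :
    τ.next (v, i, w) = ((τ (some a) v).2.2, (τ (some a) v).2.1.apply i, w) := by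
  rw [next]
  simp only [hw]

/-- From the cell of `a` the head leaves to the right, stays, or makes an excursion into `w`, which
`t` summarises. Acceptance is carried outwards by strong induction on the remaining time with the
fixed point equation. It is carried back by induction on the number of Kleene iterations: the value
`0` of the zeroth one never accepts, and each further iteration unfolds one machine step. That `u`
is arbitrary in `IsBehaviour` allows `a` to stand behind `w`. -/
theorem isBehaviour_extend (h : τ.Normal) {w : List (Fin m)} {t} (ht : τ.IsBehaviour w t) (a : Fin m) :
    τ.IsBehaviour (w ++ [a]) (τ.extend a t) := by
  have nx : ∀ u v, τ.next (v, w.length, w ++ a :: u) =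
      ((τ (some a) v).2.2, (τ (some a) v).2.1.apply w.length, w ++ a :: u) :=
    fun u v => next_some (by simp)
  constructor
  · intro u v s
    simp only [List.append_assoc, List.singleton_append, List.length_append, List.length_singleton,
      Nat.add_sub_cancel]
    have fx := congrFun (h.wordFun_extend a t)
    induction s using Nat.strong_induction_on generalizing v with
    | _ s ih =>
      rcases s with _ | s
      · intro hv
        rw [accIn_zero_iff] at hv
        subst hv
        have : τ.extend a t 1 = 1 := by rw [← fx]; simp [wordFun, h.some_one]
        rw [this]
        exact h.accIn_one _ _ _
      · intro hv
        rw [accIn_succ, nx] at hv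
        rw [← fx, wordFun]
        split <;> rename_i hd <;> rw [hd] at hv
        · exact h.accIn_mono s.le_succ (ih s (by omega) _ (ht.acc _ _ _ hv))
        · exact h.accIn_mono s.le_succ (ih s (by omega) _ hv)
        · exact h.accIn_mono s.le_succ hv
  · intro u v s
    simp only [List.append_assoc, List.singleton_append, List.length_append, List.length_singleton,
      Nat.add_sub_cancel]
    suffices ∀ j, τ.AccIn s ((τ.wordFun a t)^[j] (fun _ => 0) v, w.length + 1, w ++ a :: u) →
        ∃ s', τ.AccIn s' (v, w.length, w ++ a :: u) from this _
    intro j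
    induction j generalizing v s with
    | zero => intro hv; exact absurd hv (h.not_accIn_zero _ _ _)
    | succ j ih =>
      rw [Function.iterate_succ_apply', wordFun]
      intro hv
      suffices ∃ s', τ.AccIn s' (τ.next (v, w.length, w ++ a :: u)) from
        let ⟨s', h'⟩ := this; ⟨s' + 1, h'⟩
      rw [nx]
      split at hv <;> rename_i hd <;> rw [hd]
      · obtain ⟨s1, h1⟩ := ih _ _ hv
        exact ht.acc_of _ _ _ h1
      · exact ih _ _ hv
      · exact ⟨s, hv⟩

theorem next_none {v i} {w : List (Fin m)} (hw : w.length ≤ i) (hv : (τ none v).1 = none) :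
    τ.next (v, i, w) = ((τ none v).2.2, (τ none v).2.1.apply i, w) := by
  rcases hτ : τ none v with ⟨p, d, v'⟩
  rw [hτ] at hv
  simp only at hv
  subst hv
  rw [next]
  simp [List.getElem?_eq_none hw, hτ]

theorem next_put_length {v a} {w : List (Fin m)} (hv : (τ none v).1 = some a) :
    τ.next (v, w.length, w) =
      ((τ none v).2.2, (τ none v).2.1.apply w.length, w ++ [a]) := by
  rcases hτ : τ none v with ⟨p, d, v'⟩
  rw [hτ] at hv
  simp only at hv
  subst hv
  rw [next]
  simp [hτ]

theorem next_put_gt {v a i} {w : List (Fin m)} (hv : (τ none v).1 = some a) (hi : w.length < i) :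
    τ.next (v, i, w) = (0, i, w) := by
  rcases hτ : τ none v with ⟨p, d, v'⟩
  rw [hτ] at hv
  simp only at hv
  subst hv
  rw [next]
  simp [List.getElem?_eq_none hi.le, hτ, hi.ne']

/-- Behind the first blank cell no symbol can be written, so until the head comes back to cell `i`
the tape is fixed and only blanks are seen. Hence one function serves for every position. -/
theorem accIn_blank (h : τ.Normal) {w : List (Fin m)} {i : ℕ} (hi : w.length ≤ i) {v s}
    (hv : τ.AccIn s (v, i + 1, w)) : τ.AccIn s (τ.blank v, i, w) := by
  have fx := congrFun h.blankFun_blank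
  induction s using Nat.strong_induction_on generalizing v i with
  | _ s ih =>
    rcases s with _ | s
    · rw [accIn_zero_iff] at hv
      subst hv
      have : τ.blank 1 = 1 := by rw [← fx]; simp [blankFun, h.none_one]
      rw [this]
      exact h.accIn_one _ _ _
    · rw [accIn_succ] at hv
      rw [← fx, blankFun]
      split <;> rename_i hp
      · rw [next_put_gt hp (by omega)] at hv
        exact absurd hv (h.not_accIn_zero _ _ _)
      split <;> rename_i hd
      all_goals rw [next_none (by omega) hp, hd] at hv
      · exact h.accIn_mono s.le_succ hv
      · exact h.accIn_mono s.le_succ (ih s (by omega) hi hv)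
      -- After a right move two returns are needed, from `i + 2` to `i + 1` and from there to `i`.
      · exact h.accIn_mono s.le_succ (ih s (by omega) hi (ih s (by omega) (by omega) hv))

/-- As for words, the converse goes by induction on the Kleene iterations; `i` varies because a
right move shifts the half-line by one cell. -/
theorem accIn_of_blank (h : τ.Normal) {w : List (Fin m)} {i : ℕ} (hi : w.length ≤ i) {v s}
    (hv : τ.AccIn s (τ.blank v, i, w)) : ∃ s', τ.AccIn s' (v, i + 1, w) := by
  suffices ∀ j, τ.AccIn s (τ.blankFun^[j] (fun _ => 0) v, i, w) →
      ∃ s', τ.AccIn s' (v, i + 1, w) from this _ hv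
  clear hv
  intro j
  induction j generalizing v s i with
  | zero => exact fun hv => absurd hv (h.not_accIn_zero _ _ _)
  | succ j ih =>
    rw [Function.iterate_succ_apply', blankFun]
    intro hv
    suffices ∃ s', τ.AccIn s' (τ.next (v, i + 1, w)) from
      let ⟨s', h'⟩ := this; ⟨s' + 1, h'⟩
    split at hv <;> rename_i hp
    · exact absurd hv (h.not_accIn_zero _ _ _)
    split at hv <;> rename_i hd
    all_goals rw [next_none (by omega) hp, hd]
    · exact ⟨s, hv⟩
    · exact ih hi hv
    · obtain ⟨s1, h1⟩ := ih hi hv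
      exact ih (by omega) h1

end Normal

/-! ## The run at the first blank cell -/

/-- From a state at the first blank cell and the behaviour of the written word to the next visit of the
first blank cell. -/
def top (τ : Table m n) (x : Fin (n + 2) × (Fin (n + 2) → Fin (n + 2))) :
    Fin (n + 2) × (Fin (n + 2) → Fin (n + 2)) :=
  match τ none x.1 with
  | (none, .left, v) => (x.2 v, x.2)
  | (none, .stay, v) => (v, x.2)
  | (none, .right, v) => (τ.blank v, x.2)
  | (some a, .left, v) => (τ.extend a x.2 (x.2 v), τ.extend a x.2)
  | (some a, .stay, v) => (τ.extend a x.2 v, τ.extend a x.2)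
  | (some a, .right, v) => (v, τ.extend a x.2)

/-- The effect of reading an input symbol. -/
def read (τ : Table m n) (x : Fin (n + 2) × (Fin (n + 2) → Fin (n + 2))) (a : Fin m) :
    Fin (n + 2) × (Fin (n + 2) → Fin (n + 2)) :=
  (τ.extend a x.2 x.1, τ.extend a x.2)

namespace Normal

variable {τ : Table m n}

theorem extend_one (h : τ.Normal) (a t) : τ.extend a t 1 = 1 := by
  rw [← h.wordFun_extend]; simp [wordFun, h.some_one]

/-- A round costs at least one step of the machine. The strict decrease of the time bound drives the
induction in `exists_accIn_iff_top`. -/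
theorem accIn_top (h : τ.Normal) {w : List (Fin m)} {v t s} (ht : τ.IsBehaviour w t)
    (hv : τ.AccIn (s + 1) (v, w.length, w)) :
    ∃ w', τ.IsBehaviour w' (τ.top (v, t)).2 ∧ τ.AccIn s ((τ.top (v, t)).1, w'.length, w') := by
  rw [accIn_succ] at hv
  rcases hτ : τ none v with ⟨p, d, v'⟩
  rcases p with _ | a
  · rw [next_none le_rfl (by rw [hτ]), hτ] at hv
    refine ⟨w, ?_⟩
    cases d <;> simp only [top, hτ] <;> refine ⟨ht, ?_⟩
    · simpa using ht.acc [] v' s (by simpa [Move.apply] using hv)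
    · exact hv
    · exact h.accIn_blank le_rfl hv
  · rw [next_put_length (by rw [hτ]), hτ] at hv
    have ht' := h.isBehaviour_extend ht a
    refine ⟨w ++ [a], ?_⟩
    cases d <;> simp only [top, hτ] <;> refine ⟨ht', ?_⟩
    -- A left move after writing `a` enters `w` with `a` behind it; the return is to the cell of
    -- `a`, the last cell of `w ++ [a]`, and a second excursion starts there.
    · have h1 := ht.acc [a] v' s hv
      simpa using ht'.acc [] _ s (by simpa using h1)
    · simpa using ht'.acc [] v' s (by simpa [Move.apply] using hv)
    · simpa [Move.apply] using hv

theorem accIn_of_top (h : τ.Normal) {w : List (Fin m)} {v t} (ht : τ.IsBehaviour w t) :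
    ∃ w', τ.IsBehaviour w' (τ.top (v, t)).2 ∧ ∀ s, τ.AccIn s ((τ.top (v, t)).1, w'.length, w') →
      ∃ s', τ.AccIn s' (v, w.length, w) := by
  rcases hτ : τ none v with ⟨p, d, v'⟩
  suffices ∃ w', τ.IsBehaviour w' (τ.top (v, t)).2 ∧
      ∀ s, τ.AccIn s ((τ.top (v, t)).1, w'.length, w') →
      ∃ s', τ.AccIn s' (τ.next (v, w.length, w)) from
    let ⟨w', h1, h2⟩ := this
    ⟨w', h1, fun s hs => let ⟨s', h'⟩ := h2 s hs; ⟨s' + 1, h'⟩⟩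
  rcases p with _ | a
  · rw [next_none le_rfl (by rw [hτ]), hτ]
    refine ⟨w, ?_⟩
    cases d <;> simp only [top, hτ] <;> refine ⟨ht, fun s hs => ?_⟩
    · simpa [Move.apply] using ht.acc_of [] v' s (by simpa using hs)
    · exact ⟨s, hs⟩
    · exact h.accIn_of_blank le_rfl hs
  · rw [next_put_length (by rw [hτ]), hτ]
    have ht' := h.isBehaviour_extend ht a
    refine ⟨w ++ [a], ?_⟩
    cases d <;> simp only [top, hτ] <;> refine ⟨ht', fun s hs => ?_⟩
    · obtain ⟨s1, h1⟩ := ht'.acc_of [] _ s (by simpa using hs)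
      exact ht.acc_of [a] v' s1 (by simpa using h1)
    · simpa [Move.apply] using ht'.acc_of [] v' s (by simpa using hs)
    · exact ⟨s, by simpa [Move.apply] using hs⟩

/-- The word on the tape changes from round to round and may grow for ever, but it influences the
run only through its behaviour; so it is forgotten on the right-hand side. -/
theorem exists_accIn_iff_top (h : τ.Normal) {w : List (Fin m)} {v t} (ht : τ.IsBehaviour w t) :
    (∃ s, τ.AccIn s (v, w.length, w)) ↔ ∃ j, (τ.top^[j] (v, t)).1 = 1 := by
  constructor
  · rintro ⟨s, hs⟩
    induction s generalizing w v t with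
    | zero => exact ⟨0, hs⟩
    | succ s ih =>
      obtain ⟨w', h1, h2⟩ := h.accIn_top ht hs
      obtain ⟨j, hj⟩ := ih h1 h2
      exact ⟨j + 1, hj⟩
  · rintro ⟨j, hj⟩
    induction j generalizing w v t with
    | zero => exact ⟨0, hj⟩
    | succ j ih =>
      obtain ⟨w', h1, h2⟩ := h.accIn_of_top (v := v) ht
      obtain ⟨s, hs⟩ := ih h1 hj
      exact h2 s hs

/-- Leaving a prefix of the input to the right means entering the next longer prefix at its last
cell, so the behaviours of the prefixes can be composed from left to right, starting from the empty
one. -/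
theorem isBehaviour_read (h : τ.Normal) (v : Fin (n + 2)) (x : List (Fin m)) :
    τ.IsBehaviour x (x.foldl τ.read (v, id)).2 ∧ ∀ u,
      ((∃ s, τ.AccIn s (v, 0, x ++ u)) ↔
        ∃ s, τ.AccIn s ((x.foldl τ.read (v, id)).1, x.length, x ++ u)) := by
  induction x using List.reverseRecOn with
  | nil => exact ⟨τ.isBehaviour_nil, fun u => Iff.rfl⟩
  | append_singleton x a ih =>
    rw [List.foldl_append, List.foldl_cons, List.foldl_nil]
    have hb := h.isBehaviour_extend ih.1 a
    refine ⟨hb, fun u => ?_⟩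
    -- Here the hypothesis for the prefix is used with the new symbol as a part of what lies behind
    -- it.
    rw [List.append_assoc, ih.2 ([a] ++ u)]
    have h1 := hb.acc u (x.foldl τ.read (v, id)).1
    have h2 := hb.acc_of u (x.foldl τ.read (v, id)).1
    simp only [List.length_append, List.length_singleton, Nat.add_sub_cancel,
      List.append_assoc] at h1 h2 ⊢
    exact ⟨fun ⟨s, hs⟩ => ⟨s, h1 s hs⟩, fun ⟨s, hs⟩ => h2 s hs⟩

/-- At a blank the state `1` moves left and thus re-enters the word, so it survives a round only if
the behaviour fixes it; this property has to be part of the invariant. -/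
theorem top_one (h : τ.Normal) {x : Fin (n + 2) × (Fin (n + 2) → Fin (n + 2))} (hx : x.2 1 = 1) :
    (τ.top x).2 1 = 1 ∧ (x.1 = 1 → (τ.top x).1 = 1) := by
  obtain ⟨v, t⟩ := x
  refine ⟨?_, fun hv => ?_⟩
  · rw [top]
    split <;> first | exact hx | exact h.extend_one _ _
  · simp only at hv hx
    subst hv
    simp [top, h.none_one, hx]

theorem exists_top_iff (h : τ.Normal) {x : Fin (n + 2) × (Fin (n + 2) → Fin (n + 2))} (hx : x.2 1 = 1)
    {N : ℕ} (hN : (n + 2) ^ (n + 3) ≤ N + 1) :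
    (∃ j, (τ.top^[j] x).1 = 1) ↔ (τ.top^[N] x).1 = 1 := by
  have inv : ∀ j, (τ.top^[j] x).2 1 = 1 := by
    intro j
    induction j with
    | zero => exact hx
    | succ j ih => rw [Function.iterate_succ_apply']; exact (h.top_one ih).1
  -- The system has `(n + 2) * (n + 2) ^ (n + 2)` points, which explains the exponent `n + 3`.
  have := exists_iterate_iff τ.top (fun x => x.1 = 1 ∧ x.2 1 = 1)
    (fun x hx => ⟨(h.top_one hx.2).2 hx.1, (h.top_one hx.2).1⟩) x (n := N)
    (by simpa [pow_succ'] using hN)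
  simpa [inv] using this

/-- The decision procedure. -/
theorem accepts_iff (h : τ.Normal) (v : Fin (n + 2)) (x : List (Fin m))
    {N : ℕ} (hN : (n + 2) ^ (n + 3) ≤ N + 1) :
    (∃ s, τ.AccIn s (v, 0, x)) ↔ (τ.top^[N] (x.foldl τ.read (v, id))).1 = 1 := by
  have h1 := h.isBehaviour_read v x
  have h2 := h1.2 []
  simp only [List.append_nil] at h2
  rw [h2, h.exists_accIn_iff_top h1.1]
  refine h.exists_top_iff ?_ hN
  induction x using List.reverseRecOn with
  | nil => rfl
  | append_singleton x a ih =>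
    rw [List.foldl_append]
    exact h.extend_one _ _

end Normal
end Table

/-! ## The normal form of a machine -/

variable {m k : ℕ}

/-- The direction in which an absorbing state leaves. -/
def exitMove : Option (Fin m) → Move
  | none => .left
  | some _ => .right

/-- Whether a write of `s` on a cell with content `c` can be possible. -/
def Writable (c s : Option (Fin m)) : Prop := c = none ∨ s = c

instance (c s : Option (Fin m)) : Decidable (Writable c s) := by unfold Writable; infer_instance

/-- The normal form of the entry `e` in column `c`, for an accepting state if `b` is true. -/
def normalEntry (b : Bool) (c : Option (Fin m)) (e : Option (Option (Fin m) × Move × Fin k)) :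
    Option (Fin m) × Move × Fin (k + 2) :=
  if b then (none, exitMove c, 1) else
    match e with
    | none => (none, exitMove c, 0)
    | some (s, d, q) =>
      if Writable c s then (if c = none then s else none, d, q.succ.succ) else (none, exitMove c, 0)

/-- The normal form of a machine: the state `q` becomes `q + 2`, and accepting states lead to `1`. -/
def Machine.table (M : Machine m k) : Table m k := fun c v =>
  Fin.cases (none, exitMove c, 0)
    (Fin.cases (none, exitMove c, 1) fun q => normalEntry (M.accept q) c (M.trans q c)) v

namespace Machine

@[simp] theorem table_zero (M : Machine m k) (c) : M.table c 0 = (none, exitMove c, 0) := rfl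

@[simp] theorem table_one (M : Machine m k) (c) : M.table c 1 = (none, exitMove c, 1) := rfl

@[simp] theorem table_succ_succ (M : Machine m k) (c) (q : Fin k) :
    M.table c q.succ.succ = normalEntry (M.accept q) c (M.trans q c) := rfl

theorem normal_table (M : Machine m k) : M.table.Normal :=
  ⟨fun _ => rfl, fun _ => rfl, rfl, rfl⟩

/-- The configuration of the normal form. -/
def toNormal (c : Cfg m k) : Fin (k + 2) × ℕ × List (Fin m) := (c.state.succ.succ, c.head, c.tape)

theorem next_toNormal_of_accept (M : Machine m k) (c : Cfg m k) (hc : M.accept c.state = true) :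
    (M.table.next (toNormal c)).1 = 1 := by
  rw [Table.next]
  split <;> simp [toNormal, normalEntry, hc]

theorem next_toNormal_of_step_none (M : Machine m k) (c : Cfg m k) (hc : M.accept c.state = false)
    (h : M.step c = none) : (M.table.next (toNormal c)).1 = 0 := by
  rw [step] at h
  rw [Table.next]
  split
  · rename_i a ha
    simp only [toNormal] at ha
    simp only [toNormal, table_succ_succ, normalEntry, hc]
    rw [ha] at h
    split at h
    · simp
    · rename_i s d q ht
      by_cases hs : s = some a
      · simp [write, ha, hs] at h
      · simp [Writable, hs]
  · rename_i ha
    simp only [toNormal] at ha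
    simp only [toNormal, table_succ_succ, normalEntry, hc]
    rw [ha] at h
    split at h
    · simp
    · rename_i s d q ht
      rcases s with _ | s
      · simp [write, ha] at h
      · simp [write, ha] at h
        simp [Writable, h]

theorem next_toNormal_of_step_some (M : Machine m k) (c c' : Cfg m k) (hc : M.accept c.state = false)
    (h : M.step c = some c') : M.table.next (toNormal c) = toNormal c' := by
  rw [step] at h
  rw [Table.next]
  split
  · rename_i a ha
    simp only [toNormal] at ha
    simp only [toNormal, table_succ_succ, normalEntry, hc]
    rw [ha] at h
    split at h
    · simp at h
    · rename_i s d q ht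
      by_cases hs : s = some a
      · simp [write, ha, hs] at h
        simp [Writable, hs, ← h]
      -- A scanned symbol lies before the end of the tape, so a different content cannot be written
      -- and the assumed step does not exist.
      · have hlt : c.head ≠ c.tape.length := by
          rintro e
          simp [e] at ha
        rcases s with _ | s <;> simp_all [write]
  · rename_i ha
    simp only [toNormal] at ha
    simp only [toNormal, table_succ_succ, normalEntry, hc]
    rw [ha] at h
    split at h
    · simp at h
    · rename_i s d q ht
      rcases s with _ | s
      · simp [write, ha] at h
        simp [Writable, ← h]
      · simp [write, ha] at h
        obtain ⟨h1, rfl⟩ := h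
        simp [Writable, h1]

/-- The normal form imitates the machine step by step up to the first accepting state and enters `1`
one step later. When the machine halts without accepting, it enters `0` and never gets away from
there. -/
theorem accepts_iff_table (M : Machine m k) (x : List (Fin m)) :
    M.Accepts x ↔ ∃ s, M.table.AccIn s (M.start.succ.succ, 0, x) := by
  have hN := M.normal_table
  constructor
  · rintro ⟨c, hr, hc⟩
    change ∃ s, M.table.AccIn s (toNormal (M.init x))
    generalize M.init x = c₀ at hr ⊢
    induction hr using Relation.ReflTransGen.head_induction_on with
    | refl => exact ⟨1, M.next_toNormal_of_accept c hc⟩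
    | @head a b hab _ ih =>
      by_cases ha : M.accept a.state = true
      · exact ⟨1, M.next_toNormal_of_accept a ha⟩
      · obtain ⟨s, hs⟩ := ih
        refine ⟨s + 1, ?_⟩
        rw [Table.accIn_succ, M.next_toNormal_of_step_some a b (by simpa using ha) hab]
        exact hs
  · rintro ⟨s, hs⟩
    suffices ∀ c : Cfg m k, M.table.AccIn s (toNormal c) →
        ∃ c', StateTransition.Reaches M.step c c' ∧ M.accept c'.state = true from
      this (M.init x) hs
    clear hs
    induction s with
    | zero =>
      intro c hc
      -- The states of the machine are shifted by two, so none of them is `1`.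
      exact absurd (Table.Normal.accIn_zero_iff.1 hc) (by simp [Fin.ext_iff])
    | succ s ih =>
      intro c hc
      by_cases ha : M.accept c.state = true
      · exact ⟨c, .refl, ha⟩
      rw [Table.accIn_succ] at hc
      cases h : M.step c with
      | none =>
        have h0 := M.next_toNormal_of_step_none c (by simpa using ha) h
        have h1 := hN.iterate_of_le_one (Or.inl h0) s
        rw [Table.AccIn, h1, h0] at hc
        simp at hc
      | some c' =>
        rw [M.next_toNormal_of_step_some c c' (by simpa using ha) h] at hc
        obtain ⟨d, h1, h2⟩ := ih c' hc
        exact ⟨d, .head h h1, h2⟩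

end Machine
/-! ## Non-universality -/

/-- A predicate on words that is decided by a finite automaton is computable. -/
theorem computablePred_foldl {m : ℕ} {X : Type} [Fintype X] (δ : X → Fin m → X) (x₀ : X)
    (P : X → Prop) : ComputablePred fun x : List (Fin m) => P (x.foldl δ x₀) := by
  classical
  let e := Fintype.equivFin X
  let δ' : Fin (Fintype.card X) → Fin m → Fin (Fintype.card X) := fun i a => e (δ (e.symm i) a)
  have hfold : ∀ (x : List (Fin m)) y, x.foldl δ' (e y) = e (x.foldl δ y) := by
    intro x
    induction x with
    | nil => intro y; rfl
    | cons a x ih => intro y; rw [List.foldl_cons, List.foldl_cons, ← ih]; simp [δ']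
  rw [ComputablePred.computable_iff]
  refine ⟨fun x => decide (P (e.symm (x.foldl δ' (e x₀)))), ?_, ?_⟩
  · have h1 : Primrec fun x : List (Fin m) => x.foldl δ' (e x₀) :=
      Primrec.list_foldl Primrec.id (Primrec.const _)
        ((Primrec.dom_finite fun p : Fin (Fintype.card X) × Fin m => δ' p.1 p.2).comp
          Primrec.snd).to₂
    exact ((Primrec.dom_finite fun i => decide (P (e.symm i))).comp h1).to_comp
  · funext x
    simp [hfold]

/-- For fixed `M` the pairs (state, behaviour) are the states of a finite automaton with transitions
`read`; the final iteration of `top` only defines its set of accepting states. -/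
theorem Machine.computablePred_accepts {m k : ℕ} (M : Machine m k) :
    ComputablePred fun x : List (Fin m) => M.Accepts x := by
  have := computablePred_foldl M.table.read (M.start.succ.succ, id)
    fun y => (M.table.top^[(k + 2) ^ (k + 3)] y).1 = 1
  convert this using 2 with x
  rw [M.accepts_iff_table]
  exact propext_iff.1 (propext (M.normal_table.accepts_iff _ x (Nat.le_succ _)))

/-- A recursively enumerable language that is not reducible to the acceptance of any machine. -/
theorem exists_re_not_reducible {m : ℕ} (hm : 1 ≤ m) :
    ∃ L : Language (Fin m), REPred (fun x : List (Fin m) => x ∈ L) ∧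
      ∀ (k : ℕ) (M : Machine m k) (e : List (Fin m) → List (Fin m)), Computable e →
        ¬ ∀ x : List (Fin m), x ∈ L ↔ M.Accepts (e x) := by
  open Nat.Partrec in
  -- A word stands for the program whose code number is its length; only the length matters, so any
  -- alphabet with at least one symbol will do.
  refine ⟨{x | ((Denumerable.ofNat Code x.length).eval 0).Dom}, ?_, ?_⟩
  · have h1 : Computable fun x : List (Fin m) => Denumerable.ofNat Code x.length :=
      (Computable.ofNat Code).comp Computable.list_length
    have h2 : Partrec fun x : List (Fin m) => (Denumerable.ofNat Code x.length).eval 0 :=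
      Code.eval_part.comp h1 (Computable.const 0)
    exact h2.dom_re
  · intro k M e he h
    refine ComputablePred.halting_problem 0 (ComputablePred.computable_of_manyOneReducible
      (q := fun x : List (Fin m) => M.Accepts x) ?_ M.computablePred_accepts)
    -- A reduction `e` composed with the map from a program to a word of the right length would
    -- reduce the halting problem to a computable predicate.
    refine ⟨fun c => e (List.replicate (Encodable.encode c) ⟨0, hm⟩), he.comp ?_, fun c => ?_⟩
    · have h1 : Primrec fun n : ℕ => (List.range n).map fun _ => (⟨0, hm⟩ : Fin m) :=
        Primrec.list_map Primrec.list_range (Primrec.const _).to₂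
      refine (h1.comp Primrec.encode).to_comp.of_eq fun c => ?_
      simp [List.map_const']
    · change _ ↔ M.Accepts (e _)
      rw [← h]
      change _ ↔ (Code.eval (Denumerable.ofNat Code (List.replicate _ _).length) 0).Dom
      rw [List.length_replicate, Denumerable.ofNat_encode]

namespace Prog

/-! ## Basic programs -/

section Basic

variable {K G : Type} [DecidableEq K] {cap : K → ℕ} {S : K → List G} {i j : K}

theorem Runs.of_eq {p : Prog K G} {S S' S'' : K → List G} (h : Runs cap p S (.inl S'))
    (e : S' = S'') : Runs cap p S (.inl S'') := e ▸ h

theorem Runs.case_cons {f : Option G → Prog K G} {a : G} {l : List G} {r} (h : S i = a :: l)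
    (hf : Runs cap (f (some a)) (Function.update S i l) r) : Runs cap (.case i f) S r :=
  .case (by simpa [h] using hf)

theorem Runs.case_nil {f : Option G → Prog K G} {r} (h : S i = [])
    (hf : Runs cap (f none) S r) : Runs cap (.case i f) S r :=
  .case (by
    have e : Function.update S i [] = S := by rw [← h, Function.update_eq_self]
    simpa [h, e] using hf)

/-- A loop that pops the word `l`; the states are given by what is left of `l`. -/
theorem runs_loop {c : G → Bool} {f : G → Prog K G} (F : List G → K → List G) (l r : List G)
    (hF : ∀ l', l' <:+ l → F l' i = l' ++ r) (hc : ∀ a ∈ l, c a = true)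
    (hr : r.head?.any c = false)
    (hstep : ∀ a l', a :: l' <:+ l →
      Runs cap (f a) (Function.update (F (a :: l')) i (l' ++ r)) (.inl (F l'))) :
    Runs cap (.loop i c f) (F l) (.inl (F [])) := by
  induction l with
  | nil => exact .loop_done (by rw [hF [] List.suffix_rfl]; simpa using hr)
  | cons a l ih =>
    refine .loop_step (a := a) (l := l ++ r) (by rw [hF _ List.suffix_rfl]; simp) (hc a (by simp))
      (hstep a l List.suffix_rfl) (ih ?_ ?_ ?_)
    · exact fun l' h => hF l' (h.trans (List.suffix_cons _ _))
    · exact fun b hb => hc b (by simp [hb])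
    · exact fun b l' h => hstep b l' (h.trans (List.suffix_cons _ _))

/-- Move symbols to another stack as long as they satisfy `c`. -/
def move (i : K) (c : G → Bool) (j : K) : Prog K G := .loop i c fun a => .push j a

theorem runs_move (hij : i ≠ j) {c : G → Bool} (l r : List G) (hS : S i = l ++ r)
    (hc : ∀ a ∈ l, c a = true) (hr : r.head?.any c = false)
    (hcap : l.length + (S j).length ≤ cap j) :
    Runs cap (move i c j) S
      (.inl (Function.update (Function.update S i r) j (l.reverse ++ S j))) := by
  induction l generalizing S with
  | nil =>
    refine Runs.of_eq (.loop_done (by simpa [hS] using hr)) ?_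
    simp at hS
    simp [← hS]
  | cons a l ih =>
    simp only [List.length_cons] at hcap
    refine .loop_step (a := a) (l := l ++ r) hS (hc a (by simp))
      (.push (by simp [hij.symm]; omega)) (Runs.of_eq (ih ?_ ?_ ?_) ?_)
    · simp [hij]
    · exact fun b hb => hc b (by simp [hb])
    · simp [hij.symm]; omega
    · funext x
      by_cases hx : x = j
      · subst hx; simp [hij.symm]
      · by_cases hx' : x = i
        · subst hx'; simp [hx]
        · simp [hx, hx']

/-- Move everything to another stack. -/
def moveAll (i j : K) : Prog K G := move i (fun _ => true) j

theorem runs_moveAll (hij : i ≠ j) (hcap : (S i).length + (S j).length ≤ cap j) :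
    Runs cap (moveAll i j) S
      (.inl (Function.update (Function.update S i []) j ((S i).reverse ++ S j))) :=
  runs_move hij (S i) [] (by simp) (by simp) (by simp) hcap

/-- Empty a stack. -/
def drain (i : K) : Prog K G := .loop i (fun _ => true) fun _ => .skip

theorem runs_drain : Runs cap (drain i : Prog K G) S (.inl (Function.update S i [])) := by
  have h := runs_loop (cap := cap) (i := i) (c := fun _ => true) (f := fun _ => .skip)
    (fun l => Function.update S i l) (S i) [] (by simp) (by simp) (by simp)
    (fun a l' _ => by simpa using Runs.skip _)
  simpa [drain] using h

/-- Move symbols to two other stacks as long as they satisfy `c`. -/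
def move₂ (i : K) (c : G → Bool) (j j' : K) : Prog K G := .loop i c fun a => .seq (.push j a) (.push j' a)

theorem runs_move₂ {j' : K} (hij : i ≠ j) (hij' : i ≠ j') (hjj' : j ≠ j') {c : G → Bool} (l r : List G)
    (hS : S i = l ++ r) (hc : ∀ a ∈ l, c a = true) (hr : r.head?.any c = false)
    (hcap : l.length + (S j).length ≤ cap j) (hcap' : l.length + (S j').length ≤ cap j') :
    Runs cap (move₂ i c j j') S
      (.inl (Function.update (Function.update (Function.update S i r) j (l.reverse ++ S j)) j'
        (l.reverse ++ S j'))) := by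
  induction l generalizing S with
  | nil =>
    refine Runs.of_eq (.loop_done (by simpa [hS] using hr)) ?_
    simp at hS
    simp [← hS]
  | cons a l ih =>
    simp only [List.length_cons] at hcap hcap'
    refine .loop_step (a := a) (l := l ++ r) hS (hc a (by simp))
      (.seq (.push (by simp [hij.symm]; omega)) (.push (by simp [hij'.symm, hjj'.symm]; omega)))
      (Runs.of_eq (ih ?_ ?_ ?_ ?_) ?_)
    · simp [hij, hij']
    · exact fun b hb => hc b (by simp [hb])
    · simp [hij.symm, hjj']; omega
    · simp [hij'.symm, hjj'.symm]; omega
    · funext x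
      by_cases hx : x = j'
      · subst hx; simp [hij'.symm, hjj'.symm]
      · by_cases hx' : x = j
        · subst hx'; simp [hij.symm, hx]
        · by_cases hx'' : x = i
          · subst hx''; simp [hx, hx']
          · simp [hx, hx', hx'']

/-- Repeat `p` as often as the stack `i` has symbols; the stack `j` is used to restore it. -/
def repeatFor (i j : K) (p : Prog K G) : Prog K G :=
  .seq (.loop i (fun _ => true) fun a => .seq (.push j a) p) (moveAll j i)

/-- `F t` describes the stacks after `t` rounds. During the loop the counting symbols are spread
over `i` and `j`, so `p` has to perform its round for arbitrary contents of these two. -/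
theorem runs_repeatFor (hij : i ≠ j) (F : ℕ → K → List G) {p : Prog K G}
    (l : List G) (hcap : l.length ≤ cap j) (hcap' : l.length ≤ cap i)
    (hp : ∀ t < l.length, ∀ u w, Runs cap p (Function.update (Function.update (F t) i u) j w)
      (.inl (Function.update (Function.update (F (t + 1)) i u) j w)))
    (hi : F 0 i = l) (hj : F 0 j = []) (hi' : F l.length i = l) (hj' : F l.length j = []) :
    Runs cap (repeatFor i j p) (F 0) (.inl (F l.length)) := by
  have key : ∀ (l : List G) t w, l.length + w.length ≤ cap j →
      (∀ t' < t + l.length, ∀ u w, Runs cap p (Function.update (Function.update (F t') i u) j w)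
        (.inl (Function.update (Function.update (F (t' + 1)) i u) j w))) →
      Runs cap (.loop i (fun _ => true) fun a => .seq (.push j a) p)
        (Function.update (Function.update (F t) i l) j w)
        (.inl (Function.update (Function.update (F (t + l.length)) i []) j (l.reverse ++ w))) := by
    intro l
    induction l with
    | nil =>
      intro t w _ _
      exact Runs.of_eq (.loop_done (by simp [hij])) (by simp)
    | cons a l ih =>
      intro t w hw hp
      simp only [List.length_cons] at hw hp
      refine .loop_step (a := a) (l := l) (by simp [hij]) rfl
        (.seq (.push (by simp [hij.symm]; omega)) ?_)
        (Runs.of_eq (ih (t + 1) (a :: w) ?_ fun t' ht' => hp t' (by omega)) ?_)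
      · convert hp t (by omega) l (a :: w) using 1
        funext y
        by_cases hy : y = j
        · subst hy; simp [hij.symm]
        · by_cases hy' : y = i
          · subst hy'; simp [hy]
          · simp [hy, hy']
      · simp; omega
      · simp [Nat.add_assoc, Nat.add_comm 1]
  refine .seq (S' := Function.update (Function.update (F l.length) i []) j l.reverse)
    ?_ (Runs.of_eq (runs_moveAll hij.symm (by simpa [hij] using hcap')) ?_)
  · have := key l 0 [] (by simpa using hcap) (by simpa using hp)
    rwa [← hi, Function.update_eq_self, ← hj, Function.update_eq_self, hi, hj, List.append_nil,
      Nat.zero_add] at this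
  · funext y
    by_cases hy : y = i
    · subst hy; simp [hij, hi']
    · by_cases hy' : y = j
      · subst hy'; simp [hij.symm, hj']
      · simp [hy, hy']

end Basic

/-! ## Unary numbers and tables on stacks -/

section Unary

variable {K D : Type} [DecidableEq K] {cap : K → ℕ} {S : K → List (Bool ⊕ D)} {i j : K}

/-- The word of `n` ones. -/
def ones (n : ℕ) : List (Bool ⊕ D) := List.replicate n (.inl true)

/-- A unary number with its end marker. -/
def un (n : ℕ) : List (Bool ⊕ D) := ones n ++ [.inl false]

def isOne : Bool ⊕ D → Bool
  | .inl b => b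
  | .inr _ => false

@[simp] theorem length_ones (n : ℕ) : (ones n : List (Bool ⊕ D)).length = n := by simp [ones]

@[simp] theorem length_un (n : ℕ) : (un n : List (Bool ⊕ D)).length = n + 1 := by simp [un]

@[simp] theorem reverse_ones (n : ℕ) : (ones n : List (Bool ⊕ D)).reverse = ones n := by simp [ones]

theorem ones_succ (n : ℕ) : (ones (n + 1) : List (Bool ⊕ D)) = .inl true :: ones n := rfl

@[simp] theorem ones_zero : (ones 0 : List (Bool ⊕ D)) = [] := rfl

theorem isOne_of_mem_ones {n : ℕ} : ∀ a ∈ (ones n : List (Bool ⊕ D)), isOne a = true := by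
  simp [ones, isOne]

theorem ones_append_ones (a b : ℕ) : (ones a ++ ones b : List (Bool ⊕ D)) = ones (a + b) := by
  simp [ones]

/-- Move one unary number with its end marker to another stack. -/
def skipNum (i j : K) : Prog K (Bool ⊕ D) :=
  .seq (move i isOne j) (.case i fun _ => .push j (.inl false))

theorem runs_skipNum (hij : i ≠ j) (n : ℕ) (r : List (Bool ⊕ D)) (hS : S i = un n ++ r)
    (hcap : n + 1 + (S j).length ≤ cap j) :
    Runs cap (skipNum i j) S
      (.inl (Function.update (Function.update S i r) j ((un n).reverse ++ S j))) := by
  refine .seq (runs_move hij (ones n) (.inl false :: r) (by simp [hS, un]) isOne_of_mem_ones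
    (by simp [isOne]) (by simp; omega)) (.case (Runs.of_eq (.push ?_) ?_))
  · simp [hij, hij.symm]; omega
  · funext x
    by_cases hx : x = j
    · subst hx; simp [hij, hij.symm, un]
    · by_cases hx' : x = i
      · subst hx'; simp [hx]
      · simp [hx, hx']

/-- Replace the unary number `v` on the stack `x` by the entry `v` of the table on the stack `t`. -/
def lookup (t x a : K) : Prog K (Bool ⊕ D) :=
  .seq (.loop x (fun _ => true) fun _ => skipNum t a) (.seq (move₂ t isOne a x) (moveAll a t))

theorem runs_skipNums {t x a : K} (htx : t ≠ x) (hta : t ≠ a) (hxa : x ≠ a) (l : List ℕ)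
    (r : List (Bool ⊕ D)) (hS : S t = l.flatMap un ++ r) (hx : S x = ones l.length)
    (hcap : (l.flatMap (un (D := D))).length + (S a).length ≤ cap a) :
    Runs cap (.loop x (fun _ => true) fun _ => skipNum t a) S
      (.inl (Function.update (Function.update (Function.update S x []) t r) a
        ((l.flatMap un).reverse ++ S a))) := by
  induction l generalizing S with
  | nil =>
    refine Runs.of_eq (.loop_done (by simp [hx])) ?_
    simp only [List.flatMap_nil, List.nil_append, List.length_nil, ones_zero] at hS hx
    subst hS
    funext y
    by_cases hy : y = x
    · subst hy; simp [hx, hxa, htx.symm]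
    · by_cases hy' : y = t
      · subst hy'; simp [hta]
      · by_cases hy'' : y = a
        · subst hy''; simp
        · simp [hy, hy', hy'']
  | cons v l ih =>
    simp only [List.flatMap_cons, List.length_append, length_un] at hcap
    refine .loop_step (a := .inl true) (l := ones l.length) (by rw [hx]; rfl) rfl
      (runs_skipNum hta v (l.flatMap un ++ r) (by simp [hS, htx]) (by simp [hxa.symm]; omega))
      (Runs.of_eq (ih ?_ ?_ ?_) ?_)
    · simp [hta]
    · simp [hxa, htx.symm]
    · simp [hxa.symm, -List.length_flatMap]; omega
    · funext y
      by_cases hy : y = a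
      · subst hy; simp [hxa.symm]
      · by_cases hy' : y = t
        · subst hy'; simp [hy]
        · by_cases hy'' : y = x
          · subst hy''; simp [hy, hy']
          · simp [hy, hy', hy'']

/-- Each one of the number on `x` skips one entry of the table, so that entry `v` comes to the top.
-/
theorem runs_lookup {t x a : K} (htx : t ≠ x) (hta : t ≠ a) (hxa : x ≠ a) (l : List ℕ) (v : ℕ)
    (hv : v < l.length) (hS : S t = l.flatMap un) (hx : S x = ones v) (ha : S a = [])
    (hcap : (S t).length ≤ cap a) (hcapt : (S t).length ≤ cap t) (hcapx : (S t).length ≤ cap x) :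
    Runs cap (lookup t x a) S (.inl (Function.update S x (ones l[v]))) := by
  have hl : l.flatMap un = (l.take v).flatMap un ++ (ones l[v] ++
      ((.inl false : Bool ⊕ D) :: (l.drop (v + 1)).flatMap un)) := by
    conv_lhs => rw [← List.take_append_drop v l, List.drop_eq_getElem_cons hv]
    rw [List.flatMap_append, List.flatMap_cons]
    simp only [un, List.append_assoc, List.singleton_append]
  have hlen : ((l.take v).flatMap (un (D := D))).length + l[v] + 1 ≤ (S t).length := by
    rw [hS, hl]
    simp only [List.length_append, List.length_cons, length_ones]
    omega
  have hcapa : l[v] + ((l.take v).flatMap (un (D := D))).length ≤ cap a := by omega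
  have hcapv : l[v] ≤ cap x := by omega
  rw [lookup]
  refine .seq (runs_skipNums htx hta hxa (l.take v) _ (hS.trans hl) (by rw [hx, List.length_take_of_le hv.le])
    (by rw [ha]; simp only [List.length_nil]; omega)) ?_
  -- The found entry is copied to `x` and also to `a`, from where the whole table goes back to `t`.
  refine .seq (runs_move₂ (l := ones l[v]) (r := .inl false :: (l.drop (v + 1)).flatMap un)
    hta htx hxa.symm (by simp [hta]) isOne_of_mem_ones (by simp [isOne])
    (by simpa [ha, -List.length_flatMap] using hcapa) (by simpa [hxa, htx.symm] using hcapv)) ?_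
  refine Runs.of_eq (runs_moveAll hta.symm ?_) ?_
  · simp [hta, hxa.symm, ha, htx]
    refine le_trans (le_of_eq ?_) hcapt
    rw [hS, hl]
    simp
    omega
  · funext y
    by_cases hy : y = t
    · subst hy; simp [htx, hta, hxa.symm, hS, hl, ha]
    · by_cases hy' : y = a
      · subst hy'; simp [hy, hxa.symm, ha]
      · by_cases hy'' : y = x
        · subst hy''; simp [hy, hy']
        · simp [hy, hy', hy'']

end Unary

end Prog
/-! ## The stacks of the simulator -/

/-- The names of the stacks; there is one for every column of the transition table. -/
inductive Reg (m : ℕ)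
  | inp | rev | num | num' | tmp | st | tab | new | out | bl | aux | sav | cnt | acc | acc' | rows
  | col (c : Option (Fin m))
  deriving DecidableEq, Fintype

/-- Stack symbols: bits, and for the entries of the transition table the symbol to be written and the
head move. -/
abbrev Sym (m : ℕ) : Type := Bool ⊕ (Option (Fin m) × Move)

instance : Finite Move :=
  Finite.of_surjective (fun i : Fin 3 => if i = 0 then Move.left else if i = 1 then .stay else .right)
    fun d => by cases d
                exacts [⟨0, rfl⟩, ⟨1, rfl⟩, ⟨2, rfl⟩]

/-- The contents of the stacks. -/
@[ext] structure Mem (m : ℕ) where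
  (inp rev num num' tmp st tab new out bl aux sav cnt acc acc' rows : List (Sym m))
  col : Option (Fin m) → List (Sym m)

namespace Mem

variable {m : ℕ}

/-- The contents as a function. -/
def fn (s : Mem m) : Reg m → List (Sym m)
  | .inp => s.inp
  | .rev => s.rev
  | .num => s.num
  | .num' => s.num'
  | .tmp => s.tmp
  | .st => s.st
  | .tab => s.tab
  | .new => s.new
  | .out => s.out
  | .bl => s.bl
  | .aux => s.aux
  | .sav => s.sav
  | .cnt => s.cnt
  | .acc => s.acc
  | .acc' => s.acc'
  | .rows => s.rows
  | .col c => s.col c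

@[simp] theorem fn_inp (s : Mem m) : s.fn .inp = s.inp := rfl

@[simp] theorem fn_rev (s : Mem m) : s.fn .rev = s.rev := rfl

@[simp] theorem fn_num (s : Mem m) : s.fn .num = s.num := rfl

@[simp] theorem fn_num₂ (s : Mem m) : s.fn .num' = s.num' := rfl

@[simp] theorem fn_tmp (s : Mem m) : s.fn .tmp = s.tmp := rfl

@[simp] theorem fn_st (s : Mem m) : s.fn .st = s.st := rfl

@[simp] theorem fn_tab (s : Mem m) : s.fn .tab = s.tab := rfl

@[simp] theorem fn_new (s : Mem m) : s.fn .new = s.new := rfl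

@[simp] theorem fn_out (s : Mem m) : s.fn .out = s.out := rfl

@[simp] theorem fn_bl (s : Mem m) : s.fn .bl = s.bl := rfl

@[simp] theorem fn_aux (s : Mem m) : s.fn .aux = s.aux := rfl

@[simp] theorem fn_sav (s : Mem m) : s.fn .sav = s.sav := rfl

@[simp] theorem fn_cnt (s : Mem m) : s.fn .cnt = s.cnt := rfl

@[simp] theorem fn_acc (s : Mem m) : s.fn .acc = s.acc := rfl

@[simp] theorem fn_acc₂ (s : Mem m) : s.fn .acc' = s.acc' := rfl

@[simp] theorem fn_rows (s : Mem m) : s.fn .rows = s.rows := rfl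

@[simp] theorem fn_col (s : Mem m) (c) : s.fn (.col c) = s.col c := rfl

@[simp] theorem update_inp (s : Mem m) (l : List (Sym m)) :
    Function.update s.fn .inp l = { s with inp := l }.fn := by
  funext r; cases r <;> rfl

@[simp] theorem update_rev (s : Mem m) (l : List (Sym m)) :
    Function.update s.fn .rev l = { s with rev := l }.fn := by
  funext r; cases r <;> rfl

@[simp] theorem update_num (s : Mem m) (l : List (Sym m)) :
    Function.update s.fn .num l = { s with num := l }.fn := by
  funext r; cases r <;> rfl

@[simp] theorem update_num₂ (s : Mem m) (l : List (Sym m)) :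
    Function.update s.fn .num' l = { s with num' := l }.fn := by
  funext r; cases r <;> rfl

@[simp] theorem update_tmp (s : Mem m) (l : List (Sym m)) :
    Function.update s.fn .tmp l = { s with tmp := l }.fn := by
  funext r; cases r <;> rfl

@[simp] theorem update_st (s : Mem m) (l : List (Sym m)) :
    Function.update s.fn .st l = { s with st := l }.fn := by
  funext r; cases r <;> rfl

@[simp] theorem update_tab (s : Mem m) (l : List (Sym m)) :
    Function.update s.fn .tab l = { s with tab := l }.fn := by
  funext r; cases r <;> rfl

@[simp] theorem update_new (s : Mem m) (l : List (Sym m)) :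
    Function.update s.fn .new l = { s with new := l }.fn := by
  funext r; cases r <;> rfl

@[simp] theorem update_out (s : Mem m) (l : List (Sym m)) :
    Function.update s.fn .out l = { s with out := l }.fn := by
  funext r; cases r <;> rfl

@[simp] theorem update_bl (s : Mem m) (l : List (Sym m)) :
    Function.update s.fn .bl l = { s with bl := l }.fn := by
  funext r; cases r <;> rfl

@[simp] theorem update_aux (s : Mem m) (l : List (Sym m)) :
    Function.update s.fn .aux l = { s with aux := l }.fn := by
  funext r; cases r <;> rfl

@[simp] theorem update_sav (s : Mem m) (l : List (Sym m)) :
    Function.update s.fn .sav l = { s with sav := l }.fn := by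
  funext r; cases r <;> rfl

@[simp] theorem update_cnt (s : Mem m) (l : List (Sym m)) :
    Function.update s.fn .cnt l = { s with cnt := l }.fn := by
  funext r; cases r <;> rfl

@[simp] theorem update_acc (s : Mem m) (l : List (Sym m)) :
    Function.update s.fn .acc l = { s with acc := l }.fn := by
  funext r; cases r <;> rfl

@[simp] theorem update_acc₂ (s : Mem m) (l : List (Sym m)) :
    Function.update s.fn .acc' l = { s with acc' := l }.fn := by
  funext r; cases r <;> rfl

@[simp] theorem update_rows (s : Mem m) (l : List (Sym m)) :
    Function.update s.fn .rows l = { s with rows := l }.fn := by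
  funext r; cases r <;> rfl

@[simp] theorem update_col (s : Mem m) (c) (l : List (Sym m)) :
    Function.update s.fn (.col c) l = { s with col := Function.update s.col c l }.fn := by
  funext r
  cases r
  case col c' =>
    by_cases h : c' = c
    · subst h; simp
    · rw [Function.update_of_ne (by simpa using h)]; simp [h]
  all_goals rfl

end Mem
namespace Sim

open Prog

variable {m n : ℕ}

/-! ## Encoding of tables -/

/-- The code of a function on states. -/
def encFun (f : Fin (n + 2) → Fin (n + 2)) : List (Sym m) :=
  (List.finRange (n + 2)).flatMap fun v => un (f v)

/-- The code of an entry of the transition table. -/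
def encItem (e : Option (Fin m) × Move × Fin (n + 2)) : List (Sym m) := .inr (e.1, e.2.1) :: un e.2.2

@[simp] theorem length_encItem (e : Option (Fin m) × Move × Fin (n + 2)) :
    (encItem e).length = e.2.2 + 2 := by simp [encItem]

theorem reverse_encItem (e : Option (Fin m) × Move × Fin (n + 2)) :
    (encItem e).reverse = .inl false :: (ones e.2.2 ++ [.inr (e.1, e.2.1)]) := by simp [encItem, un]

/-- The code of a column of the transition table; the last state is at the top. -/
def encCol (τ : Table m n) (c : Option (Fin m)) : List (Sym m) :=
  (List.finRange (n + 2)).reverse.flatMap fun v => encItem (τ c v)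

theorem length_flatMap_le {α β : Type} (l : List α) (f : α → List β) (b : ℕ)
    (h : ∀ a ∈ l, (f a).length ≤ b) : (l.flatMap f).length ≤ l.length * b := by
  induction l with
  | nil => simp
  | cons a l ih =>
    have h1 := h a (by simp)
    have h2 := ih fun x hx => h x (by simp [hx])
    rw [List.flatMap_cons, List.length_append, List.length_cons, Nat.add_mul]
    omega

/-- The room on the stacks. -/
abbrev room (n : ℕ) : ℕ := (n + 3) * (n + 3)

theorem length_encFun (f : Fin (n + 2) → Fin (n + 2)) :
    (encFun f : List (Sym m)).length ≤ room n := by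
  have := length_flatMap_le (List.finRange (n + 2)) (fun v => (un (f v) : List (Sym m))) (n + 3)
    (fun v _ => by rw [length_un]; omega)
  rw [List.length_finRange] at this
  exact this.trans (Nat.mul_le_mul_right _ (by omega))

theorem length_encCol (τ : Table m n) (c : Option (Fin m)) : (encCol τ c).length ≤ room n := by
  have := length_flatMap_le (List.finRange (n + 2)).reverse (fun v => encItem (τ c v)) (n + 3)
    (fun v _ => by rw [encItem, List.length_cons, length_un]; omega)
  rw [List.length_reverse, List.length_finRange] at this
  exact this.trans (Nat.mul_le_mul_right _ (by omega))

theorem add_two_le_room : n + 3 ≤ room n := Nat.le_mul_of_pos_left _ (by omega)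

/-- All stacks but those for the input have enough room. -/
def Roomy (n : ℕ) (cap : Reg m → ℕ) : Prop := ∀ r, r ≠ .inp → r ≠ .rev → room n ≤ cap r

variable {cap : Reg m → ℕ}

theorem runs_lookup_fun {s : Mem m} {t x : Reg m} (hR : Roomy n cap) (htx : t ≠ x) (hta : t ≠ .aux)
    (hxa : x ≠ .aux) (ht : t ≠ .inp ∧ t ≠ .rev) (hx' : x ≠ .inp ∧ x ≠ .rev)
    (f : Fin (n + 2) → Fin (n + 2)) (v : Fin (n + 2)) (hS : s.fn t = encFun f)
    (hx : s.fn x = ones v) (ha : s.aux = []) :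
    Runs cap (lookup t x .aux) s.fn (.inl (Function.update s.fn x (ones (f v)))) := by
  have hl := length_encFun (m := m) f
  rw [← hS] at hl
  have := runs_lookup (cap := cap) (S := s.fn) htx hta hxa
    ((List.finRange (n + 2)).map fun v => (f v).val) v (by simp)
    (by rw [hS, encFun, List.flatMap_map]) hx ha (hl.trans (hR _ (by simp) (by simp)))
    (hl.trans (hR _ ht.1 ht.2)) (hl.trans (hR _ hx'.1 hx'.2))
  simpa using this

/-! ## One pass over a column of the transition table -/

/-- Go through the column `c`, and for each entry replace its new state by the result of `act`; the
results are collected on the stack `new`. -/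
def pass (c : Option (Fin m)) (act : Option (Fin m) × Move → Prog (Reg m) (Sym m)) :
    Prog (Reg m) (Sym m) :=
  .seq (.loop (.col c) Sum.isRight fun a => .seq (.push .sav a) (.seq (move₂ (.col c) isOne .sav .tmp)
    (.seq (.case (.col c) fun _ => .push .sav (.inl false))
      (.seq (Sum.elim (fun _ => .skip) act a) (.seq (.push .out (.inl false)) (moveAll .tmp .out))))))
  (.seq (moveAll .sav (.col c)) (.seq (drain .new) (.seq (moveAll .out .aux) (moveAll .aux .new))))

/-- A column has the last state on top, so the results pushed on `out` end with that of state `0` on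
top, the order of `encFun`. The hypothesis on `act` quantifies over the stacks in motion and lets it
change only `tmp`. -/
theorem runs_passLoop (hR : Roomy n cap) (τ : Table m n) (c : Option (Fin m))
    (act : Option (Fin m) × Move → Prog (Reg m) (Sym m)) (φ : Fin (n + 2) → Fin (n + 2)) (s : Mem m)
    (hact : ∀ v u w z, Runs cap (act ((τ c v).1, (τ c v).2.1))
      { s with col := Function.update s.col c u, sav := w, out := z, tmp := ones (τ c v).2.2 }.fn
      (.inl { s with col := Function.update s.col c u, sav := w, out := z, tmp := ones (φ v) }.fn))
    (vs : List (Fin (n + 2))) (w z : List (Sym m))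
    (hw : (vs.flatMap fun v => encItem (τ c v)).length + w.length ≤ room n)
    (hz : (vs.flatMap fun v => (un (φ v) : List (Sym m))).length + z.length ≤ room n) :
    Runs cap (.loop (.col c) Sum.isRight fun a => .seq (.push .sav a)
        (.seq (move₂ (.col c) isOne .sav .tmp) (.seq (.case (.col c) fun _ => .push .sav (.inl false))
        (.seq (Sum.elim (fun _ => .skip) act a) (.seq (.push .out (.inl false)) (moveAll .tmp .out))))))
      { s with
        col := Function.update s.col c (vs.flatMap fun v => encItem (τ c v))
        sav := w, out := z, tmp := [] }.fn
      (.inl { s with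
        col := Function.update s.col c []
        sav := (vs.flatMap fun v => encItem (τ c v)).reverse ++ w
        out := (vs.reverse.flatMap fun v => un (φ v)) ++ z, tmp := [] }.fn) := by
  have hsav := hR .sav (by simp) (by simp)
  have htmp := hR .tmp (by simp) (by simp)
  have hout := hR .out (by simp) (by simp)
  have hn := add_two_le_room (n := n)
  induction vs generalizing w z with
  | nil => exact .loop_done (by simp)
  | cons v vs ih =>
    simp only [List.flatMap_cons, List.length_append, length_un] at hw hz
    simp only [length_encItem] at hw
    refine .loop_step (a := .inr ((τ c v).1, (τ c v).2.1))
      (l := ones (τ c v).2.2 ++ (.inl false :: vs.flatMap fun v => encItem (τ c v)))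
      (by simp [encItem, un]) rfl (S' := { s with
        col := Function.update s.col c (vs.flatMap fun v => encItem (τ c v))
        sav := (encItem (τ c v)).reverse ++ w
        out := un (φ v) ++ z, tmp := [] }.fn) ?_ (Runs.of_eq (ih _ _ ?_ ?_) ?_)
    · simp only [Mem.update_col, Function.update_idem]
      refine .seq (.push (by simp; omega)) ?_
      simp only [Mem.update_sav, Mem.fn_sav]
      refine .seq (runs_move₂ (l := ones (τ c v).2.2)
        (r := .inl false :: vs.flatMap fun v => encItem (τ c v)) (by simp) (by simp) (by simp) (by simp)
        isOne_of_mem_ones rfl (by simp; omega) (by simp; omega)) ?_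
      simp only [Mem.update_col, Mem.update_sav, Mem.update_tmp, Mem.fn_sav, Mem.fn_tmp,
        Function.update_idem]
      refine .seq (.case (.push (by simp; omega))) ?_
      simp only [Mem.update_col, Mem.update_sav, Mem.fn_sav, Mem.fn_col, Function.update_idem,
        Function.update_self, List.tail_cons, reverse_ones, List.append_nil]
      refine .seq (hact v _ _ _) ?_
      refine .seq (.push (by simp; omega)) ?_
      simp only [Mem.update_out, Mem.fn_out]
      refine Runs.of_eq (runs_moveAll (by simp) (by simp; omega)) ?_
      simp [encItem, un]
    · simp only [List.length_append, List.length_reverse, length_encItem]; omega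
    · simp only [List.length_append, length_un]; omega
    · simp

theorem runs_pass (hR : Roomy n cap) (τ : Table m n) (c : Option (Fin m))
    (act : Option (Fin m) × Move → Prog (Reg m) (Sym m)) (φ : Fin (n + 2) → Fin (n + 2)) (s : Mem m)
    (hact : ∀ v u w z, Runs cap (act ((τ c v).1, (τ c v).2.1))
      { s with col := Function.update s.col c u, sav := w, out := z, tmp := ones (τ c v).2.2 }.fn
      (.inl { s with col := Function.update s.col c u, sav := w, out := z, tmp := ones (φ v) }.fn))
    (hcol : s.col c = encCol τ c) (hsav : s.sav = []) (hout : s.out = []) (htmp : s.tmp = [])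
    (haux : s.aux = []) :
    Runs cap (pass c act) s.fn (.inl { s with new := encFun φ }.fn) := by
  have h1 := length_encCol τ c
  have h2 := length_encFun (m := m) φ
  have h2' : ((List.finRange (n + 2)).reverse.flatMap fun v => (un (φ v) : List (Sym m))).length
      ≤ room n := by
    refine le_trans (le_of_eq ?_) h2
    rw [encFun]
    simp
  have key := runs_passLoop hR τ c act φ s hact (List.finRange (n + 2)).reverse [] []
    h1 h2'
  have e : ({ s with
        col := Function.update s.col c ((List.finRange (n + 2)).reverse.flatMap fun v => encItem (τ c v))
        sav := [], out := [], tmp := [] } : Mem m) = s := by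
    have e : Function.update s.col c ((List.finRange (n + 2)).reverse.flatMap
        fun v => encItem (τ c v)) = s.col := by
      rw [← encCol, ← hcol, Function.update_eq_self]
    rw [e]
    ext1 <;> simp [*]
  rw [e, List.reverse_reverse, List.append_nil, List.append_nil, ← encFun, ← encCol] at key
  refine .seq key ?_
  refine .seq (runs_moveAll (by simp) ?_) ?_
  · simpa using h1.trans (hR _ (by simp) (by simp))
  simp only [Mem.update_col, Mem.update_sav, Mem.fn_col, Mem.fn_sav, Function.update_idem,
    Function.update_self, List.reverse_reverse, List.append_nil]
  -- `act` may consult the previous table on `new` during the whole loop, so that table is dropped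
  -- only now. Two moves through `aux` keep the order of the new one.
  refine .seq runs_drain ?_
  simp only [Mem.update_new]
  refine .seq (runs_moveAll (by simp) ?_) ?_
  · simpa [haux] using h2.trans (hR _ (by simp) (by simp))
  simp only [Mem.update_out, Mem.update_aux, Mem.fn_aux, Mem.fn_out, haux, List.append_nil]
  refine Runs.of_eq (runs_moveAll (by simp) ?_) ?_
  · simpa using h2.trans (hR _ (by simp) (by simp))
  · simp only [Mem.update_new, Mem.update_aux, Mem.fn_aux, Mem.fn_new, List.reverse_reverse,
      List.append_nil, ← hcol, Function.update_eq_self]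
    congr 1
    ext1 <;> simp [*]

/-! ## Computing behaviours -/

/-- Iterate the passes `act` over the column `c`, as often as there are states, and store the result on
the stack `dst`. -/
def iter (c : Option (Fin m)) (act : Option (Fin m) × Move → Prog (Reg m) (Sym m)) (dst : Reg m) :
    Prog (Reg m) (Sym m) :=
  .seq (repeatFor .num .num' (.push .new (.inl false)))
    (.seq (repeatFor .num .num' (pass c act))
      (.seq (drain dst) (.seq (moveAll .new .aux) (moveAll .aux dst))))

/-- The `n + 2` ones on `num` serve twice: for writing the constant function `0`, whose code
consists of `n + 2` end markers, and for counting the Kleene iterations. -/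
theorem runs_iter (hR : Roomy n cap) (τ : Table m n) (c : Option (Fin m))
    (act : Option (Fin m) × Move → Prog (Reg m) (Sym m))
    (φ : (Fin (n + 2) → Fin (n + 2)) → Fin (n + 2) → Fin (n + 2)) {dst : Reg m}
    (hd : dst = .tab ∨ dst = .bl) (s : Mem m)
    (hact : ∀ f v x y u w z, Runs cap (act ((τ c v).1, (τ c v).2.1))
      { s with
        num := x, num' := y, new := encFun f
        col := Function.update s.col c u, sav := w, out := z, tmp := ones (τ c v).2.2 }.fn
      (.inl { s with
        num := x, num' := y, new := encFun f
        col := Function.update s.col c u, sav := w, out := z, tmp := ones (φ f v) }.fn))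
    (hcol : s.col c = encCol τ c) (hsav : s.sav = []) (hout : s.out = []) (htmp : s.tmp = [])
    (haux : s.aux = []) (hnum : s.num = ones (n + 2)) (hnum' : s.num' = []) (hnew : s.new = []) :
    Runs cap (iter c act dst) s.fn
      (.inl (Function.update s.fn dst (encFun (φ^[n + 2] fun _ => 0)))) := by
  have hn := add_two_le_room (n := n)
  have cnum := hR .num (by simp) (by simp)
  have cnum' := hR .num' (by simp) (by simp)
  have cnew := hR .new (by simp) (by simp)
  have caux := hR .aux (by simp) (by simp)
  have cdst := hR dst (by rcases hd with rfl | rfl <;> simp) (by rcases hd with rfl | rfl <;> simp)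
  have hnd : dst ≠ .new ∧ dst ≠ .aux := by rcases hd with rfl | rfl <;> simp
  have e0 : (encFun (fun _ : Fin (n + 2) => 0) : List (Sym m)) =
      List.replicate (n + 2) (.inl false) := by
    rw [encFun]
    simp [un, List.map_const', ← List.map_eq_flatMap]
  refine .seq (S' := { s with new := encFun fun _ : Fin (n + 2) => 0 }.fn) ?_ ?_
  · have := runs_repeatFor (cap := cap) (i := .num) (j := .num') (by simp)
      (fun t => { s with new := List.replicate t (.inl false) }.fn) (p := .push .new (.inl false))
      (ones (n + 2)) (by simp; omega) (by simp; omega) (fun t ht u w => ?_) hnum hnum' hnum hnum'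
    · rw [e0]
      simpa [← hnew] using this
    · simp only [Mem.update_num, Mem.update_num₂]
      simp only [length_ones] at ht
      refine Runs.of_eq (.push (by simp; omega)) ?_
      simp [List.replicate_succ]
  refine .seq (S' := { s with new := encFun (φ^[n + 2] fun _ => 0) }.fn) ?_ ?_
  · have := runs_repeatFor (cap := cap) (i := .num) (j := .num') (by simp)
      (fun t => { s with new := encFun (φ^[t] fun _ => 0) }.fn) (p := pass c act) (ones (n + 2))
      (by simp; omega) (by simp; omega) (fun t _ u w => ?_) hnum hnum' hnum hnum'
    · simpa using this
    · simp only [Mem.update_num, Mem.update_num₂, Function.iterate_succ_apply']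
      exact runs_pass hR τ c act (φ _) _ (fun v u' w' z' => hact _ v u w u' w' z') hcol hsav hout htmp haux
  refine .seq runs_drain ?_
  generalize φ^[n + 2] (fun _ => 0) = g
  have hl := length_encFun (m := m) g
  refine .seq (runs_moveAll (by simp) ?_) (Runs.of_eq (runs_moveAll hnd.2.symm ?_) ?_)
  · simp [hnd.1.symm, hnd.2.symm, haux]
    omega
  · simp [hnd.1, hnd.2, hnd.1.symm, hnd.2.symm, haux]
    omega
  · rcases hd with rfl | rfl <;> simp [haux, hnew]

end Sim
namespace Sim

open Prog

variable {m n : ℕ} {cap : Reg m → ℕ}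

/-! ## The simulation -/

/-- The stacks during the simulation. -/
def state (τ : Table m n) (inp cnt aux : List (Sym m))
    (x : Fin (n + 2) × (Fin (n + 2) → Fin (n + 2))) : Mem m where
  inp := inp
  rev := []
  num := ones (n + 2)
  num' := []
  tmp := []
  st := ones x.1
  tab := encFun x.2
  new := []
  out := []
  bl := encFun τ.blank
  aux := aux
  sav := []
  cnt := cnt
  acc := []
  acc' := []
  rows := []
  col := encCol τ

/-- The case distinction of `Table.wordFun`: `tab` holds the behaviour of the word, `new` the
present approximation and `tmp` the new state of the entry. -/
def actWord : Option (Fin m) × Move → Prog (Reg m) (Sym m)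
  | (_, .left) => .seq (lookup .tab .tmp .aux) (lookup .new .tmp .aux)
  | (_, .stay) => lookup .new .tmp .aux
  | (_, .right) => .skip

/-- The case distinction of `Table.blankFun`. An empty stack `tmp` is the state `0`, the outcome of
a write that is not available. -/
def actBlank : Option (Fin m) × Move → Prog (Reg m) (Sym m)
  | (some _, _) => drain .tmp
  | (none, .left) => .skip
  | (none, .stay) => lookup .new .tmp .aux
  | (none, .right) => .seq (lookup .new .tmp .aux) (lookup .new .tmp .aux)

/-- Replace the behaviour of a word by that of the word followed by `a`. -/
def extendProg (a : Fin m) : Prog (Reg m) (Sym m) := iter (some a) actWord .tab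

theorem runs_extendProg (hR : Roomy n cap) (τ : Table m n) (inp cnt : List (Sym m)) (v t) (a : Fin m) :
    Runs cap (extendProg a) (state τ inp cnt [] (v, t)).fn
      (.inl (state τ inp cnt [] (v, τ.extend a t)).fn) := by
  refine Runs.of_eq (runs_iter hR τ (some a) actWord (τ.wordFun a t) (Or.inl rfl) _ ?_ rfl rfl rfl rfl
    rfl rfl rfl rfl) ?_
  · intro f v x y u w z
    rw [Table.wordFun]
    obtain ⟨p, d, v'⟩ := τ (some a) v
    cases d <;> simp only [actWord]
    · refine .seq (runs_lookup_fun hR (by simp) (by simp) (by simp) (by simp) (by simp) t v'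
        rfl rfl rfl) ?_
      simp only [Mem.update_tmp]
      refine Runs.of_eq (runs_lookup_fun hR (by simp) (by simp) (by simp) (by simp) (by simp) f (t v')
        rfl rfl rfl) ?_
      simp only [Mem.update_tmp]
    · refine Runs.of_eq (runs_lookup_fun hR (by simp) (by simp) (by simp) (by simp) (by simp) f v'
        rfl rfl rfl) ?_
      simp only [Mem.update_tmp]
    · exact .skip _
  · simp only [Mem.update_tab]
    rfl

/-- Compute the behaviour of the blank part of the tape. -/
def blankProg : Prog (Reg m) (Sym m) := iter none actBlank .bl

theorem runs_blankProg (hR : Roomy n cap) (τ : Table m n) (inp cnt l : List (Sym m)) (x) :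
    Runs cap blankProg { state τ inp cnt [] x with bl := l }.fn
      (.inl (state τ inp cnt [] x).fn) := by
  refine Runs.of_eq (runs_iter hR τ none actBlank τ.blankFun (Or.inr rfl) _ ?_ rfl rfl rfl rfl
    rfl rfl rfl rfl) ?_
  · intro f v x y u w z
    rw [Table.blankFun]
    obtain ⟨p, d, v'⟩ := τ none v
    rcases p with _ | p
    · cases d <;> simp only [actBlank]
      · exact .skip _
      · refine Runs.of_eq (runs_lookup_fun hR (by simp) (by simp) (by simp) (by simp) (by simp) f v'
          rfl rfl rfl) ?_
        simp only [Mem.update_tmp]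
      · refine .seq (runs_lookup_fun hR (by simp) (by simp) (by simp) (by simp) (by simp) f v'
          rfl rfl rfl) ?_
        simp only [Mem.update_tmp]
        refine Runs.of_eq (runs_lookup_fun hR (by simp) (by simp) (by simp) (by simp) (by simp) f (f v')
          rfl rfl rfl) ?_
        simp only [Mem.update_tmp]
    · refine Runs.of_eq runs_drain ?_
      simp only [Mem.update_tmp]
      rfl
  · simp only [Mem.update_bl]
    rfl

/-- Replace the state on the stack `st` by its image under the table on the stack `t`. -/
def applyProg (t : Reg m) : Prog (Reg m) (Sym m) := lookup t .st .aux

theorem runs_apply_tab (hR : Roomy n cap) (τ : Table m n) (inp cnt : List (Sym m)) (v t) :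
    Runs cap (applyProg .tab) (state τ inp cnt [] (v, t)).fn
      (.inl (state τ inp cnt [] (t v, t)).fn) := by
  refine Runs.of_eq (runs_lookup_fun hR (by simp) (by simp) (by simp) (by simp) (by simp) t v
    rfl rfl rfl) ?_
  simp only [Mem.update_st]
  rfl

theorem runs_apply_bl (hR : Roomy n cap) (τ : Table m n) (inp cnt : List (Sym m)) (v t) :
    Runs cap (applyProg .bl) (state τ inp cnt [] (v, t)).fn
      (.inl (state τ inp cnt [] (τ.blank v, t)).fn) := by
  refine Runs.of_eq (runs_lookup_fun hR (by simp) (by simp) (by simp) (by simp) (by simp) τ.blank v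
    rfl rfl rfl) ?_
  simp only [Mem.update_st]
  rfl

/-- The effect of an input symbol. -/
def readProg (a : Fin m) : Prog (Reg m) (Sym m) := .seq (extendProg a) (applyProg .tab)

theorem runs_readProg (hR : Roomy n cap) (τ : Table m n) (inp cnt : List (Sym m)) (x) (a : Fin m) :
    Runs cap (readProg a) (state τ inp cnt [] x).fn (.inl (state τ inp cnt [] (τ.read x a)).fn) :=
  .seq (runs_extendProg hR τ inp cnt x.1 x.2 a) (runs_apply_tab hR τ inp cnt _ _)

/-- What to do after a step at the first blank cell. -/
def actTop : Option (Fin m) × Move → Prog (Reg m) (Sym m)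
  | (none, .left) => applyProg .tab
  | (none, .stay) => .skip
  | (none, .right) => applyProg .bl
  | (some a, .left) => .seq (applyProg .tab) (.seq (extendProg a) (applyProg .tab))
  | (some a, .stay) => .seq (extendProg a) (applyProg .tab)
  | (some a, .right) => extendProg a

/-- One step at the first blank cell and the way back to the first blank cell: look up the entry of the
present state in the column of the blank, and act accordingly. -/
def topProg : Prog (Reg m) (Sym m) :=
  .seq (moveAll (.col none) .sav)
  (.seq (.loop .st (fun _ => true) fun _ => .seq (move .sav Sum.isLeft (.col none))
      (.case .sav fun a => a.elim .skip (.push (.col none))))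
  (.seq (.case .sav fun a => a.elim .skip (.push (.col none)))
  (.seq (move₂ .sav isOne (.col none) .st)
  (.case .sav fun a => match a with
    | some (.inr e) => .seq (.push (.col none) (.inr e)) (.seq (moveAll .sav (.col none)) (actTop e))
    | _ => .skip))))

theorem runs_actTop (hR : Roomy n cap) (τ : Table m n) (inp cnt : List (Sym m)) (x) :
    Runs cap (actTop ((τ none x.1).1, (τ none x.1).2.1)) (state τ inp cnt [] ((τ none x.1).2.2, x.2)).fn
      (.inl (state τ inp cnt [] (τ.top x)).fn) := by
  rw [Table.top]
  obtain ⟨p, d, v⟩ := τ none x.1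
  rcases p with _ | a <;> cases d <;> simp only [actTop]
  · exact runs_apply_tab hR τ inp cnt _ _
  · exact .skip _
  · exact runs_apply_bl hR τ inp cnt _ _
  · exact .seq (runs_apply_tab hR τ inp cnt _ _)
      (.seq (runs_extendProg hR τ inp cnt _ _ a) (runs_apply_tab hR τ inp cnt _ _))
  · exact .seq (runs_extendProg hR τ inp cnt _ _ a) (runs_apply_tab hR τ inp cnt _ _)
  · exact runs_extendProg hR τ inp cnt _ _ a

/-- On `sav` the entries are reversed, so the bits of an entry come before its symbol of kind
`Sum.inr`. Popping bits and one more symbol therefore passes exactly one entry. -/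
theorem runs_skipItems (s : Mem m) (l : List (Option (Fin m) × Move × Fin (n + 2))) (r : List (Sym m))
    (hst : s.st = ones l.length) (hsav : s.sav = (l.flatMap fun e => (encItem e).reverse) ++ r)
    (hcap : s.sav.length + (s.col none).length ≤ cap (.col none)) :
    Runs cap (.loop .st (fun _ => true) fun _ => .seq (move .sav Sum.isLeft (.col none))
      (.case .sav fun a => a.elim .skip (.push (.col none)))) s.fn
      (.inl { s with
        st := [], sav := r
        col := Function.update s.col none
          ((l.flatMap fun e => (encItem e).reverse).reverse ++ s.col none) }.fn) := by
  induction l generalizing s with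
  | nil =>
    refine Runs.of_eq (.loop_done (by simp [hst])) ?_
    obtain ⟨⟩ := s
    simp at hst hsav
    simp [hst, hsav]
  | cons e l ih =>
    have hsav' : s.sav = (un e.2.2).reverse ++ (.inr (e.1, e.2.1) ::
        ((l.flatMap fun e => (encItem e).reverse) ++ r)) := by
      rw [hsav]; simp [encItem]
    have hlen := congrArg List.length hsav'
    simp only [List.length_append, List.length_reverse, length_un, List.length_cons] at hlen
    refine .loop_step (a := .inl true) (l := ones l.length) (by simp [hst, ones_succ]) rfl
      (S' := { s with
        st := ones l.length
        sav := (l.flatMap fun e => (encItem e).reverse) ++ r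
        col := Function.update s.col none (encItem e ++ s.col none) }.fn) ?_
      (Runs.of_eq (ih _ rfl rfl ?_) ?_)
    · simp only [Mem.update_st]
      refine .seq (runs_move (i := Reg.sav) (j := Reg.col none) (by simp) (un e.2.2).reverse _ hsav' ?_ rfl
        ?_) ?_
      · simp [un, ones]
      · simp; omega
      · simp only [Mem.update_sav, Mem.update_col, Mem.fn_col]
        refine .case (Runs.of_eq (.push ?_) ?_)
        · simp; omega
        · simp [encItem]
    · simp only [List.length_append, Function.update_self, length_encItem]
      omega
    · simp

/-- Moved to `sav`, the column begins with state `0`, so the unary state `v` counts the entries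
before its own. Everything popped is put back on the column; the ones of the new state go to `st` as
well. -/
theorem runs_topProg (hR : Roomy n cap) (τ : Table m n) (inp cnt : List (Sym m)) (x) :
    Runs cap topProg (state τ inp cnt [] x).fn (.inl (state τ inp cnt [] (τ.top x)).fn) := by
  obtain ⟨v, t⟩ := x
  have hcap := (length_encCol τ none).trans (hR (.col none) (by simp) (by simp))
  have hcap' := (length_encCol τ none).trans (hR .sav (by simp) (by simp))
  have hst := (add_two_le_room (n := n)).trans (hR .st (by simp) (by simp))
  set l₁ := (List.finRange (n + 2)).take v with hl₁
  set l₂ := (List.finRange (n + 2)).drop (v + 1) with hl₂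
  have hl : List.finRange (n + 2) = l₁ ++ v :: l₂ := by
    conv_lhs => rw [← List.take_append_drop v (List.finRange (n + 2)),
      List.drop_eq_getElem_cons (by simp), List.getElem_finRange]
    simp [hl₁, hl₂]
  set A : List (Sym m) := (l₁.map (τ none)).flatMap fun e => (encItem e).reverse with hA
  set B : List (Sym m) := (l₂.map (τ none)).flatMap fun e => (encItem e).reverse with hB
  have hcol : (encCol τ none).reverse = A ++ ((encItem (τ none v)).reverse ++ B) := by
    rw [encCol, hl, hA, hB]
    simp [List.reverse_flatMap, List.flatMap_map, Function.comp_def]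
  have hlen := congrArg List.length hcol
  simp only [List.length_append, List.length_reverse, length_encItem] at hlen
  refine .seq (runs_moveAll (by simp) (by simpa [state] using hcap')) ?_
  simp only [Mem.update_col, Mem.update_sav, Mem.fn_col, Mem.fn_sav]
  refine .seq (runs_skipItems _ (l₁.map (τ none)) ((encItem (τ none v)).reverse ++ B) ?_ ?_ ?_) ?_
  · simp [state, hl₁]
  · simp only [state, List.append_nil]
    exact hcol
  · simpa [state] using hcap
  simp only [Function.update_idem, Function.update_self, List.append_nil]
  simp only [state, reverse_encItem, List.cons_append, List.append_assoc, List.nil_append]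
  have hA' : (List.flatMap (fun e => .inl false :: (ones e.2.2 ++ [.inr (e.1, e.2.1)]))
      (List.map (τ none) l₁) : List (Sym m)) = A := by
    rw [hA]; simp only [reverse_encItem]
  rw [hA']
  refine .seq (Runs.case_cons rfl (.push ?_)) ?_
  · simp
    omega
  simp only [Mem.update_sav, Mem.update_col, Mem.fn_col, Function.update_self, Function.update_idem]
  refine .seq (runs_move₂ (i := Reg.sav) (j := Reg.col none) (by simp) (by simp) (by simp)
    (ones (τ none v).2.2) (.inr ((τ none v).1, (τ none v).2.1) :: B) rfl isOne_of_mem_ones rfl ?_ ?_) ?_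
  · simp
    omega
  · simp
    omega
  simp only [Mem.update_sav, Mem.update_col, Mem.fn_col, Mem.update_st, Mem.fn_st, Function.update_self,
    Function.update_idem, reverse_ones, List.append_nil]
  refine .case_cons rfl (.seq (.push ?_) ?_)
  · simp
    omega
  simp only [Mem.update_sav, Mem.update_col, Mem.fn_col, Function.update_self, Function.update_idem]
  refine .seq (runs_moveAll (by simp) ?_) ?_
  · simp
    omega
  simp only [Mem.update_sav, Mem.update_col, Mem.fn_col, Mem.fn_sav, Function.update_self,
    Function.update_idem]
  have hcol' : B.reverse ++ .inr ((τ none v).1, (τ none v).2.1) :: (ones (τ none v).2.2 ++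
      .inl false :: A.reverse) = encCol τ none := by
    rw [← List.reverse_inj, hcol]
    simp [reverse_encItem]
  rw [hcol', Function.update_eq_self]
  exact runs_actTop hR τ inp cnt (v, t)

end Sim
namespace Sim

open Prog

variable {m n : ℕ} {cap : Reg m → ℕ}

/-! ## A binary counter -/

/-- Run `body` as long as the binary counter on the stack `cnt` is not zero; each time the counter is
decremented. -/
def countLoop (body : Prog (Reg m) (Sym m)) : Prog (Reg m) (Sym m) :=
  .loop .cnt (fun _ => true) fun a => match a with
    | .inl true => .seq (.push .cnt (.inl false)) (.seq (moveAll .aux .cnt) body)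
    | _ => .push .aux (.inl true)

def zeros (D : ℕ) : List (Sym m) := List.replicate D (.inl false)

/-- The least significant digit is on top. Zeros above a one are the borrow: they are remembered on
`aux` as the ones they become after the decrement. -/
theorem runs_countLoop_zeros (hR : Roomy n cap) {body : Prog (Reg m) (Sym m)} (τ : Table m n)
    (inp rest : List (Sym m)) (x) {r} (D A : ℕ) (hD : D + A ≤ room n)
    (h : Runs cap (countLoop body) (state τ inp rest (ones (D + A)) x).fn r) :
    Runs cap (countLoop body) (state τ inp (zeros D ++ rest) (ones A) x).fn r := by
  have hc := hR .aux (by simp) (by simp)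
  induction D generalizing A with
  | zero => simpa [zeros] using h
  | succ D ih =>
    refine .loop_step (a := .inl false) (l := zeros D ++ rest) rfl rfl
      (S' := (state τ inp (zeros D ++ rest) (ones (A + 1)) x).fn) (Runs.of_eq (.push ?_) ?_)
      (ih (A + 1) (by omega) (by rwa [show D + (A + 1) = D + 1 + A by omega]))
    · simp [state]; omega
    · simp only [Mem.update_cnt, Mem.update_aux]
      rfl

/-- Counting down `D + 1` ones means counting down the lower `D` digits, one decrement that borrows
from the next digit, and counting down the lower digits again: `2 * (2 ^ D - 1) + 1` runs of the
body. -/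
theorem runs_countLoop_ones (hR : Roomy n cap) {body : Prog (Reg m) (Sym m)} (τ : Table m n)
    (f : Fin (n + 2) × (Fin (n + 2) → Fin (n + 2)) → Fin (n + 2) × (Fin (n + 2) → Fin (n + 2)))
    (inp : List (Sym m))
    (hb : ∀ cnt x, Runs cap body (state τ inp cnt [] x).fn (.inl (state τ inp cnt [] (f x)).fn))
    {r} (D : ℕ) (rest : List (Sym m)) (x) (hD : D + rest.length ≤ room n)
    (h : Runs cap (countLoop body) (state τ inp (zeros D ++ rest) [] (f^[2 ^ D - 1] x)).fn r) :
    Runs cap (countLoop body) (state τ inp (ones D ++ rest) [] x).fn r := by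
  have hc := hR .cnt (by simp) (by simp)
  induction D generalizing rest x with
  | zero => simpa [zeros] using h
  | succ D ih =>
    have e1 : ∀ (b : Bool) (r : List (Sym m)), List.replicate (D + 1) (.inl b) ++ r =
        List.replicate D (.inl b) ++ .inl b :: r := by
      intro b r
      rw [List.replicate_succ', List.append_assoc]
      rfl
    rw [zeros, e1] at h
    rw [ones, e1]
    refine ih (.inl true :: rest) x (by simp; omega) ?_
    -- The lower digits are zero now, and the digit behind them is still one; it turns to zero with
    -- one run of the body.
    refine runs_countLoop_zeros hR τ inp (.inl true :: rest) _ D 0 (by omega) ?_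
    refine .loop_step (a := .inl true) (l := rest) rfl rfl
      (S' := (state τ inp (ones D ++ .inl false :: rest) [] (f (f^[2 ^ D - 1] x))).fn) ?_ ?_
    · simp only [Mem.update_cnt]
      refine .seq (.push (by simp; omega)) ?_
      simp only [Mem.update_cnt]
      refine .seq (runs_moveAll (by simp) ?_) ?_
      · simp [state]; omega
      · simp only [Mem.update_cnt, Mem.update_aux]
        refine Eq.subst (motive := fun S => Runs cap body S _) ?_ (hb _ _)
        simp [state]
    · refine ih (.inl false :: rest) _ (by simp; omega) ?_
      rw [← Function.iterate_succ_apply' f, ← Function.iterate_add_apply f]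
      have e2 : 2 ^ D - 1 + (2 ^ D - 1).succ = 2 ^ (D + 1) - 1 := by
        have := Nat.one_le_two_pow (n := D)
        rw [pow_succ]
        omega
      rw [e2]
      exact h

/-- Run the simulation at the first blank cell until the counter is zero, and give the answer. -/
def decideProg : Prog (Reg m) (Sym m) :=
  .seq (countLoop topProg) (.case .st fun a => a.elim (.halt false) fun _ =>
    .case .st fun a => a.elim (.halt true) fun _ => .halt false)

theorem runs_decideProg (hR : Roomy n cap) (τ : Table m n) (D : ℕ) (hD : D ≤ room n) (x) :
    Runs cap decideProg (state τ [] (ones D) [] x).fn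
      (.inr (decide ((τ.top^[2 ^ D - 1] x).1 = 1))) := by
  have h1 : Runs cap (countLoop topProg) (state τ [] (ones D) [] x).fn
      (.inl (state τ [] [] (ones D) (τ.top^[2 ^ D - 1] x)).fn) := by
    have := runs_countLoop_ones hR (body := topProg) τ τ.top []
      (fun cnt x => runs_topProg hR τ [] cnt x)
      (r := .inl (state τ [] [] (ones D) (τ.top^[2 ^ D - 1] x)).fn) D [] x (by simpa using hD) ?_
    · simpa using this
    -- With no digit left behind the zeros the loop ends; the `D` ones prepared for the borrow
    -- remain on `aux`, which does no harm.
    · have h0 := runs_countLoop_zeros hR (body := topProg) τ [] [] (τ.top^[2 ^ D - 1] x) D 0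
        (by simpa using hD) (Runs.loop_done rfl)
      simpa using h0
  refine .seq h1 ?_
  generalize (τ.top^[2 ^ D - 1] x) = y
  obtain ⟨v, t⟩ := y
  have hst : (state τ [] [] (ones D) (v, t)).fn .st = ones v := rfl
  rcases hv : v.val with _ | _ | j
  · refine .case_nil (by rw [hst, hv]; rfl) ?_
    have : v ≠ 1 := by rintro rfl; simp at hv
    simpa [this] using Runs.halt _ _
  · refine .case_cons (by rw [hst, hv]; rfl) (.case_nil (by simp) ?_)
    have : v = 1 := by ext; simpa using hv
    simpa [this] using Runs.halt _ _
  · refine .case_cons (by rw [hst, hv]; rfl) (.case_cons (a := .inl true) (l := ones j) (by simp; rfl) ?_)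
    have : v ≠ 1 := by rintro rfl; simp at hv
    simpa [this] using Runs.halt _ _

/-! ## Initialisation -/

/-- Put as many ones on the stack `j` as there are on `i`, with the help of the stack `a`. -/
def copyProg (i j a : Reg m) : Prog (Reg m) (Sym m) :=
  .seq (move₂ i (fun _ => true) a j) (moveAll a i)

theorem runs_copyProg {i j a : Reg m} (hij : i ≠ j) (hia : i ≠ a) (hja : j ≠ a) {S : Reg m → List (Sym m)}
    (v : ℕ) (hi : S i = ones v) (ha : S a = []) (hcj : v + (S j).length ≤ cap j) (hca : v ≤ cap a)
    (hci : v ≤ cap i) :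
    Runs cap (copyProg i j a) S (.inl (Function.update S j (ones v ++ S j))) := by
  refine .seq (runs_move₂ hia hij hja.symm (ones v) [] (by simpa using hi) (by simp) rfl
    (by simpa [ha] using hca) (by simpa using hcj)) (Runs.of_eq (runs_moveAll hia.symm ?_) ?_)
  · simpa [hij, hia, hja.symm, ha] using hci
  · funext x
    by_cases hx : x = i
    · subst hx; simp [hij, hia, hja.symm, hi, ha]
    · by_cases hx' : x = j
      · subst hx'; simp [hx, hja]
      · by_cases hx'' : x = a
        · subst hx''; simp [hx, hx', ha]
        · simp [hx, hx', hx'']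

/-- Write the table of the identity function on the stack `tab` and fill the counter. -/
def idProg : Prog (Reg m) (Sym m) :=
  .seq (copyProg .num .tmp .aux) (.loop .tmp (fun _ => true) fun _ =>
    .seq (.push .tab (.inl false)) (.seq (copyProg .tmp .tab .aux) (copyProg .num .cnt .aux)))

theorem encFun_id : (encFun (id : Fin (n + 2) → Fin (n + 2)) : List (Sym m)) =
    (List.range (n + 2)).flatMap un := by
  rw [encFun, ← List.map_coe_finRange_eq_range, List.flatMap_map]
  rfl

/-- The table of the identity is built from its last entry to its first while `tmp` counts down.
Each of the `n + 2` rounds adds `n + 2` ones to the counter, whose value finally is `2 ^ ((n + 2) *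
(n + 2)) - 1`. -/
theorem runs_idLoop (hR : Roomy n cap) (s : Mem m) (haux : s.aux = []) (hnum : s.num = ones (n + 2))
    (t : ℕ) (ht : t ≤ n + 2) :
    Runs cap (.loop .tmp (fun _ => true) fun _ =>
        .seq (.push .tab (.inl false)) (.seq (copyProg .tmp .tab .aux) (copyProg .num .cnt .aux)))
      { s with
        tmp := ones t, tab := ((List.range (n + 2)).drop t).flatMap un
        cnt := ones ((n + 2 - t) * (n + 2)) }.fn
      (.inl { s with tmp := [], tab := encFun (n := n) id, cnt := ones ((n + 2) * (n + 2)) }.fn) := by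
  have hn := add_two_le_room (n := n)
  have ctab := hR .tab (by simp) (by simp)
  have ctmp := hR .tmp (by simp) (by simp)
  have cnum := hR .num (by simp) (by simp)
  have ccnt := hR .cnt (by simp) (by simp)
  have caux := hR .aux (by simp) (by simp)
  induction t with
  | zero =>
    refine Runs.of_eq (.loop_done rfl) ?_
    rw [encFun_id]
    simp
  | succ t ih =>
    have e : (List.range (n + 2)).drop t = t :: (List.range (n + 2)).drop (t + 1) := by
      rw [List.drop_eq_getElem_cons (by simp; omega)]
      simp
    have hl := length_encFun (m := m) (n := n) id
    rw [encFun_id, ← List.take_append_drop t (List.range (n + 2)), List.flatMap_append, e,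
      List.flatMap_cons, List.length_append, List.length_append, length_un] at hl
    have hm : (n + 2 - (t + 1)) * (n + 2) + (n + 2) ≤ room n := by
      rw [← Nat.succ_mul]
      exact Nat.mul_le_mul (by omega) (by omega)
    refine .loop_step (a := .inl true) (l := ones t) rfl rfl ?_ (ih (by omega))
    simp only [Mem.update_tmp]
    refine .seq (.push ?_) ?_
    · simp only [Mem.fn_tab]; omega
    simp only [Mem.update_tab, Mem.fn_tab]
    refine .seq (runs_copyProg (by simp) (by simp) (by simp) t rfl haux ?_ (by omega) (by omega)) ?_
    · simp only [Mem.fn_tab, List.length_cons]; omega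
    simp only [Mem.update_tab, Mem.fn_tab]
    refine Runs.of_eq (runs_copyProg (by simp) (by simp) (by simp) (n + 2) hnum haux ?_ (by omega)
      (by omega)) ?_
    · simp only [Mem.fn_cnt, length_ones]; omega
    · simp only [Mem.update_cnt, Mem.fn_cnt, e, ones_append_ones]
      have : n + 2 + (n + 2 - (t + 1)) * (n + 2) = (n + 2 - t) * (n + 2) := by
        rw [show n + 2 - t = n + 2 - (t + 1) + 1 by omega, Nat.succ_mul, Nat.add_comm]
      rw [this]
      simp [un]

theorem runs_idProg (hR : Roomy n cap) (s : Mem m) (haux : s.aux = []) (hnum : s.num = ones (n + 2))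
    (htmp : s.tmp = []) (htab : s.tab = []) (hcnt : s.cnt = []) :
    Runs cap idProg s.fn (.inl { s with
      tab := encFun (n := n) id, cnt := ones ((n + 2) * (n + 2)) }.fn) := by
  have hn := add_two_le_room (n := n)
  have ctmp := hR .tmp (by simp) (by simp)
  have cnum := hR .num (by simp) (by simp)
  have caux := hR .aux (by simp) (by simp)
  refine .seq (runs_copyProg (by simp) (by simp) (by simp) (n + 2) hnum haux ?_ (by omega) (by omega)) ?_
  · simp [htmp]; omega
  simp only [Mem.update_tmp, Mem.fn_tmp, htmp, List.append_nil]
  have := runs_idLoop hR s haux hnum (n + 2) le_rfl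
  have e : (List.range (n + 2)).drop (n + 2) = [] := by simp
  rw [e, Nat.sub_self, Nat.zero_mul] at this
  have e2 : ({ s with tmp := ones (n + 2), tab := [], cnt := [] } : Mem m) =
      { s with tmp := ones (n + 2) } := by rw [htab, hcnt]
  rw [← e2]
  exact this

/-- The counter runs long enough for the number of pairs (state, behaviour), because `n + 2 ≤ 2 ^ (n
+ 1)` and `(n + 1) * (n + 3) ≤ (n + 2) * (n + 2)`. -/
theorem pow_le_two_pow (n : ℕ) : (n + 2) ^ (n + 3) ≤ 2 ^ ((n + 2) * (n + 2)) - 1 + 1 := by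
  have h1 : n + 2 ≤ 2 ^ (n + 1) := Nat.lt_two_pow_self
  rw [Nat.sub_add_cancel Nat.one_le_two_pow]
  calc (n + 2) ^ (n + 3) ≤ (2 ^ (n + 1)) ^ (n + 3) := Nat.pow_le_pow_left h1 _
    _ = 2 ^ ((n + 1) * (n + 3)) := by rw [pow_mul]
    _ ≤ _ := Nat.pow_le_pow_right (by norm_num) (by ring_nf; omega)

end Sim
namespace Sim

open Prog

variable {m k : ℕ} {cap : Reg m → ℕ}

/-! ## Reading codes -/

/-- The stacks `s` with the remaining input `u`. -/
def withInp (s : Mem m) (u : List Bool) : Mem m := { s with inp := u.map .inl }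

@[simp] theorem update_withInp (s : Mem m) (u v : List Bool) :
    Function.update (withInp s u).fn .inp (v.map .inl) = (withInp s v).fn := by
  simp [withInp]

/-- The program `p` reads the code of an object `a` from the input and then has stacks `post a`, or it
rejects if the input does not begin with a code. -/
def Reads (cap : Reg m → ℕ) (p : Prog (Reg m) (Sym m)) (s : Mem m) {α : Type} (enc : α → List Bool)
    (post : α → Mem m) : Prop :=
  ∀ u, (∃ a v, u = enc a ++ v ∧ Runs cap p (withInp s u).fn (.inl (withInp (post a) v).fn)) ∨
    ((∀ a v, u ≠ enc a ++ v) ∧ Runs cap p (withInp s u).fn (.inr false))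

/-- No code is a proper prefix of another one. -/
def PrefixFree {α : Type} (enc : α → List Bool) : Prop := ∀ a b u v, enc a ++ u = enc b ++ v → u = v

theorem PrefixFree.prod {α β : Type} {encA : α → List Bool} {encB : β → List Bool}
    (hA : PrefixFree encA) (hB : PrefixFree encB) :
    PrefixFree fun x : α × β => encA x.1 ++ encB x.2 := by
  intro a b u v h
  simp only [List.append_assoc] at h
  exact hB _ _ _ _ (hA _ _ _ _ h)

theorem prefixFree_unary : PrefixFree fun q : Fin k => unary q.val :=
  fun _ _ _ _ h => (unary_append_inj h).2

theorem prefixFree_encodeEntry :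
    PrefixFree (encodeEntry : Option (Option (Fin m) × Move × Fin k) → List Bool) :=
  fun _ _ _ _ h => (encodeEntry_append_inj h).2

theorem prefixFree_bits {j : ℕ} : PrefixFree fun l : { l : List Bool // l.length = j } => l.1 :=
  fun a b _ _ h => (List.append_inj h (by rw [a.2, b.2])).2

theorem PrefixFree.flatMap {α : Type} {enc : α → List Bool} (h : PrefixFree enc) {j : ℕ} :
    PrefixFree fun l : { l : List α // l.length = j } => l.1.flatMap enc := by
  rintro ⟨l, hl⟩ ⟨l', hl'⟩ u v e
  simp only at e
  induction l generalizing l' j with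
  | nil =>
    obtain rfl : l' = [] := List.eq_nil_of_length_eq_zero (hl'.trans hl.symm)
    simpa using e
  | cons a l ih =>
    rcases l' with _ | ⟨a', l'⟩
    · simp at hl hl'; omega
    · simp only [List.flatMap_cons, List.append_assoc] at e
      exact ih rfl l' (by simp at hl hl'; omega) (h _ _ _ _ e)

/-- Prefix-freeness matters when the second part fails: the first code is then the only possible
one, so no other decomposition of the input could succeed. -/
theorem Reads.seq {p q : Prog (Reg m) (Sym m)} {s : Mem m} {α β : Type} {encA : α → List Bool}
    {encB : β → List Bool} {postA : α → Mem m} {postB : α → β → Mem m} (hp : Reads cap p s encA postA)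
    (hA : PrefixFree encA) (hq : ∀ a, Reads cap q (postA a) encB (postB a)) :
    Reads cap (.seq p q) s (fun x : α × β => encA x.1 ++ encB x.2) fun x => postB x.1 x.2 := by
  intro u
  rcases hp u with ⟨a, v, rfl, h1⟩ | ⟨h0, h1⟩
  · rcases hq a v with ⟨b, v', rfl, h2⟩ | ⟨h0, h2⟩
    · exact Or.inl ⟨(a, b), v', by simp, .seq h1 h2⟩
    · refine Or.inr ⟨fun x v' e => ?_, .seq h1 h2⟩
      rw [List.append_assoc] at e
      exact h0 _ _ (hA _ _ _ _ e)
  · refine Or.inr ⟨fun x v' e => ?_, .seq_halt h1⟩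
    rw [List.append_assoc] at e
    exact h0 _ _ e

theorem Reads.seq_right {p q : Prog (Reg m) (Sym m)} {s : Mem m} {α : Type} {enc : α → List Bool}
    {post post' : α → Mem m} (hp : Reads cap p s enc post)
    (hq : ∀ a u, Runs cap q (withInp (post a) u).fn (.inl (withInp (post' a) u).fn)) :
    Reads cap (.seq p q) s enc post' := by
  intro u
  rcases hp u with ⟨a, v, rfl, h1⟩ | ⟨h0, h1⟩
  · exact Or.inl ⟨a, v, rfl, .seq h1 (hq a v)⟩
  · exact Or.inr ⟨h0, .seq_halt h1⟩

theorem Reads.seq_left {p q : Prog (Reg m) (Sym m)} {s s' : Mem m} {α : Type} {enc : α → List Bool}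
    {post : α → Mem m} (hp : ∀ u, Runs cap p (withInp s u).fn (.inl (withInp s' u).fn))
    (hq : Reads cap q s' enc post) : Reads cap (.seq p q) s enc post := by
  intro u
  rcases hq u with ⟨a, v, h, h1⟩ | ⟨h0, h1⟩
  · exact Or.inl ⟨a, v, h, .seq (hp u) h1⟩
  · exact Or.inr ⟨h0, .seq (hp u) h1⟩

theorem Reads.congr {p : Prog (Reg m) (Sym m)} {s : Mem m} {α β : Type} {encA : α → List Bool}
    {encB : β → List Bool} {postA : α → Mem m} {postB : β → Mem m} (h : Reads cap p s encA postA)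
    (f : α → β) (hf : Function.Surjective f) (henc : ∀ a, encB (f a) = encA a)
    (hpost : ∀ a, postB (f a) = postA a) : Reads cap p s encB postB := by
  intro u
  rcases h u with ⟨a, v, e, h1⟩ | ⟨h0, h1⟩
  · exact Or.inl ⟨f a, v, by rw [henc, e], by rw [hpost]; exact h1⟩
  · refine Or.inr ⟨fun b v e => ?_, h1⟩
    obtain ⟨a, rfl⟩ := hf b
    exact h0 a v (by rw [← henc, e])

/-- Read a unary number and continue with the program of that index in the list. -/
def readAlt : List (Prog (Reg m) (Sym m)) → Prog (Reg m) (Sym m)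
  | [] => .halt false
  | p :: ps => .case .inp fun a => match a with
    | some (.inl false) => p
    | some (.inl true) => readAlt ps
    | _ => .halt false

theorem runs_readAlt {s : Mem m} (ps : List (Prog (Reg m) (Sym m))) (i : ℕ) (hi : i < ps.length)
    (v : List Bool) {r} (h : Runs cap ps[i] (withInp s v).fn r) :
    Runs cap (readAlt ps) (withInp s (unary i ++ v)).fn r := by
  induction ps generalizing i with
  | nil => simp at hi
  | cons p ps ih =>
    rcases i with _ | i
    · refine .case_cons (a := .inl false) (l := v.map .inl) rfl ?_
      rw [update_withInp]
      exact h
    · refine .case_cons (a := .inl true) (l := (unary i ++ v).map .inl) rfl ?_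
      rw [update_withInp]
      exact ih i (by simpa using hi) h

theorem runs_readAlt_fail {s : Mem m} (ps : List (Prog (Reg m) (Sym m))) (u : List Bool)
    (h : ∀ i < ps.length, ∀ v, u ≠ unary i ++ v) :
    Runs cap (readAlt ps) (withInp s u).fn (.inr false) := by
  induction ps generalizing u with
  | nil => exact .halt _ _
  | cons p ps ih =>
    rcases u with _ | ⟨_ | _, u⟩
    · exact .case_nil rfl (.halt _ _)
    · exact absurd rfl (h 0 (by simp) u)
    · refine .case_cons (a := .inl true) (l := u.map .inl) rfl ?_
      rw [update_withInp]
      refine ih u fun i hi v e => h (i + 1) (by simpa using hi) v ?_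
      rw [e]
      rfl

/-- The value of a component with finitely many possibilities is not stored on a stack but
remembered in the control, as the choice of the alternative. -/
theorem Reads.alt {s : Mem m} {ι β : Type} (l : List ι) {encA : ι → List Bool}
    (hl : ∀ i (h : i < l.length), encA l[i] = unary i) (hmem : ∀ a, a ∈ l)
    (f : ι → Prog (Reg m) (Sym m)) {encB : β → List Bool} {post : ι → β → Mem m}
    (h : ∀ a, Reads cap (f a) s encB (post a)) :
    Reads cap (readAlt (l.map f)) s (fun x : ι × β => encA x.1 ++ encB x.2)
      fun x => post x.1 x.2 := by
  intro u
  by_cases hu : ∃ i < l.length, ∃ v, u = unary i ++ v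
  · obtain ⟨i, hi, v, rfl⟩ := hu
    rcases h l[i] v with ⟨b, v', rfl, h1⟩ | ⟨h0, h1⟩
    · exact Or.inl ⟨(l[i], b), v', by simp [hl i hi],
        runs_readAlt _ i (by simpa using hi) _ (by simpa using h1)⟩
    · refine Or.inr ⟨?_, runs_readAlt _ i (by simpa using hi) _ (by simpa using h1)⟩
      rintro ⟨a, b⟩ v' e
      obtain ⟨j, hj, rfl⟩ := List.getElem_of_mem (hmem a)
      rw [List.append_assoc, hl j hj] at e
      exact h0 b v' (unary_append_inj e).2
  · push Not at hu
    refine Or.inr ⟨?_, runs_readAlt_fail _ u (by simpa using hu)⟩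
    rintro ⟨a, b⟩ v e
    obtain ⟨j, hj, rfl⟩ := List.getElem_of_mem (hmem a)
    rw [List.append_assoc, hl j hj] at e
    exact hu j hj _ e

theorem eq_replicate_append (u : List Bool) :
    ∃ a v, u = List.replicate a true ++ v ∧ (v = [] ∨ ∃ v', v = false :: v') := by
  induction u with
  | nil => exact ⟨0, [], rfl, Or.inl rfl⟩
  | cons b u ih =>
    cases b
    · exact ⟨0, _, rfl, Or.inr ⟨u, rfl⟩⟩
    · obtain ⟨a, v, rfl, h⟩ := ih
      exact ⟨a + 1, v, rfl, h⟩

theorem replicate_ne_unary_append (a b : ℕ) (v : List Bool) :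
    List.replicate a true ≠ unary b ++ v := by
  intro e
  have : false ∈ List.replicate a true := by rw [e]; simp [unary]
  simp at this

theorem unary_append_eq (a : ℕ) (v : List Bool) :
    unary a ++ v = List.replicate a true ++ false :: v := by simp [unary]

/-! ## Reading states -/

/-- Read a state `q` and put `q + 2` on the stack `tmp`; reject unless `q` is less than the number of
states. -/
def readState : Prog (Reg m) (Sym m) :=
  .seq (.case .num fun _ => .push .num' (.inl true))
  (.seq (.case .num fun _ => .push .num' (.inl true))
  (.seq (.push .tmp (.inl true)) (.seq (.push .tmp (.inl true))
  (.seq (.loop .inp isOne fun _ => .case .num fun a =>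
      a.elim (.halt false) fun _ => .seq (.push .num' (.inl true)) (.push .tmp (.inl true)))
  (.seq (.case .inp fun a => match a with
    | some (.inl false) => .skip
    | _ => .halt false)
  (.seq (.case .num fun a => a.elim (.halt false) fun _ => .push .num (.inl true))
    (moveAll .num' .num)))))))

theorem runs_readStateLoop (hR : Roomy k cap) (s : Mem m) (v : List Bool)
    (hv : v = [] ∨ ∃ v', v = false :: v') (a i j : ℕ) (hij : i + j = k + 2) :
    Runs cap (.loop .inp isOne fun _ => .case .num fun a =>
      a.elim (.halt false) fun _ => .seq (.push .num' (.inl true)) (.push .tmp (.inl true)))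
      (withInp { s with num := ones j, num' := ones i, tmp := ones i } (List.replicate a true ++ v)).fn
      (if a ≤ j then .inl (withInp
        { s with num := ones (j - a), num' := ones (i + a), tmp := ones (i + a) } v).fn
        else .inr false) := by
  have c1 := hR .num' (by simp) (by simp)
  have c2 := hR .tmp (by simp) (by simp)
  have hn := add_two_le_room (n := k)
  induction a generalizing i j with
  | zero =>
    refine .loop_done ?_
    rcases hv with rfl | ⟨v', rfl⟩ <;> simp [withInp, isOne]
  | succ a ih =>
    rcases j with _ | j
    · refine .loop_halt (a := .inl true) (l := (List.replicate a true ++ v).map .inl) rfl rfl ?_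
      exact .case_nil rfl (.halt _ _)
    · have := ih (i + 1) j (by omega)
      rw [show i + (a + 1) = i + 1 + a by omega, Nat.add_sub_add_right]
      simp only [Nat.add_le_add_iff_right]
      refine .loop_step (a := .inl true) (l := (List.replicate a true ++ v).map .inl) rfl rfl
        (S' := (withInp { s with num := ones j, num' := ones (i + 1), tmp := ones (i + 1) }
          (List.replicate a true ++ v)).fn) ?_ this
      rw [update_withInp]
      refine .case_cons (a := .inl true) (l := ones j) rfl (.seq (.push ?_)
        (Runs.of_eq (.push ?_) ?_))
      · simp [withInp]; omega
      · simp [withInp]; omega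
      · simp [withInp, ones_succ]

/-- The `k + 2` ones on `num` check the range: two pay for the shift of the states, each one of the
input pays with another, and one has to be left at the end. -/
theorem reads_readState (hR : Roomy k cap) (s : Mem m) (hnum : s.num = ones (k + 2))
    (hnum' : s.num' = []) (htmp : s.tmp = []) :
    Reads cap readState s (fun q : Fin k => unary q.val) fun q => { s with tmp := ones (q.val + 2) } := by
  have c1 := hR .num' (by simp) (by simp)
  have c2 := hR .tmp (by simp) (by simp)
  have c3 := hR .num (by simp) (by simp)
  have hn := add_two_le_room (n := k)
  have pre : ∀ {q : Prog (Reg m) (Sym m)} {u : List Bool} {r},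
      Runs cap q (withInp { s with num := ones k, num' := ones 2, tmp := ones 2 } u).fn r →
      Runs cap (.seq (.case .num fun _ => .push .num' (.inl true))
        (.seq (.case .num fun _ => .push .num' (.inl true))
        (.seq (.push .tmp (.inl true)) (.seq (.push .tmp (.inl true)) q)))) (withInp s u).fn r := by
    intro q u r h
    refine .seq (.case_cons (a := .inl true) (l := ones (k + 1)) hnum
      (.push (by simp [withInp, hnum']; omega))) ?_
    refine .seq (.case_cons (a := .inl true) (l := ones k) (by simp [withInp, ones_succ])
      (.push (by simp [withInp, hnum']; omega))) ?_
    refine .seq (.push (by simp [withInp, htmp]; omega)) (.seq (.push (by simp [withInp, htmp]; omega)) ?_)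
    simpa [withInp, hnum', htmp, ones_succ] using h
  intro u
  obtain ⟨a, v, rfl, hv⟩ := eq_replicate_append u
  have hloop := runs_readStateLoop hR s v hv a 2 k (by omega)
  by_cases ha : a ≤ k
  swap
  · rw [if_neg ha] at hloop
    refine Or.inr ⟨fun q v' e => ?_, pre (.seq_halt hloop)⟩
    rcases hv with rfl | ⟨w, rfl⟩
    · exact replicate_ne_unary_append _ _ _ (by simpa using e)
    · rw [← unary_append_eq] at e
      have := (unary_append_inj e).1
      omega
  rw [if_pos ha] at hloop
  rcases hv with rfl | ⟨w, rfl⟩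
  · refine Or.inr ⟨fun q v' e => replicate_ne_unary_append _ _ _ (by simpa using e),
      pre (.seq hloop (.seq_halt (.case_nil rfl (.halt _ _))))⟩
  -- For `a = k` the loop still succeeds but uses up `num`; the test behind the loop rejects this
  -- value.
  rcases Nat.eq_or_lt_of_le ha with rfl | ha'
  · refine Or.inr ⟨fun q v' e => ?_, pre (.seq hloop (.seq (.case_cons (a := .inl false)
      (l := w.map .inl) rfl (.skip _)) (.seq_halt (.case_nil ?_ (.halt _ _)))))⟩
    · rw [← unary_append_eq] at e
      have := (unary_append_inj e).1
      omega
    · rw [update_withInp]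
      simp [withInp]
  · refine Or.inl ⟨⟨a, ha'⟩, w, (unary_append_eq _ _).symm, pre (.seq hloop (.seq
      (.case_cons (a := .inl false) (l := w.map .inl) rfl (.skip _)) ?_))⟩
    rw [update_withInp]
    obtain ⟨j, hj⟩ : ∃ j, k - a = j + 1 := ⟨k - a - 1, by omega⟩
    refine .seq (.case_cons (a := .inl true) (l := ones j) (by simp [withInp, hj, ones_succ])
      (.push (by simp [withInp]; omega))) (Runs.of_eq (runs_moveAll (by simp) ?_) ?_)
    · simp [withInp]; omega
    · simp [withInp, hnum, hnum', ← ones_succ, ones_append_ones]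
      rw [show 2 + a + (j + 1) = k + 2 by omega, Nat.add_comm 2 a]

/-! ## Reading the transition table -/

/-- Put the entry that leaves with the state `0` or `1` on the column `c`. -/
def emitConst (c : Option (Fin m)) (b : Bool) : Prog (Reg m) (Sym m) :=
  .seq (.push (.col c) (.inl false)) (.seq (if b then .push (.col c) (.inl true) else .skip)
    (.push (.col c) (.inr (none, exitMove c))))

theorem runs_emitConst (s : Mem m) (c : Option (Fin m)) (b : Bool)
    (hc : (s.col c).length + (k + 3) ≤ cap (.col c)) :
    Runs cap (emitConst c b) s.fn (.inl { s with
      col := Function.update s.col c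
        (encItem (n := k) (none, exitMove c, if b then 1 else 0) ++ s.col c) }.fn) := by
  refine .seq (.push (by simp; omega)) ?_
  cases b
  · refine .seq (.skip _) (Runs.of_eq (.push (by simp; omega)) ?_)
    simp [encItem, un]
  · refine .seq (.push (by simp; omega)) (Runs.of_eq (.push (by simp; omega)) ?_)
    simp [encItem, un, ones]

/-- Put the normal form of an entry on the column `c`; its new state is on the stack `tmp`. -/
def emit (b : Bool) (c s : Option (Fin m)) (d : Move) : Prog (Reg m) (Sym m) :=
  if b then .seq (drain .tmp) (emitConst c true)
  else if Writable c s then .seq (.push (.col c) (.inl false)) (.seq (moveAll .tmp (.col c))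
    (.push (.col c) (.inr (if c = none then s else none, d))))
  else .seq (drain .tmp) (emitConst c false)

theorem runs_emit (s : Mem m) (b : Bool) (c a : Option (Fin m)) (d : Move) (q : Fin k)
    (htmp : s.tmp = ones (q.val + 2)) (hc : (s.col c).length + (k + 3) ≤ cap (.col c)) :
    Runs cap (emit b c a d) s.fn (.inl { s with
      tmp := []
      col := Function.update s.col c
        (encItem (normalEntry b c (some (a, d, q))) ++ s.col c) }.fn) := by
  have key : ∀ b, Runs cap (.seq (drain .tmp) (emitConst c b)) s.fn (.inl { s with
      tmp := []
      col := Function.update s.col c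
        (encItem (n := k) (none, exitMove c, if b then 1 else 0) ++ s.col c) }.fn) := by
    intro b
    refine .seq runs_drain ?_
    simp only [Mem.update_tmp]
    exact runs_emitConst _ c b hc
  rw [emit, normalEntry]
  split
  · simpa using key true
  split
  · have := q.isLt
    refine .seq (.push (by simp; omega)) (.seq (runs_moveAll (by simp) (by simp [htmp]; omega))
      (Runs.of_eq (.push (by simp [htmp]; omega)) ?_))
    simp [htmp, encItem, un]
  · simpa using key false

/-- The columns in the order of the code. -/
def columns (m : ℕ) : List (Option (Fin m)) := none :: (List.finRange m).map some

theorem mem_columns (c : Option (Fin m)) : c ∈ columns m := by cases c <;> simp [columns]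

theorem nodup_columns : (columns m).Nodup := by
  simp [columns, List.nodup_finRange, List.nodup_map_iff (Option.some_injective _)]

theorem encodeCell_columns (i : ℕ) (h : i < (columns m).length) : encodeCell (columns m)[i] = unary i := by
  rcases i with _ | i <;> simp [columns, encodeCell]

def moves : List Move := [.left, .stay, .right]

theorem mem_moves (d : Move) : d ∈ moves := by cases d <;> simp [moves]

theorem encodeMove_moves (i : ℕ) (h : i < moves.length) : encodeMove moves[i] = unary i := by
  simp only [moves, List.length_cons, List.length_nil] at h
  interval_cases i <;> rfl

/-- Read an entry of the column `c` in the row of a state that is accepting if `b` is true. -/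
def entryProg (b : Bool) (c : Option (Fin m)) : Prog (Reg m) (Sym m) :=
  .case .inp fun a => match a with
    | some (.inl false) => emitConst c b
    | some (.inl true) => readAlt ((columns m).map fun s => readAlt (moves.map fun d =>
        .seq readState (emit b c s d)))
    | _ => .halt false

theorem reads_entryProg (hR : Roomy k cap) (s : Mem m) (b : Bool) (c : Option (Fin m))
    (hnum : s.num = ones (k + 2)) (hnum' : s.num' = []) (htmp : s.tmp = [])
    (hc : (s.col c).length + (k + 3) ≤ cap (.col c)) :
    Reads cap (entryProg b c) s (encodeEntry : Option (Option (Fin m) × Move × Fin k) → List Bool)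
      fun e => { s with
        col := Function.update s.col c (encItem (normalEntry b c e) ++ s.col c) } := by
  have h1 : ∀ a d, Reads cap (.seq readState (emit b c a d)) s (fun q : Fin k => unary q.val)
      fun q => { s with
        col := Function.update s.col c (encItem (normalEntry b c (some (a, d, q))) ++ s.col c) } := by
    intro a d
    refine (reads_readState hR s hnum hnum' htmp).seq_right fun q u => ?_
    refine Runs.of_eq (runs_emit _ b c a d q rfl hc) ?_
    simp [withInp, htmp]
  have h2 := fun a => Reads.alt moves (encA := encodeMove) encodeMove_moves mem_moves _ (h1 a)
  have h3 := Reads.alt (columns m) (encA := encodeCell) encodeCell_columns mem_columns _ h2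
  intro u
  rcases u with _ | ⟨_ | _, u⟩
  · refine Or.inr ⟨?_, .case_nil rfl (.halt _ _)⟩
    rintro (_ | ⟨a, d, q⟩) v e <;> simp [encodeEntry] at e
  · refine Or.inl ⟨none, u, rfl, .case_cons (a := .inl false) (l := u.map .inl) rfl ?_⟩
    rw [update_withInp]
    refine Runs.of_eq (runs_emitConst (k := k) _ c b hc) ?_
    cases b <;> simp [withInp, normalEntry]
  · rcases h3 u with ⟨⟨a, d, q⟩, v, rfl, h⟩ | ⟨h0, h⟩
    · refine Or.inl ⟨some (a, d, q), v, by simp [encodeEntry],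
        .case_cons (a := .inl true) (l := (encodeCell a ++ (encodeMove d ++ unary q.val) ++ v).map .inl)
          rfl ?_⟩
      rw [update_withInp]
      exact h
    · refine Or.inr ⟨?_, .case_cons (a := .inl true) (l := u.map .inl) rfl ?_⟩
      · rintro (_ | ⟨a, d, q⟩) v e
        · simp [encodeEntry] at e
        · refine h0 (a, d, q) v ?_
          simpa [encodeEntry] using e
      · rw [update_withInp]
        exact h

end Sim
namespace Sim

open Prog

variable {m k : ℕ} {cap : Reg m → ℕ}

/-! ## Reading machines -/

/-- Read the entries of a row in the given columns. -/
def rowProg (b : Bool) : List (Option (Fin m)) → Prog (Reg m) (Sym m)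
  | [] => .skip
  | c :: cs => .seq (entryProg b c) (rowProg b cs)

/-- A row of the transition table. -/
abbrev Row (m k : ℕ) : Type := Option (Fin m) → Option (Option (Fin m) × Move × Fin k)

theorem length_encItem_le (e : Option (Fin m) × Move × Fin (k + 2)) : (encItem e).length ≤ k + 3 := by
  rw [length_encItem]
  omega

theorem reads_rowProg (hR : Roomy k cap) (b : Bool) (cs : List (Option (Fin m))) (hcs : cs.Nodup)
    (s : Mem m) (hnum : s.num = ones (k + 2)) (hnum' : s.num' = []) (htmp : s.tmp = [])
    (hc : ∀ c ∈ cs, (s.col c).length + (k + 3) ≤ cap (.col c)) :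
    Reads cap (rowProg b cs) s (fun e : Row m k => cs.flatMap fun c => encodeEntry (e c))
      fun e => { s with
        col := fun c => if c ∈ cs then encItem (normalEntry b c (e c)) ++ s.col c else s.col c } := by
  induction cs generalizing s with
  | nil =>
    intro u
    exact Or.inl ⟨fun _ => none, u, rfl, Runs.of_eq (.skip _) (by simp)⟩
  | cons c cs ih =>
    simp only [List.nodup_cons] at hcs
    have h1 := reads_entryProg hR s b c hnum hnum' htmp (hc c (by simp))
    have h2 := fun e => ih hcs.2 { s with
        col := Function.update s.col c (encItem (normalEntry (k := k) b c e) ++ s.col c) } hnum hnum' htmp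
      (by
        intro c' hc'
        have : c' ≠ c := by rintro rfl; exact hcs.1 hc'
        simpa [this] using hc c' (by simp [hc']))
    -- A row on `c :: cs` is an entry for `c` and a row on `cs`; since `c` is not in `cs`,
    -- overwriting the row at `c` disturbs nothing else.
    refine (h1.seq prefixFree_encodeEntry h2).congr (fun x => Function.update x.2 c x.1) ?_ ?_ ?_
    · exact fun e => ⟨(e c, e), by simp⟩
    · rintro ⟨x, e⟩
      simp only [List.flatMap_cons, Function.update_self]
      congr 1
      refine List.flatMap_congr fun c' hc' => ?_
      have : c' ≠ c := by rintro rfl; exact hcs.1 hc'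
      simp [this]
    · rintro ⟨x, e⟩
      simp only
      congr 1
      funext c'
      by_cases h : c' = c
      · subst h; simp [hcs.1]
      · simp [h]

theorem prefixFree_row : PrefixFree fun e : Row m k => (columns m).flatMap fun c => encodeEntry (e c) := by
  intro a b u v h
  refine (flatMap_append_inj _ _ _ (fun c _ u v h => ?_) _ _ h).2
  obtain ⟨h, h'⟩ := encodeEntry_append_inj h
  exact ⟨by rw [h], h'⟩

/-- Read the rows; the accepting bits of the states are on the stack `acc'`. -/
def rowsProg : Prog (Reg m) (Sym m) :=
  .loop .acc' (fun _ => true) fun a => match a with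
    | .inl b => rowProg b (columns m)
    | _ => .skip

/-- The accepting bits both count the rows and decide their normal form, so one bit is consumed with
each row. A row adds at most `k + 3` symbols to a column. -/
theorem reads_rowsProg (hR : Roomy k cap) (bs : List Bool) (s : Mem m) (hnum : s.num = ones (k + 2))
    (hnum' : s.num' = []) (htmp : s.tmp = []) (hacc : s.acc' = bs.map .inl)
    (hc : ∀ c, (s.col c).length + bs.length * (k + 3) ≤ cap (.col c)) :
    Reads cap rowsProg s (fun l : { l : List (Row m k) // l.length = bs.length } =>
        l.1.flatMap fun e => (columns m).flatMap fun c => encodeEntry (e c))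
      fun l => { s with
        acc' := []
        col := fun c => ((bs.zip l.1).reverse.flatMap fun p => encItem (normalEntry p.1 c (p.2 c))) ++
          s.col c } := by
  induction bs generalizing s with
  | nil =>
    intro u
    refine Or.inl ⟨⟨[], rfl⟩, u, rfl, Runs.of_eq (.loop_done ?_) ?_⟩
    · simp [withInp, hacc]
    · simp [withInp, hacc]
  | cons b bs ih =>
    simp only [List.length_cons, Nat.succ_mul] at hc
    intro u
    have h1 := reads_rowProg hR b (columns m) nodup_columns { s with acc' := bs.map .inl } hnum hnum' htmp
      (fun c _ => by have := hc c; simp only; omega) u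
    have e0 : Function.update (withInp s u).fn .acc' (bs.map .inl) =
        (withInp { s with acc' := bs.map .inl } u).fn := by simp [withInp]
    rcases h1 with ⟨e, v, rfl, h1⟩ | ⟨h0, h1⟩
    · have h2 := ih { s with
          acc' := bs.map .inl
          col := fun c => if c ∈ columns m then encItem (normalEntry b c (e c)) ++ s.col c else s.col c }
        hnum hnum' htmp rfl (fun c => by
          have := hc c
          have := length_encItem_le (normalEntry b c (e c))
          simp only [mem_columns, if_true, List.length_append]
          omega) v
      rcases h2 with ⟨⟨l, hl⟩, v', rfl, h2⟩ | ⟨h0, h2⟩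
      · refine Or.inl ⟨⟨e :: l, by simp [hl]⟩, v', by simp, .loop_step (a := .inl b)
          (l := bs.map .inl) (by simp [withInp, hacc]) rfl (by rw [e0]; exact h1) ?_⟩
        refine Runs.of_eq h2 ?_
        simp [withInp, mem_columns]
      · refine Or.inr ⟨?_, .loop_step (a := .inl b)
          (l := bs.map .inl) (by simp [withInp, hacc]) rfl (by rw [e0]; exact h1) h2⟩
        rintro ⟨l, hl⟩ v' e'
        rcases l with _ | ⟨e₁, l⟩
        · simp at hl
        · simp only [List.flatMap_cons, List.append_assoc] at e'
          exact h0 ⟨l, by simpa using hl⟩ v' (prefixFree_row _ _ _ _ e')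
    · refine Or.inr ⟨?_, .loop_halt (a := .inl b)
          (l := bs.map .inl) (by simp [withInp, hacc]) rfl (by rw [e0]; exact h1)⟩
      rintro ⟨l, hl⟩ v' e'
      rcases l with _ | ⟨e₁, l⟩
      · simp at hl
      · simp only [List.flatMap_cons, List.append_assoc] at e'
        exact h0 _ _ e'

/-- Read one bit. -/
def bitProg : Prog (Reg m) (Sym m) :=
  .case .inp fun a => match a with
    | some (.inl b) => .push .acc (.inl b)
    | _ => .halt false

/-- Read as many bits as there are symbols on the stack `rows`. -/
def bitsProg : Prog (Reg m) (Sym m) :=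
  .loop .rows (fun _ => true) fun _ => bitProg

theorem reads_bitsProg (j : ℕ) (s : Mem m) (hrows : s.rows = ones j)
    (hacc : j + s.acc.length ≤ cap .acc) :
    Reads cap bitsProg s (fun l : { l : List Bool // l.length = j } => l.1) fun l => { s with
      rows := []
      acc := (l.1.map .inl).reverse ++ s.acc } := by
  induction j generalizing s with
  | zero =>
    intro u
    refine Or.inl ⟨⟨[], rfl⟩, u, rfl, Runs.of_eq (.loop_done ?_) ?_⟩
    · simp [withInp, hrows]
    · simp [withInp, hrows]
  | succ j ih =>
    intro u
    have hr : (withInp s u).fn .rows = .inl true :: ones j := by simp [withInp, hrows, ones_succ]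
    rcases u with _ | ⟨b, u⟩
    · refine Or.inr ⟨?_, .loop_halt hr rfl (.case_nil (by simp [withInp]) (.halt _ _))⟩
      rintro ⟨l, hl⟩ v e
      simp only [List.nil_eq, List.append_eq_nil_iff] at e
      simp [e.1] at hl
    · have h1 : Runs cap bitProg (Function.update (withInp s (b :: u)).fn .rows (ones j))
          (.inl (withInp { s with rows := ones j, acc := .inl b :: s.acc } u).fn) := by
        refine .case_cons (a := .inl b) (l := u.map .inl) (by simp [withInp]) (Runs.of_eq (.push ?_) ?_)
        · simp [withInp]; omega
        · simp [withInp]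
      rcases ih { s with rows := ones j, acc := .inl b :: s.acc } rfl (by simp; omega) u with
        ⟨⟨l, hl⟩, v, rfl, h2⟩ | ⟨h0, h2⟩
      · refine Or.inl ⟨⟨b :: l, by simp [hl]⟩, v, by simp, .loop_step hr rfl h1 (Runs.of_eq h2 ?_)⟩
        simp [withInp]
      · refine Or.inr ⟨?_, .loop_step hr rfl h1 h2⟩
        rintro ⟨l, hl⟩ v e
        rcases l with _ | ⟨b', l⟩
        · simp at hl
        · simp only [List.cons_append, List.cons.injEq] at e
          exact h0 ⟨l, by simpa using hl⟩ v e.2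

/-- Put the entries of the states `0` and `1` on the columns. -/
def constProg : List (Option (Fin m)) → Prog (Reg m) (Sym m)
  | [] => .skip
  | c :: cs => .seq (.seq (emitConst c false) (emitConst c true)) (constProg cs)

/-- The entries of the states `0` and `1`. -/
def constItems (k : ℕ) (c : Option (Fin m)) : List (Sym m) :=
  encItem (n := k) (none, exitMove c, 1) ++ encItem (n := k) (none, exitMove c, 0)

theorem length_constItems (c : Option (Fin m)) : (constItems k c).length = 5 := by
  rw [constItems, List.length_append, length_encItem, length_encItem]
  simp

theorem runs_constProg (hR : Roomy k cap) (cs : List (Option (Fin m))) (hcs : cs.Nodup) (s : Mem m)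
    (hs : ∀ c ∈ cs, s.col c = []) :
    Runs cap (constProg cs) s.fn (.inl { s with
      col := fun c => if c ∈ cs then constItems k c else s.col c }.fn) := by
  have hn : 3 * (k + 3) ≤ room k := Nat.mul_le_mul_right _ (by omega)
  induction cs generalizing s with
  | nil => simpa [constProg] using Runs.skip _
  | cons c cs ih =>
    simp only [List.nodup_cons] at hcs
    have hc := hR (.col c) (by simp) (by simp)
    have h0 := hs c (by simp)
    have h1 := runs_emitConst (k := k) (cap := cap) s c false (by rw [h0]; simp only [List.length_nil]; omega)
    have h2 := runs_emitConst (k := k) (cap := cap) { s with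
      col := Function.update s.col c (encItem (n := k) (none, exitMove c, 0) ++ s.col c) } c true
      (by rw [h0]; simp [-length_encItem]; simp; omega)
    refine .seq (.seq h1 h2) (Runs.of_eq (ih hcs.2 _ ?_) ?_)
    · intro c' hc'
      have : c' ≠ c := by rintro rfl; exact hcs.1 hc'
      simpa [this] using hs c' (by simp [hc'])
    · simp only
      congr 2
      funext c'
      by_cases h : c' = c
      · subst h; simp [hcs.1, constItems, h0]
      · simp [h]

/-- Read everything but the number of states. -/
def machineProg : Prog (Reg m) (Sym m) :=
  .seq (constProg (columns m)) (.seq (.seq readState (moveAll .tmp .st))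
    (.seq (.seq bitsProg (moveAll .acc .acc')) rowsProg))

/-- The stacks after the number of states has been read. -/
def sizeMem (m k : ℕ) : Mem m where
  inp := []
  rev := []
  num := ones (k + 2)
  num' := []
  tmp := []
  st := []
  tab := []
  new := []
  out := []
  bl := []
  aux := []
  sav := []
  cnt := []
  acc := []
  acc' := []
  rows := ones k
  col := fun _ => []

/-- The data of a machine: the initial state, the accepting bits and the rows. -/
abbrev MachineData (m k : ℕ) : Type :=
  Fin k × { l : List Bool // l.length = k } × { l : List (Row m k) // l.length = k }

/-- The code of a machine without the number of states. -/
def encData (x : MachineData m k) : List Bool :=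
  unary x.1.val ++ (x.2.1.1 ++ x.2.2.1.flatMap fun e => (columns m).flatMap fun c => encodeEntry (e c))

theorem prefixFree_encData : PrefixFree (encData : MachineData m k → List Bool) :=
  prefixFree_unary.prod (prefixFree_bits.prod prefixFree_row.flatMap)

theorem reads_machineProg (hR : Roomy k cap) :
    Reads cap machineProg (sizeMem m k) encData fun x : MachineData m k => { sizeMem m k with
      st := ones (x.1.val + 2)
      rows := []
      col := fun c => ((x.2.1.1.zip x.2.2.1).reverse.flatMap
        fun p => encItem (normalEntry p.1 c (p.2 c))) ++ constItems k c } := by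
  have hn := add_two_le_room (n := k)
  have hst := hR .st (by simp) (by simp)
  have hacc := hR .acc (by simp) (by simp)
  have hacc' := hR .acc' (by simp) (by simp)
  refine Reads.seq_left (s' := { sizeMem m k with col := fun c => constItems k c }) ?_ ?_
  · intro u
    refine Runs.of_eq (runs_constProg hR _ nodup_columns _ (fun _ _ => rfl)) ?_
    simp [withInp, mem_columns, sizeMem]
  refine Reads.seq (encB := fun x : { l : List Bool // l.length = k } × { l : List (Row m k) // l.length = k } =>
      x.1.1 ++ x.2.1.flatMap fun e => (columns m).flatMap fun c => encodeEntry (e c)) (postB := fun (q : Fin k) (x : { l : List Bool // l.length = k } × { l : List (Row m k) // l.length = k }) => { sizeMem m k with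
      st := ones (q.val + 2)
      rows := []
      col := fun c => ((x.1.1.zip x.2.1).reverse.flatMap
        fun p => encItem (normalEntry p.1 c (p.2 c))) ++ constItems k c }) (Reads.seq_right
    (post' := fun q : Fin k => { sizeMem m k with st := ones (q.val + 2), col := fun c => constItems k c })
    (reads_readState hR { sizeMem m k with col := fun c => constItems k c } rfl rfl rfl) ?_) prefixFree_unary ?_
  · intro q u
    refine Runs.of_eq (runs_moveAll (by simp) ?_) ?_
    · simp [withInp, sizeMem]
      omega
    · simp [withInp, sizeMem]
  intro q
  refine Reads.seq (encB := fun x : { l : List (Row m k) // l.length = k } =>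
      x.1.flatMap fun e => (columns m).flatMap fun c => encodeEntry (e c)) (postB := fun (bs : { l : List Bool // l.length = k }) (x : { l : List (Row m k) // l.length = k }) => { sizeMem m k with
      st := ones (q.val + 2)
      rows := []
      col := fun c => ((bs.1.zip x.1).reverse.flatMap
        fun p => encItem (normalEntry p.1 c (p.2 c))) ++ constItems k c }) (Reads.seq_right
    (post' := fun bs : { l : List Bool // l.length = k } => { sizeMem m k with
      st := ones (q.val + 2), col := constItems k, rows := [], acc' := bs.1.map .inl })
    (reads_bitsProg k { sizeMem m k with st := ones (q.val + 2), col := fun c => constItems k c } rfl ?_) ?_)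
    prefixFree_bits ?_
  · simp [sizeMem]
    omega
  · rintro ⟨bs, hbs⟩ u
    refine Runs.of_eq (runs_moveAll (by simp) ?_) ?_
    · simp [withInp, sizeMem, hbs]
      omega
    · simp [withInp, sizeMem]
  rintro ⟨bs, hbs⟩
  subst hbs
  exact reads_rowsProg hR bs { sizeMem m bs.length with
      st := ones (q.val + 2), col := constItems bs.length, rows := [], acc' := bs.map .inl }
    rfl rfl rfl rfl (fun c => by
      have hc := hR (.col c) (by simp) (by simp)
      rw [length_constItems]
      -- Five symbols for the states `0` and `1` and at most `k + 3` for each of the `k` rows.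
      refine le_trans ?_ hc
      rw [room]
      nlinarith)

end Sim
namespace Sim

open Prog

variable {m k : ℕ} {cap : Reg m → ℕ}

/-! ## Reading inputs -/

/-- Read the input and compute its behaviour. -/
def inputProg : Prog (Reg m) (Sym m) :=
  .loop .inp (fun _ => true) fun a =>
    .seq (.push .inp a) (readAlt ((List.finRange m).map readProg))

/-- The loop pops a symbol only to see that the input is not exhausted; the body puts it back before
parsing. One input symbol may take several bits, hence the strong induction on the length. -/
theorem runs_inputProg (hR : Roomy k cap) (τ : Table m k) (cnt : List (Sym m)) (u : List Bool)
    (hu : u.length ≤ cap .inp) (y) :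
    (∃ x, u = encodeInput x ∧ Runs cap inputProg (state τ (u.map .inl) cnt [] y).fn
      (.inl (state τ [] cnt [] (x.foldl τ.read y)).fn)) ∨
    ((∀ x : List (Fin m), u ≠ encodeInput x) ∧
      Runs cap inputProg (state τ (u.map .inl) cnt [] y).fn (.inr false)) := by
  induction hn : u.length using Nat.strong_induction_on generalizing u y with
  | _ n ih =>
    subst hn
    rcases u with _ | ⟨b, u⟩
    · exact Or.inl ⟨[], rfl, .loop_done rfl⟩
    have hpush : ∀ {q : Prog (Reg m) (Sym m)} {r},
        Runs cap q (withInp (state τ [] cnt [] y) (b :: u)).fn r →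
        Runs cap (.seq (.push .inp (.inl b)) q)
          (Function.update (state τ ((b :: u).map .inl) cnt [] y).fn .inp (u.map .inl)) r := by
      intro q r h
      refine .seq (.push ?_) ?_
      · simpa [state] using hu
      · simpa [withInp, state] using h
    by_cases h : ∃ i < m, ∃ v, b :: u = unary i ++ v
    · obtain ⟨i, hi, v, e⟩ := h
      have hl : v.length < (b :: u).length := by
        rw [e]
        simp [unary]
        omega
      have h1 : Runs cap (.seq (.push .inp (.inl b)) (readAlt ((List.finRange m).map readProg)))
          (Function.update (state τ ((b :: u).map .inl) cnt [] y).fn .inp (u.map .inl))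
          (.inl (state τ (v.map .inl) cnt [] (τ.read y ⟨i, hi⟩)).fn) := by
        refine hpush ?_
        rw [e]
        refine runs_readAlt _ i (by simpa using hi) v ?_
        simpa [withInp, state] using runs_readProg hR τ (v.map .inl) cnt y ⟨i, hi⟩
      rcases ih _ hl v (hl.le.trans hu) (τ.read y ⟨i, hi⟩) rfl with ⟨x, rfl, h2⟩ | ⟨h0, h2⟩
      · exact Or.inl ⟨⟨i, hi⟩ :: x, by rw [e]; simp [encodeInput],
          .loop_step (a := .inl b) (l := u.map .inl) rfl rfl h1 h2⟩
      · refine Or.inr ⟨?_, .loop_step (a := .inl b) (l := u.map .inl) rfl rfl h1 h2⟩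
        rintro (_ | ⟨a, x⟩) e'
        · simp [encodeInput] at e'
        · rw [e] at e'
          exact h0 x (unary_append_inj (b := a.val) (v := encodeInput x)
            (by simpa [encodeInput] using e')).2
    · push Not at h
      refine Or.inr ⟨?_, .loop_halt (a := .inl b) (l := u.map .inl) rfl rfl
        (hpush (runs_readAlt_fail _ _ (by simpa using h)))⟩
      rintro (_ | ⟨a, x⟩) e'
      · simp [encodeInput] at e'
      · exact h a.val a.isLt (encodeInput x) (by simpa [encodeInput] using e')

/-! ## Codes of machines -/

/-- The data of a machine. -/
def machineData (M : Machine m k) : MachineData m k :=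
  (M.start, ⟨(List.finRange k).map M.accept, by simp⟩, ⟨(List.finRange k).map M.trans, by simp⟩)

theorem machineData_surjective : Function.Surjective (machineData : Machine m k → MachineData m k) := by
  rintro ⟨q, ⟨bs, hb⟩, ⟨rs, hr⟩⟩
  refine ⟨⟨q, fun i => bs[i], fun i => rs[i]⟩, ?_⟩
  have e : ∀ {α : Type} (l : List α) (h : l.length = k), (List.finRange k).map (fun i => l[i]) = l := by
    rintro α l rfl
    exact List.ext_getElem (by simp) (by simp)
  simp only [machineData, Prod.mk.injEq, Subtype.mk.injEq, true_and]
  exact ⟨e bs hb, e rs hr⟩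

theorem encodeMachine_eq (M : Machine m k) : encodeMachine M = unary k ++ encData (machineData M) := by
  have e : encodeRow M = fun q => (columns m).flatMap fun c => encodeEntry (M.trans q c) := by
    funext q
    simp [encodeRow, columns, List.flatMap_map]
  simp [encodeMachine, encData, machineData, e, List.flatMap_map]

theorem encode_eq (M : Machine m k) (x : List (Fin m)) :
    encode M x = unary k ++ (encData (machineData M) ++ encodeInput x) := by
  rw [encode, encodeMachine_eq, List.append_assoc]

/-- The rows were pushed in order on top of the entries for `0` and `1`, which gives the column with
the last state on top. -/
theorem col_machineData (M : Machine m k) (c : Option (Fin m)) :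
    (((machineData M).2.1.1.zip (machineData M).2.2.1).reverse.flatMap
      fun p => encItem (normalEntry p.1 c (p.2 c))) ++ constItems k c = encCol M.table c := by
  rw [encCol, List.finRange_succ, List.finRange_succ]
  simp [machineData, List.zip_map', ← List.map_reverse, List.flatMap_map, constItems]

/-! ## The universal program -/

/-- Reverse the input and read the number of states. -/
def sizeProg : Prog (Reg m) (Sym m) :=
  .seq (moveAll .rev .inp) (.seq (move₂ .inp isOne .num .rows) (.seq
    (.case .inp fun a => match a with
      | some (.inl false) => .skip
      | _ => .halt false)
    (.seq (.push .num (.inl true)) (.push .num (.inl true)))))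

/-- The number of leading ones. -/
def leading (w : List Bool) : ℕ := (w.takeWhile id).length

theorem leading_unary (k : ℕ) (v : List Bool) : leading (unary k ++ v) = k := by
  simp [leading, unary]

theorem leading_replicate (k : ℕ) : leading (List.replicate k true) = k := by
  simp [leading]

theorem leading_le (w : List Bool) : leading w ≤ w.length := (List.takeWhile_sublist _).length_le

/-- The capacities must be fixed before it is known whether `w` is a code. The number of leading
ones is defined for every word and is the number of states if `w` is a code. -/
theorem runs_sizeProg (w : List Bool) (hR : Roomy (leading w) cap) (hinp : w.length ≤ cap .inp) :
    (∃ k v, w = unary k ++ v ∧ Runs cap sizeProg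
      (Function.update (fun _ => []) .rev (w.map .inl).reverse) (.inl (withInp (sizeMem m k) v).fn)) ∨
    ((∀ k v, w ≠ unary k ++ v) ∧ Runs cap sizeProg
      (Function.update (fun _ => []) .rev (w.map .inl).reverse) (.inr false)) := by
  have e0 : (fun _ => [] : Reg m → List (Sym m)) = (Mem.fn
      ⟨[], [], [], [], [], [], [], [], [], [], [], [], [], [], [], [], fun _ => []⟩) := by
    funext r; cases r <;> rfl
  have c1 := hR .num (by simp) (by simp)
  have c2 := hR .rows (by simp) (by simp)
  have hn := add_two_le_room (n := leading w)
  have pre : ∀ (a : ℕ) (v : List Bool) (hv : v = [] ∨ ∃ v', v = false :: v')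
      (e : w = List.replicate a true ++ v) (ha : a = leading w) {q : Prog (Reg m) (Sym m)} {r},
      Runs cap q (withInp { sizeMem m a with num := ones a } v).fn r →
      Runs cap (.seq (moveAll .rev .inp) (.seq (move₂ .inp isOne .num .rows) q))
        (Function.update (fun _ => []) .rev (w.map .inl).reverse) r := by
    intro a v hv e ha q r h
    rw [e0]
    simp only [Mem.update_rev]
    refine .seq (runs_moveAll (by simp) (by simpa using hinp)) (.seq (runs_move₂ (l := ones a)
      (r := v.map .inl) (by simp) (by simp) (by simp) ?_ isOne_of_mem_ones ?_ ?_ ?_) ?_)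
    · simp [e, ones]
    · rcases hv with rfl | ⟨v', rfl⟩ <;> simp [isOne]
    · simp; omega
    · simp; omega
    · simpa [withInp, sizeMem] using h
  obtain ⟨a, v, e, hv⟩ := eq_replicate_append w
  have ha : a = leading w := by
    rcases hv with rfl | ⟨v', rfl⟩
    · rw [e, List.append_nil, leading_replicate]
    · rw [e, ← unary_append_eq, leading_unary]
  rcases hv with rfl | ⟨v', rfl⟩
  · refine Or.inr ⟨fun k v e' => ?_, pre a [] (Or.inl rfl) e ha (.seq_halt (.case_nil rfl (.halt _ _)))⟩
    rw [e, List.append_nil] at e'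
    exact replicate_ne_unary_append _ _ _ e'
  · refine Or.inl ⟨a, v', by rw [e, unary_append_eq], pre a _ (Or.inr ⟨v', rfl⟩) e ha (.seq
      (.case_cons (a := .inl false) (l := v'.map .inl) rfl (.skip _)) ?_)⟩
    rw [update_withInp]
    refine .seq (.push (by simp [withInp]; omega)) (Runs.of_eq (.push (by simp [withInp]; omega)) ?_)
    simp [withInp, sizeMem, ones_succ]

/-- The decision procedure for the acceptance problem. -/
def mainProg : Prog (Reg m) (Sym m) :=
  .seq sizeProg (.seq machineProg (.seq idProg (.seq blankProg (.seq inputProg decideProg))))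

theorem mem_acceptanceProblem {M : Machine m k} {x : List (Fin m)} :
    encode M x ∈ acceptanceProblem m ↔ M.Accepts x := by
  constructor
  · rintro ⟨k', M', x', e, h⟩
    obtain ⟨rfl, hM, rfl⟩ := encode_inj e
    rwa [eq_of_heq hM]
  · exact fun h => ⟨k, M, x, rfl, h⟩

theorem runs_mainProg (w : List Bool) (hR : Roomy (leading w) cap) (hinp : w.length ≤ cap .inp) :
    ∃ b, (b = true ↔ w ∈ acceptanceProblem m) ∧ Runs cap mainProg
      (Function.update (fun _ => []) .rev (w.map .inl).reverse) (.inr b) := by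
  rcases runs_sizeProg w hR hinp with ⟨k, v, rfl, h1⟩ | ⟨h0, h1⟩
  swap
  · refine ⟨false, ?_, .seq_halt h1⟩
    simp only [Bool.false_eq_true, false_iff]
    rintro ⟨k, M, x, e, _⟩
    exact h0 _ _ (e.trans (encode_eq M x))
  rw [leading_unary] at hR
  rcases reads_machineProg hR v with ⟨d, u, rfl, h2⟩ | ⟨h0, h2⟩
  swap
  · refine ⟨false, ?_, .seq h1 (.seq_halt h2)⟩
    simp only [Bool.false_eq_true, false_iff]
    rintro ⟨k', M, x, e, _⟩
    rw [encode_eq] at e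
    obtain ⟨rfl, e⟩ := unary_append_inj e
    exact h0 _ _ e
  -- Whatever data have been read are those of some machine, so the columns hold its normal form.
  obtain ⟨M, rfl⟩ := machineData_surjective d
  simp only [col_machineData] at h2
  set q : Fin (k + 2) := M.start.succ.succ with hq
  have h3 := runs_idProg hR { sizeMem m k with
    inp := u.map .inl, st := ones q, rows := [], col := encCol M.table } rfl rfl rfl rfl rfl
  have h4 := runs_blankProg hR M.table (u.map .inl) (ones ((k + 2) * (k + 2))) [] (q, id)
  have hu : u.length ≤ cap .inp := by
    refine le_trans ?_ hinp
    simp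
    omega
  have key : ∀ {p : Prog (Reg m) (Sym m)} {r},
      Runs cap p (state M.table (u.map .inl) (ones ((k + 2) * (k + 2))) [] (q, id)).fn r →
      Runs cap (.seq sizeProg (.seq machineProg (.seq idProg (.seq blankProg p))))
        (Function.update (fun _ => []) .rev
          ((unary k ++ (encData (machineData M) ++ u)).map .inl).reverse) r :=
    fun h => .seq h1 (.seq h2 (.seq h3 (.seq h4 h)))
  rcases runs_inputProg hR M.table (ones ((k + 2) * (k + 2))) u hu (q, id) with
    ⟨x, rfl, h5⟩ | ⟨h0, h5⟩
  · refine ⟨_, ?_, key (.seq h5 (runs_decideProg hR M.table _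
      (Nat.mul_le_mul (by omega) (by omega)) _))⟩
    rw [← encode_eq, mem_acceptanceProblem, M.accepts_iff_table,
      M.normal_table.accepts_iff _ _ (pow_le_two_pow k), decide_eq_true_iff]
  · refine ⟨false, ?_, key (.seq_halt h5)⟩
    simp only [Bool.false_eq_true, false_iff]
    rintro ⟨k', M', x, e, _⟩
    rw [encode_eq] at e
    obtain ⟨rfl, e⟩ := unary_append_inj e
    exact h0 x (prefixFree_encData _ _ _ _ e)

/-! ## Space -/

/-- The room that is given to the stacks. -/
def space (w : List Bool) : Reg m → ℕ
  | .inp => w.length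
  | .rev => w.length
  | _ => room (leading w)

theorem roomy_space (w : List Bool) : Roomy (leading w) (space w : Reg m → ℕ) := by
  intro r h1 h2
  cases r <;> first | exact absurd rfl h1 | exact absurd rfl h2 | exact le_rfl

theorem sum_space_le (w : List Bool) :
    ∑ r : Reg m, space w r ≤ 2 * w.length + Fintype.card (Reg m) * room (leading w) := by
  have h : ∀ r : Reg m, space w r ≤
      (if r = .inp then w.length else 0) + (if r = .rev then w.length else 0) + room (leading w) := by
    intro r
    cases r <;> simp [space]
  refine (Finset.sum_le_sum fun r _ => h r).trans (le_of_eq ?_)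
  simp [Finset.sum_add_distrib, two_mul]

/-- The Turing machine for the acceptance problem. -/
noncomputable def universal (m : ℕ) : TM2ComputableAux Bool Bool :=
  (mainProg : Prog (Reg m) (Sym m)).machine .rev Sum.inl

/-- Three stacks are bounded by the length of `w`: `inp`, `rev` and the stack for input and output,
which has one more cell for the answer. The other stacks need only room in terms of the leading
ones. -/
theorem universal_spec (w : List Bool) :
    (∃ (c : (universal m).tm.Cfg) (b : Bool), Occurs (universal m) w c ∧ c.l = none ∧
      c.stk (universal m).tm.k₁ = [(universal m).outputAlphabet.symm b] ∧
      (b = true ↔ w ∈ acceptanceProblem m)) ∧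
    RunsInSpace (universal m) w
      (3 * w.length + 1 + Fintype.card (Reg m) * room (leading w)) := by
  obtain ⟨b, hb, h⟩ := runs_mainProg (m := m) w (roomy_space w) le_rfl
  obtain ⟨⟨c, h1, h2, h3⟩, h4⟩ := machine_spec (mainProg : Prog (Reg m) (Sym m)) .rev Sum.inl w b (space w) le_rfl h
  refine ⟨⟨c, b, h1, h2, h3, hb⟩, fun c hc => (h4 c hc).trans ?_⟩
  have := sum_space_le (m := m) w
  omega

theorem decides_universal : Decides (universal m) (acceptanceProblem m) :=
  fun w => (universal_spec w).1

theorem acceptanceProblem_mem_PSPACE : acceptanceProblem m ∈ PSPACE := by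
  refine ⟨universal m, 3 * .X + 1 + .C (Fintype.card (Reg m)) * ((.X + 3) * (.X + 3)),
    decides_universal, fun w c hc => ((universal_spec w).2 c hc).trans ?_⟩
  have h : room (leading w) ≤ room w.length :=
    Nat.mul_le_mul (Nat.add_le_add_right (leading_le w) 3) (Nat.add_le_add_right (leading_le w) 3)
  have h' := Nat.mul_le_mul_left (Fintype.card (Reg m)) h
  simpa using h'

/-! ### Lengths of codes -/

theorem length_encodeEntry_le (e : Option (Option (Fin m) × Move × Fin k)) :
    (encodeEntry e).length ≤ m + k + 5 := by
  rcases e with _ | ⟨s, d, q⟩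
  · simp [encodeEntry]
  · have h1 : (encodeCell s).length ≤ m + 1 := by
      rcases s with _ | a
      · simp [encodeCell, unary]
      · have := a.isLt
        simp [encodeCell, unary]
    have h2 : (encodeMove d).length ≤ 3 := by cases d <;> simp [encodeMove, unary]
    have h3 := q.isLt
    simp only [encodeEntry, unary, List.length_cons, List.length_append, List.length_replicate,
      List.length_nil]
    omega

theorem length_encode_le (M : Machine m k) (x : List (Fin m)) :
    (encode M x).length ≤ 3 * k + 2 + k * ((m + 1) * (m + k + 5)) + m * x.length := by
  have h1 : (encodeInput x).length ≤ x.length * m :=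
    length_flatMap_le x _ m fun a _ => by simp [unary]
  have h2 : (encData (machineData M)).length ≤ 2 * k + 1 + k * ((m + 1) * (m + k + 5)) := by
    have h3 := length_flatMap_le (machineData M).2.2.1
      (fun e => (columns m).flatMap fun c => encodeEntry (e c)) ((m + 1) * (m + k + 5)) fun e _ => by
        have := length_flatMap_le (columns m) (fun c => encodeEntry (e c)) (m + k + 5)
          fun c _ => length_encodeEntry_le _
        simpa [columns] using this
    rw [(machineData M).2.2.2] at h3
    have h4 := (machineData M).2.1.2
    have h5 := M.start.isLt
    rw [encData, List.length_append, List.length_append, h4]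
    simp only [unary, machineData, List.length_append, List.length_replicate, List.length_cons,
      List.length_nil] at h3 ⊢
    omega
  rw [encode_eq, List.length_append, List.length_append, Nat.mul_comm m]
  simp only [unary, List.length_append, List.length_replicate, List.length_cons, List.length_nil]
  omega

theorem exists_universal : ∃ (U : TM2ComputableAux Bool Bool) (g : ℕ → ℕ) (C : ℕ),
    Decides U (acceptanceProblem m) ∧ ∀ (k : ℕ) (M : Machine m k) (x : List (Fin m)),
      RunsInSpace U (encode M x) (g k + C * x.length) := by
  -- An input symbol has a code of at most `m` bits, and three stacks are linear in the length of
  -- the code, whence `C = 3 * m`.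
  refine ⟨universal m, fun k => 3 * (3 * k + 2 + k * ((m + 1) * (m + k + 5))) + 1 +
    Fintype.card (Reg m) * room k, 3 * m, decides_universal, fun k M x c hc =>
    ((universal_spec _).2 c hc).trans ?_⟩
  have h1 := length_encode_le M x
  have h2 : leading (encode M x) = k := by rw [encode_eq, leading_unary]
  rw [h2]
  simp only [Nat.mul_assoc]
  omega

end Sim
end WriteOnce

theorem mainTheorem6 (m : ℕ) (hm : 2 ≤ m) :
    (∃ (U : Turing.TM2ComputableAux Bool Bool) (g : ℕ → ℕ) (C : ℕ),
      WriteOnce.Decides U (WriteOnce.acceptanceProblem m) ∧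
      ∀ (k : ℕ) (M : WriteOnce.Machine m k) (x : List (Fin m)),
        WriteOnce.RunsInSpace U (WriteOnce.encode M x) (g k + C * x.length)) ∧
    WriteOnce.acceptanceProblem m ∈ WriteOnce.PSPACE ∧
    (∃ L : Language (Fin m), REPred (fun x : List (Fin m) => x ∈ L) ∧
      ∀ (k : ℕ) (M : WriteOnce.Machine m k) (e : List (Fin m) → List (Fin m)), Computable e →
        ¬ ∀ x : List (Fin m), x ∈ L ↔ M.Accepts (e x)) :=
  ⟨WriteOnce.Sim.exists_universal, WriteOnce.Sim.acceptanceProblem_mem_PSPACE,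
    WriteOnce.exists_re_not_reducible (by omega)⟩
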